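/- **Setting.** $\mathbf{CAT}$ is the 2-category of categories. For a category $B$, the lax slice $\mathbf{CAT}/\!/B$ has as objects the functors $F\colon A\to B$; as 1-cells from $F\colon A\to B$ to $F'\colon A'\to B$ the pairs $(\hat\alpha,\alpha)$ with $\hat\alpha\colon A\to A'$ a functor and $\alpha\colon F\Rightarrow F'\hat\alpha$; and as 2-cells $(\hat\alpha,\alpha)\Rightarrow(\hat\beta,\beta)$ the natural transformations $\delta\colon\hat\alpha\Rightarrow\hat\beta$ with $F'\delta\circ\alpha=\beta$. An $\mathcal F$-category is a 2-category of "loose" morphisms with a class of "tight" morphisms that contains the identities and is closed under composition; in $\mathbf{CAT}/\!/B$ the 1-cell $(\hat\alpha,\alpha)$ is tight when $\alpha$ is an identity. An $\mathcal F$-functor is a 2-functor between the loose parts that preserves tight morphisms. A *lax adjunction* from a 2-functor $F\colon\mathcal A\to\mathcal C$ to a 2-functor $U\colon\mathcal C\to\mathcal A$ consists of lax natural transformations $\eta\colon 1\Rightarrow UF$ (structure cells $\eta_f\colon UF(f)\eta_a\Rightarrow\eta_b f$) and $\varepsilon\colon FU\Rightarrow1$ and of modifications $s\colon 1_F\Rightarrow\varepsilon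 F\circ F\eta$ and $t\colon U\varepsilon\circ\eta U\Rightarrow 1_U$ such that both swallowtail pastings (of $Us$, $\eta_\eta$, $tF$ and of $sU$, $\varepsilon_\varepsilon$, $Ft$) are identities. It is *strict* if $s$ and $t$ are identities, *right semi-lax* if $\varepsilon$ is strictly 2-natural and $s$ is the identity, and a *loose $\mathcal F$-adjunction* if $F$ and $U$ are $\mathcal F$-functors and the structure cells of $\eta$ and $\varepsilon$ on tight morphisms are identities. **Change of base.** Let $\tau\colon E\to B$ be a functor with a split normal cleavage of opcartesian lifts (a split Grothendieck opfibration). The $\mathcal F$-functor $\tau^*\colon\mathbf{CAT}/\!/B\to\mathbf{CAT}/\!/E$ sends $F\colon A\to B$ to the projection $\tau^*F\colon A\times_BE\to E$; it sends $(\hat\alpha,\alpha)\colon F\to F'$ to the 1-cell whose functor part is $(a,e)\mapsto(\hat\alpha a,e')$, where $e\to e'$ is the chosen lift of $\alpha_a$ at $e$, and whose 2-cell consists of these chosen lifts; it sends $\delta$ to the transformation whose component at $(a,e)$ is $\delta_a$ together with the chosen lift of $F'(\delta_a)$. **The right adjoint.** For $H\colon D\to E$ let $\mathcal H$ be the following category.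 Objects are pairs $(X,(\hat\alpha,\alpha))$ with $X\in B$, $\hat\alpha\colon\tau^{-1}(X)\to D$ a functor on the fibre and $\alpha\colon U_X\Rightarrow H\hat\alpha$, where $U_X\colon\tau^{-1}(X)\to E$ is the inclusion. A morphism $(X,(\hat\alpha,\alpha))\to(X',(\hat\beta,\beta))$ is an $f\colon X\to X'$ with an assignment $\hat\Phi$ of a morphism $\hat\Phi(g)\colon\hat\alpha(e)\to\hat\beta(e')$ to each $g\colon e\to e'$ over $f$, compatible with composition with vertical morphisms on both sides, and with $H(\hat\Phi(g))\,\alpha_e=\beta_{e'}\,g$. The identity of $(X,(\hat\alpha,\alpha))$ is $g\mapsto\hat\alpha(g)$, and $(f',\hat\Phi')(f,\hat\Phi)$ sends $g$ over $f'f$ to $\hat\Phi'(g_2)\hat\Phi(g_1)$ for any factorization $g=g_2g_1$ with $g_1$ over $f$ and $g_2$ over $f'$. Let $\tau_*H\colon\mathcal H\to B$ be the projection. Postcomposition makes $\tau_*$ an $\mathcal F$-functor $\mathbf{CAT}/\!/E\to\mathbf{CAT}/\!/B$: it sends $(\hat\psi,\psi)\colon G\to H$ to the tight 1-cell $(X,(\hat\alpha,\alpha))\mapsto(X,(\hat\psi\hat\alpha,\psi\hat\alpha\circ\alpha))$,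 $(f,\hat\Phi)\mapsto(f,\hat\psi\hat\Phi)$, and a 2-cell $\Psi\colon(\hat\psi,\psi)\Rightarrow(\hat\chi,\chi)$ to the transformation whose component at $(X,(\hat\alpha,\alpha))$ lies over $1_X$ and is $g\mapsto\Psi_{\hat\alpha(e')}\,\hat\psi(\hat\alpha(g))$ for $g\colon e\to e'$ vertical over $X$. **Cocylinders.** Let $\mathcal A$ be an $\mathcal F$-category, $W\colon\mathcal A^{op}\to\mathcal F$ a weight (a 2-functor $W_\lambda\colon\mathcal A^{op}\to\mathbf{CAT}$ with a full subcategory of each $W_\lambda(a)$ that is preserved by tight morphisms) and $H\colon\mathcal A\to\mathcal S$ an $\mathcal F$-functor (an $\mathcal F$-diagram). An *oplax normal 2-cocylinder* on $C\in\mathcal S$ is an oplax natural transformation $\mu\colon W_\lambda\Rightarrow\mathcal S(H(-),C)$ whose structure cells on tight morphisms are identities. It is *universal* if for every $Q\in\mathcal S$ composition with $\mu$ is an isomorphism from $\mathcal S(C,Q)$ to the category of oplax normal 2-cocylinders on $Q$ and modifications. Its *$\lambda$-components* are the morphisms $\mu_a(X)\colon H(a)\to C$ for $a\in\mathcal A$,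 $X\in W_\lambda(a)$. **Theorem.** Let $\tau\colon E\to B$ be a split Grothendieck opfibration in $\mathbf{CAT}$. 1. There is a lax adjunction from $\tau^*\colon\mathbf{CAT}/\!/B\to\mathbf{CAT}/\!/E$ to $\tau_*\colon\mathbf{CAT}/\!/E\to\mathbf{CAT}/\!/B$ that is a loose $\mathcal F$-adjunction, right semi-lax and strict, and whose counit $\varepsilon_H\colon\tau^*\tau_*H\to H$ is evaluation: $\hat\varepsilon_H((X,(\hat\alpha,\alpha)),e)=\hat\alpha(e)$, $\hat\varepsilon_H((f,\hat\Phi),g)=\hat\Phi(g)$, with 2-cell $(\varepsilon_H)_{((X,(\hat\alpha,\alpha)),e)}=\alpha_e$. In particular $\tau^*$ has a strict right semi-lax loose right $\mathcal F$-adjoint. 2. Consequently $\tau^*$ preserves universal oplax normal 2-cocylinders for $\mathcal F$-diagrams with tight $\lambda$-components: if $H\colon\mathcal A\to\mathbf{CAT}/\!/B$ is an $\mathcal F$-diagram, $W$ a weight as above and $\mu\colon W_\lambda\Rightarrow(\mathbf{CAT}/\!/B)(H(-),C)$ is a universal oplax normal 2-cocylinder all of whose components $\mu_a(X)$ are tight,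 then $\tau^*\circ\mu\colon W_\lambda\Rightarrow(\mathbf{CAT}/\!/E)(\tau^*H(-),\tau^*C)$ is again a universal oplax normal 2-cocylinder with tight components. -/

import Mathlib

open CategoryTheory Bicategory Opposite
open Bicategory.Opposite

universe w v u w₁ v₁ u₁ w₂ v₂ u₂

namespace LaxChangeOfBase

/-- A 2-cell of a bicategory is an identity: its source and target are equal 1-cells and the
2-cell is the identity (transported along that equality). -/
def IsIdCell {S : Type u} [Bicategory.{w, v} S] {a b : S} {f g : a ⟶ b} (θ : f ⟶ g) : Prop :=
  ∃ h : f = g, θ = eqToHom h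

/-- The structure of an `F`-category (enhanced 2-category) on a 2-category `S` of loose morphisms:
a wide, locally full sub-2-category of tight morphisms. -/
class FCategory (S : Type u) [Bicategory.{w, v} S] where
  /-- The tight morphisms. -/
  Tight : ∀ {a b : S}, (a ⟶ b) → Prop
  tight_id : ∀ a : S, Tight (𝟙 a)
  tight_comp : ∀ {a b c : S} {f : a ⟶ b} {g : b ⟶ c}, Tight f → Tight g → Tight (f ≫ g)

/-- An `F`-functor: a (strict) 2-functor between the loose parts that preserves tightness. -/
structure FFunctor (S : Type u₁) [Bicategory.{w₁, v₁} S] [FCategory S]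
    (T : Type u₂) [Bicategory.{w₂, v₂} T] [FCategory T] extends StrictPseudofunctor S T where
  map_tight : ∀ {a b : S} (f : a ⟶ b), FCategory.Tight f → FCategory.Tight (map f)

section LaxAdjunction

variable {S : Type u₁} [Bicategory.{w₁, v₁} S] {T : Type u₂} [Bicategory.{w₂, v₂} T]

/-- A lax adjunction between 2-functors `F` and `U` (Gray's strict weak quasi-adjunction): lax
natural unit `η : 1 ⟶ U F` and counit `ε : F U ⟶ 1`, and modifications `s : 1 ⟶ ε F ∘ F η` and
`t : U ε ∘ η U ⟶ 1`, such that both swallowtail pasting composites are identities. The laws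
are those of 2-categories, written with the coherence 2-cells of `S`, `T`, `F` and `U`, which are
identities when `S` and `T` are 2-categories. -/
structure LaxAdjunction (F : StrictPseudofunctor S T) (U : StrictPseudofunctor T S) where
  /-- The lax natural unit, with structure 2-cells `η_a ≫ U F f ⟶ f ≫ η_b`. -/
  unit : Lax.LaxTrans (StrictPseudofunctor.id S).toLax (F.comp U).toLax
  /-- The lax natural counit, with structure 2-cells `ε_a ≫ g ⟶ F U g ≫ ε_b`. -/
  counit : Lax.LaxTrans (U.comp F).toLax (StrictPseudofunctor.id T).toLax
  /-- The components of the modification `s`. -/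
  s (a : S) : 𝟙 (F.obj a) ⟶ F.map (unit.app a) ≫ counit.app (F.obj a)
  /-- The components of the modification `t`. -/
  t (b : T) : unit.app (U.obj b) ≫ U.map (counit.app b) ⟶ 𝟙 (U.obj b)
  s_naturality {a a' : S} (f : a ⟶ a') :
    s a ▷ F.map f ≫ (α_ _ _ _).hom ≫
        F.map (unit.app a) ◁ counit.naturality (F.map f) ≫ (α_ _ _ _).inv ≫
        ((F.mapComp (unit.app a) (U.map (F.map f))).inv ≫ F.map₂ (unit.naturality f) ≫
          (F.mapComp f (unit.app a')).hom) ▷ counit.app (F.obj a') ≫ (α_ _ _ _).hom =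
      (λ_ (F.map f)).hom ≫ (ρ_ (F.map f)).inv ≫ F.map f ◁ s a'
  t_naturality {b b' : T} (g : b ⟶ b') :
    t b ▷ U.map g ≫ (λ_ (U.map g)).hom ≫ (ρ_ (U.map g)).inv =
      (α_ _ _ _).hom ≫
        unit.app (U.obj b) ◁ ((U.mapComp (counit.app b) g).inv ≫ U.map₂ (counit.naturality g) ≫
          (U.mapComp (F.map (U.map g)) (counit.app b')).hom) ≫ (α_ _ _ _).inv ≫
        unit.naturality (U.map g) ▷ U.map (counit.app b') ≫ (α_ _ _ _).hom ≫
        U.map g ◁ t b'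
  swallowtail_unit (a : S) :
    unit.app a ◁ ((U.mapId (F.obj a)).inv ≫ U.map₂ (s a) ≫
          (U.mapComp (F.map (unit.app a)) (counit.app (F.obj a))).hom) ≫ (α_ _ _ _).inv ≫
        unit.naturality (unit.app a) ▷ U.map (counit.app (F.obj a)) ≫ (α_ _ _ _).hom ≫
        unit.app a ◁ t (F.obj a) =
      𝟙 (unit.app a ≫ 𝟙 (U.obj (F.obj a)))
  swallowtail_counit (b : T) :
    s (U.obj b) ▷ counit.app b ≫ (α_ _ _ _).hom ≫
        F.map (unit.app (U.obj b)) ◁ counit.naturality (counit.app b) ≫ (α_ _ _ _).inv ≫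
        ((F.mapComp (unit.app (U.obj b)) (U.map (counit.app b))).inv ≫ F.map₂ (t b) ≫
          (F.mapId (U.obj b)).hom) ▷ counit.app b =
      𝟙 (𝟙 (F.obj (U.obj b)) ≫ counit.app b)

namespace LaxAdjunction

variable {F : StrictPseudofunctor S T} {U : StrictPseudofunctor T S} (adj : LaxAdjunction F U)

/-- The unit and the counit are loose strict/lax `F`-natural: their structure 2-cells on tight
morphisms are identities. (For `F` and `U` underlying `F`-functors this says that the lax
adjunction is a loose lax `F`-adjunction.) -/
def IsLooseFAdjunction [FCategory S] [FCategory T] : Prop :=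
  (∀ {a b : S} (f : a ⟶ b), FCategory.Tight f → IsIdCell (adj.unit.naturality f)) ∧
    ∀ {a b : T} (g : a ⟶ b), FCategory.Tight g → IsIdCell (adj.counit.naturality g)

/-- The counit is strictly 2-natural and `s` is the identity. -/
def IsRightSemiLax : Prop :=
  (∀ {a b : T} (g : a ⟶ b), IsIdCell (adj.counit.naturality g)) ∧ ∀ a : S, IsIdCell (adj.s a)

/-- Both `s` and `t` are identities. -/
def IsStrict : Prop :=
  (∀ a : S, IsIdCell (adj.s a)) ∧ ∀ b : T, IsIdCell (adj.t b)

end LaxAdjunction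

end LaxAdjunction

/-- An `F`-functor `W : Aᵒᵖ ⥤ F` into the `F`-category `F` of full embeddings of categories: a
2-functor of loose parts `W_λ : Aᵒᵖ ⥤ Cat` and a full subcategory `W_τ(a)` of each `W_λ(a)`, given by
its objects, which is preserved by the action of tight morphisms. -/
structure FWeight (A : Type u₁) [Bicategory.{w₁, v₁} A] [FCategory A] where
  /-- The 2-functor of loose parts. -/
  loose : StrictPseudofunctor Aᵒᵖ Cat.{w, v}
  /-- The objects of the tight parts. -/
  tightObj : ∀ a : A, loose.obj (op a) → Prop
  map_tightObj : ∀ {a b : A} (f : a ⟶ b), FCategory.Tight f →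
    ∀ X : loose.obj (op b), tightObj b X → tightObj a ((loose.map f.op).toFunctor.obj X)

section Cocylinder

variable {A : Type u₁} [Bicategory.{w₁, v₁} A] {S : Type u} [Bicategory.{w, v} S]
  {T : Type u₂} [Bicategory.{w, v} T]

/-- The 2-presheaf `S(H(-), C) : Aᵒᵖ ⥤ Cat`. -/
def homPresheaf (H : StrictPseudofunctor A S) (C : S) : Pseudofunctor Aᵒᵖ Cat.{w, v} where
  obj a := Cat.of (H.obj (unop a) ⟶ C)
  map f := (precomp C (H.map f.unop)).toCatHom
  map₂ η := NatTrans.toCatHom₂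
    { app := fun x => H.map₂ η.unop2 ▷ x
      naturality := fun x y θ => whisker_exchange (H.map₂ η.unop2) θ }
  map₂_id {a b} f := by
    ext (x : H.obj (unop a) ⟶ C)
    change H.map₂ (𝟙 f.unop) ▷ x = 𝟙 (H.map f.unop ≫ x)
    simp
  map₂_comp {a b f g h} η θ := by
    ext (x : H.obj (unop a) ⟶ C)
    change H.map₂ (η.unop2 ≫ θ.unop2) ▷ x = H.map₂ η.unop2 ▷ x ≫ H.map₂ θ.unop2 ▷ x
    simp
  mapId a := Cat.Hom.isoMk (NatIso.ofComponents
    (fun (x : H.obj (unop a) ⟶ C) => whiskerRightIso (H.mapId (unop a)) x ≪≫ λ_ x)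
    (fun {x y} θ => by
      change H.map (𝟙 (unop a)) ◁ θ ≫ (H.mapId (unop a)).hom ▷ y ≫ (λ_ y).hom =
        ((H.mapId (unop a)).hom ▷ x ≫ (λ_ x).hom) ≫ θ
      simp [whisker_exchange_assoc]))
  mapComp {a b c} f g := Cat.Hom.isoMk (NatIso.ofComponents
    (fun (x : H.obj (unop a) ⟶ C) =>
      whiskerRightIso (H.mapComp g.unop f.unop) x ≪≫ α_ (H.map g.unop) (H.map f.unop) x)
    (fun {x y} θ => by
      change H.map (g.unop ≫ f.unop) ◁ θ ≫ (H.mapComp g.unop f.unop).hom ▷ y ≫ (α_ _ _ _).hom =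
        ((H.mapComp g.unop f.unop).hom ▷ x ≫ (α_ _ _ _).hom) ≫ H.map g.unop ◁ H.map f.unop ◁ θ
      simp [whisker_exchange_assoc]))
  map₂_whisker_left {a b c} f g g' η := by
    ext (x : H.obj (unop a) ⟶ C)
    change H.map₂ (η.unop2 ▷ f.unop) ▷ x =
      ((H.mapComp g.unop f.unop).hom ▷ x ≫ (α_ _ _ _).hom) ≫
        H.map₂ η.unop2 ▷ (H.map f.unop ≫ x) ≫
          (α_ _ _ _).inv ≫ (H.mapComp g'.unop f.unop).inv ▷ x
    simp [← comp_whiskerRight]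
  map₂_whisker_right {a b c} f f' η g := by
    ext (x : H.obj (unop a) ⟶ C)
    change H.map₂ (g.unop ◁ η.unop2) ▷ x =
      ((H.mapComp g.unop f.unop).hom ▷ x ≫ (α_ _ _ _).hom) ≫
        H.map g.unop ◁ H.map₂ η.unop2 ▷ x ≫
          (α_ _ _ _).inv ≫ (H.mapComp g.unop f'.unop).inv ▷ x
    simp
  map₂_associator {a b c d} f g h := by
    ext (x : H.obj (unop a) ⟶ C)
    change H.map₂ (α_ h.unop g.unop f.unop).inv ▷ x =
      ((H.mapComp h.unop (g.unop ≫ f.unop)).hom ▷ x ≫ (α_ _ _ _).hom) ≫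
        H.map h.unop ◁ ((H.mapComp g.unop f.unop).hom ▷ x ≫ (α_ _ _ _).hom) ≫
        𝟙 _ ≫ ((α_ _ _ _).inv ≫ (H.mapComp h.unop g.unop).inv ▷ (H.map f.unop ≫ x)) ≫
        (α_ _ _ _).inv ≫ (H.mapComp (h.unop ≫ g.unop) f.unop).inv ▷ x
    have e : H.map₂ (α_ h.unop g.unop f.unop).inv =
        (H.mapComp h.unop (g.unop ≫ f.unop)).hom ≫ H.map h.unop ◁ (H.mapComp g.unop f.unop).hom ≫
          (α_ _ _ _).inv ≫ (H.mapComp h.unop g.unop).inv ▷ H.map f.unop ≫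
            (H.mapComp (h.unop ≫ g.unop) f.unop).inv := by
      rw [← cancel_epi (H.map₂ (α_ h.unop g.unop f.unop).hom), ← H.map₂_comp]
      simp
    rw [e]
    simp
  map₂_left_unitor {a b} f := by
    ext (x : H.obj (unop a) ⟶ C)
    change H.map₂ (ρ_ f.unop).hom ▷ x =
      ((H.mapComp f.unop (𝟙 _)).hom ▷ x ≫ (α_ _ _ _).hom) ≫
        H.map f.unop ◁ ((H.mapId (unop a)).hom ▷ x ≫ (λ_ x).hom) ≫ 𝟙 _
    simp
  map₂_right_unitor {a b} f := by
    ext (x : H.obj (unop a) ⟶ C)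
    change H.map₂ (λ_ f.unop).hom ▷ x =
      ((H.mapComp (𝟙 _) f.unop).hom ▷ x ≫ (α_ _ _ _).hom) ≫
        ((H.mapId (unop b)).hom ▷ (H.map f.unop ≫ x) ≫ (λ_ _).hom) ≫ 𝟙 _
    simp

/-- Postcomposition with `q : C ⟶ Q`, as a (strictly natural) transformation
`S(H(-), C) ⟶ S(H(-), Q)`. -/
def postcompTrans (H : StrictPseudofunctor A S) {C Q : S} (q : C ⟶ Q) :
    Oplax.OplaxTrans (homPresheaf H C).toOplax (homPresheaf H Q).toOplax where
  app a := (postcomp (H.obj (unop a)) q).toCatHom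
  naturality {a b} f := NatTrans.toCatHom₂
    { app := fun (x : H.obj (unop a) ⟶ C) => (α_ (H.map f.unop) x q).hom
      naturality := fun (x y : H.obj (unop a) ⟶ C) θ =>
        associator_naturality_middle (H.map f.unop) θ q }
  naturality_naturality {a b f g} η := by
    ext (x : H.obj (unop a) ⟶ C)
    change (H.map₂ η.unop2 ▷ x) ▷ q ≫ (α_ _ _ _).hom = (α_ _ _ _).hom ≫ H.map₂ η.unop2 ▷ (x ≫ q)
    simp
  naturality_id a := by
    ext (x : H.obj (unop a) ⟶ C)
    change (α_ _ _ _).hom ≫ (H.mapId (unop a)).hom ▷ (x ≫ q) ≫ (λ_ (x ≫ q)).hom =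
      ((H.mapId (unop a)).hom ▷ x ≫ (λ_ x).hom) ▷ q ≫ 𝟙 _ ≫ 𝟙 _
    simp
  naturality_comp {a b c} f g := by
    ext (x : H.obj (unop a) ⟶ C)
    change (α_ _ _ _).hom ≫ (H.mapComp g.unop f.unop).hom ▷ (x ≫ q) ≫ (α_ _ _ _).hom =
      ((H.mapComp g.unop f.unop).hom ▷ x ≫ (α_ _ _ _).hom) ▷ q ≫ 𝟙 _ ≫
        (α_ (H.map g.unop) (H.map f.unop ≫ x) q).hom ≫ 𝟙 _ ≫
        H.map g.unop ◁ (α_ (H.map f.unop) x q).hom ≫ 𝟙 _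
    simp

/-- The action of a 2-functor `F : S ⥤ T` on hom-categories, as a (strictly natural)
transformation `S(H(-), C) ⟶ T(F(H(-)), F(C))`. -/
def mapTrans (H : StrictPseudofunctor A S) (F : StrictPseudofunctor S T) (C : S) :
    Oplax.OplaxTrans (homPresheaf H C).toOplax (homPresheaf (H.comp F) (F.obj C)).toOplax where
  app a := (F.mapFunctor (H.obj (unop a)) C).toCatHom
  naturality {a b} f := NatTrans.toCatHom₂
    { app := fun (x : H.obj (unop a) ⟶ C) => (F.mapComp (H.map f.unop) x).hom
      naturality := fun (x y : H.obj (unop a) ⟶ C) θ =>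
        F.toOplax.mapComp_naturality_right (H.map f.unop) θ }
  naturality_naturality {a b f g} η := by
    ext (x : H.obj (unop a) ⟶ C)
    change F.map₂ (H.map₂ η.unop2 ▷ x) ≫ (F.mapComp _ _).hom =
      (F.mapComp _ _).hom ≫ F.map₂ (H.map₂ η.unop2) ▷ F.map x
    simp
  naturality_id a := by
    ext (x : H.obj (unop a) ⟶ C)
    change (F.mapComp _ _).hom ≫
        (F.map₂ (H.mapId (unop a)).hom ≫ (F.mapId (H.obj (unop a))).hom) ▷ F.map x ≫
          (λ_ (F.map x)).hom =
      F.map₂ ((H.mapId (unop a)).hom ▷ x ≫ (λ_ x).hom) ≫ 𝟙 _ ≫ 𝟙 _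
    simp
  naturality_comp {a b c} f g := by
    ext (x : H.obj (unop a) ⟶ C)
    change (F.mapComp _ _).hom ≫
        (F.map₂ (H.mapComp g.unop f.unop).hom ≫
          (F.mapComp (H.map g.unop) (H.map f.unop)).hom) ▷ F.map x ≫ (α_ _ _ _).hom =
      F.map₂ ((H.mapComp g.unop f.unop).hom ▷ x ≫ (α_ _ _ _).hom) ≫ 𝟙 _ ≫
        (F.mapComp (H.map g.unop) (H.map f.unop ≫ x)).hom ≫ 𝟙 _ ≫
        F.map (H.map g.unop) ◁ (F.mapComp (H.map f.unop) x).hom ≫ 𝟙 _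
    simp

variable (W : StrictPseudofunctor Aᵒᵖ Cat.{w, v}) (H : StrictPseudofunctor A S)

/-- Oplax 2-cocylinders `W ⟶ S(H(-), C)`: oplax natural transformations, with structure
2-cells `W(f) ≫ μ_b ⟶ μ_a ≫ S(H(f), C)`. -/
abbrev OplaxCocylinder (C : S) := Oplax.OplaxTrans W.toOplax (homPresheaf H C).toOplax

variable {W H}

/-- The cocylinder `(q ∘ -) ∘ μ`. -/
def OplaxCocylinder.postcomp {C Q : S} (μ : OplaxCocylinder W H C) (q : C ⟶ Q) :
    OplaxCocylinder W H Q :=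
  μ.vcomp (postcompTrans H q)

/-- The image `F ∘ μ` of a cocylinder under a 2-functor `F`. -/
def OplaxCocylinder.map {C : S} (μ : OplaxCocylinder W H C) (F : StrictPseudofunctor S T) :
    OplaxCocylinder W (H.comp F) (F.obj C) :=
  μ.vcomp (mapTrans H F C)

/-- Postcomposition with a 2-cell `δ : q ⟶ q'` of `S`, as a modification. -/
def postcompModification (H : StrictPseudofunctor A S) {C Q : S} {q q' : C ⟶ Q} (δ : q ⟶ q') :
    Oplax.OplaxTrans.Modification (postcompTrans H q) (postcompTrans H q') where
  app a := NatTrans.toCatHom₂ ((postcomposing (H.obj (unop a)) C Q).map δ)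
  naturality {a b} f := by
    ext (x : H.obj (unop a) ⟶ C)
    exact (associator_naturality_right (H.map f.unop) x δ)

open scoped Oplax.OplaxTrans in
/-- The modification `(δ ∘ -) * μ`. -/
def OplaxCocylinder.postcomp₂ {C Q : S} (μ : OplaxCocylinder W H C) {q q' : C ⟶ Q} (δ : q ⟶ q') :
    Oplax.OplaxTrans.Modification (μ.postcomp q) (μ.postcomp q') :=
  (Oplax.OplaxTrans.whiskerLeft μ
    (Oplax.OplaxTrans.Hom.of (postcompModification H δ))).as

/-- The component `μ_a(X) : H(a) ⟶ C` of a cocylinder at `a : A` and `X : W(a)`. -/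
def OplaxCocylinder.component {C : S} (μ : OplaxCocylinder W H C) (a : A)
    (X : W.obj (op a)) : H.obj a ⟶ C :=
  (μ.app (op a)).toFunctor.obj X

/-- Oplax normal cocylinders: the structure 2-cells on tight morphisms are identities. -/
def OplaxCocylinder.IsNormal [FCategory A] {C : S} (μ : OplaxCocylinder W H C) : Prop :=
  ∀ {a b : A} (f : a ⟶ b), FCategory.Tight f → IsIdCell (μ.naturality f.op)

/-- Universality of an (oplax normal) cocylinder `μ` on `C`: for every `Q`, composition with `μ` is an
isomorphism from the category `S(C, Q)` to the category of oplax normal cocylinders on `Q` and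
modifications; that is, it is bijective on objects and on morphisms. -/
structure OplaxCocylinder.IsUniversal [FCategory A] {C : S} (μ : OplaxCocylinder W H C) :
    Prop where
  existsUnique_desc {Q : S} (σ : OplaxCocylinder W H Q) : σ.IsNormal →
    ∃! q : C ⟶ Q, μ.postcomp q = σ
  existsUnique_desc₂ {Q : S} {q q' : C ⟶ Q}
    (Γ : Oplax.OplaxTrans.Modification (μ.postcomp q) (μ.postcomp q')) :
    ∃! δ : q ⟶ q', μ.postcomp₂ δ = Γ

end Cocylinder

/-- Objects of the lax slice of `CAT` over `B`. -/
structure LaxSlice (B : Type u) [Category.{u} B] where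
  dom : Cat.{u, u}
  proj : dom ⥤ B

namespace LaxSlice

variable {B : Type u} [Category.{u} B]

/-- A 1-cell of the lax slice: a functor `hat` with a 2-cell `proj ⟶ hat ⋙ proj`. -/
structure Hom (X Y : LaxSlice B) where
  hat : X.dom ⥤ Y.dom
  cell : X.proj ⟶ hat ⋙ Y.proj

/-- A 2-cell of the lax slice. -/
structure Hom₂ {X Y : LaxSlice B} (f g : Hom X Y) where
  hat : f.hat ⟶ g.hat
  w : ∀ x : X.dom, f.cell.app x ≫ Y.proj.map (hat.app x) = g.cell.app x

@[ext]
theorem Hom₂.ext' {X Y : LaxSlice B} {f g : Hom X Y} {θ θ' : Hom₂ f g}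
    (h : ∀ x, θ.hat.app x = θ'.hat.app x) : θ = θ' := by
  obtain ⟨a, _⟩ := θ
  obtain ⟨b, _⟩ := θ'
  obtain rfl : a = b := by ext x; exact h x
  rfl

instance : CategoryStruct (LaxSlice B) where
  Hom := Hom
  id X := { hat := 𝟭 X.dom, cell := { app := fun x => 𝟙 (X.proj.obj x) } }
  comp {X Y Z} f g :=
    { hat := f.hat ⋙ g.hat
      cell :=
        { app := fun x => f.cell.app x ≫ g.cell.app (f.hat.obj x)
          naturality := fun x y φ => by
            have h1 := f.cell.naturality φ
            have h2 := g.cell.naturality (f.hat.map φ)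
            dsimp at h1 h2 ⊢
            rw [reassoc_of% h1, h2, Category.assoc] } }

@[simp] theorem id_hat (X : LaxSlice B) : Hom.hat (𝟙 X) = 𝟭 X.dom := rfl
@[simp] theorem id_cell_app (X : LaxSlice B) (x : X.dom) :
    (Hom.cell (𝟙 X)).app x = 𝟙 (X.proj.obj x) := rfl
@[simp] theorem comp_hat {X Y Z : LaxSlice B} (f : X ⟶ Y) (g : Y ⟶ Z) :
    Hom.hat (f ≫ g) = Hom.hat f ⋙ Hom.hat g := rfl
@[simp] theorem comp_cell_app {X Y Z : LaxSlice B} (f : X ⟶ Y) (g : Y ⟶ Z) (x : X.dom) :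
    (Hom.cell (f ≫ g)).app x = (Hom.cell f).app x ≫ (Hom.cell g).app ((Hom.hat f).obj x) := rfl

instance homCategory (X Y : LaxSlice B) : Category (X ⟶ Y) where
  Hom f g := Hom₂ f g
  id f := { hat := 𝟙 f.hat, w := fun x => by simp }
  comp {f g h} α β :=
    { hat := α.hat ≫ β.hat
      w := fun x => by
        rw [NatTrans.comp_app, Functor.map_comp, ← Category.assoc, α.w, β.w] }
  id_comp α := Hom₂.ext' fun x => Category.id_comp _
  comp_id α := Hom₂.ext' fun x => Category.comp_id _
  assoc α β γ := Hom₂.ext' fun x => Category.assoc _ _ _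

@[ext]
theorem hom₂_ext {X Y : LaxSlice B} {f g : X ⟶ Y} {θ θ' : f ⟶ g}
    (h : ∀ x, (Hom₂.hat θ).app x = (Hom₂.hat θ').app x) : θ = θ' := Hom₂.ext' h

@[simp] theorem id₂_hat {X Y : LaxSlice B} (f : X ⟶ Y) (x : X.dom) :
    (Hom₂.hat (𝟙 f)).app x = 𝟙 ((Hom.hat f).obj x) := rfl
@[simp] theorem comp₂_hat {X Y : LaxSlice B} {f g h : X ⟶ Y} (α : f ⟶ g) (β : g ⟶ h) (x : X.dom) :
    (Hom₂.hat (α ≫ β)).app x = (Hom₂.hat α).app x ≫ (Hom₂.hat β).app x := rfl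

/-- Invertible 2-cells from natural isomorphisms. -/
def isoMk {X Y : LaxSlice B} {f g : X ⟶ Y} (e : Hom.hat f ≅ Hom.hat g)
    (w : ∀ x : X.dom, (Hom.cell f).app x ≫ Y.proj.map (e.hom.app x) = (Hom.cell g).app x) :
    f ≅ g where
  hom := Hom₂.mk e.hom w
  inv := Hom₂.mk e.inv (fun x => by rw [← w x, Category.assoc, ← Functor.map_comp]; simp)
  hom_inv_id := Hom₂.ext' fun x => e.hom_inv_id_app x
  inv_hom_id := Hom₂.ext' fun x => e.inv_hom_id_app x

/-- Left whiskering in the lax slice. -/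
def whiskerL {X Y Z : LaxSlice B} (f : X ⟶ Y) {g h : Y ⟶ Z} (η : g ⟶ h) : f ≫ g ⟶ f ≫ h :=
  Hom₂.mk (f := f ≫ g) (g := f ≫ h) (Functor.whiskerLeft (Hom.hat f) (Hom₂.hat η)) (fun x => by
    have := η.w ((Hom.hat f).obj x)
    simp [this])

/-- Right whiskering in the lax slice. -/
def whiskerR {X Y Z : LaxSlice B} {f g : X ⟶ Y} (η : f ⟶ g) (h : Y ⟶ Z) : f ≫ h ⟶ g ≫ h :=
  Hom₂.mk (f := f ≫ h) (g := g ≫ h) (Functor.whiskerRight (Hom₂.hat η) (Hom.hat h)) (fun x => by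
    have h1 := η.w x
    have h2 := (Hom.cell h).naturality ((Hom₂.hat η).app x)
    dsimp at h1 h2 ⊢
    rw [Category.assoc, ← h2, ← h1, Category.assoc])

@[simp] theorem whiskerL_hat {X Y Z : LaxSlice B} (f : X ⟶ Y) {g h : Y ⟶ Z} (η : g ⟶ h)
    (x : X.dom) : (Hom₂.hat (whiskerL f η)).app x = (Hom₂.hat η).app ((Hom.hat f).obj x) := rfl

@[simp] theorem whiskerR_hat {X Y Z : LaxSlice B} {f g : X ⟶ Y} (η : f ⟶ g) (h : Y ⟶ Z)
    (x : X.dom) : (Hom₂.hat (whiskerR η h)).app x = (Hom.hat h).map ((Hom₂.hat η).app x) := rfl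

/-- The lax slice as a bicategory; it is strict (see below). -/
instance bicategory : Bicategory.{u, u} (LaxSlice B) where
  whiskerLeft f _ _ η := whiskerL f η
  whiskerRight η h := whiskerR η h
  associator {W X Y Z} f g h := isoMk (f := (f ≫ g) ≫ h) (g := f ≫ g ≫ h)
    (Functor.associator _ _ _) (fun x => by simp)
  leftUnitor {X Y} f := isoMk (f := 𝟙 X ≫ f) (g := f) (Functor.leftUnitor _) (fun x => by simp)
  rightUnitor {X Y} f := isoMk (f := f ≫ 𝟙 Y) (g := f) (Functor.rightUnitor _) (fun x => by simp)
  whiskerLeft_id _ _ := hom₂_ext fun _ => rfl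
  whiskerLeft_comp _ _ _ _ _ _ := hom₂_ext fun _ => rfl
  id_whiskerLeft _ := by
    apply hom₂_ext; intro x
    exact ((Category.id_comp _).trans (Category.comp_id _)).symm
  comp_whiskerLeft _ _ _ _ _ := by
    apply hom₂_ext; intro x
    exact ((Category.id_comp _).trans (Category.comp_id _)).symm
  id_whiskerRight _ _ := by
    apply hom₂_ext; intro x
    exact CategoryTheory.Functor.map_id _ _
  comp_whiskerRight _ _ _ := by
    apply hom₂_ext; intro x
    exact CategoryTheory.Functor.map_comp _ _ _
  whiskerRight_id _ := by
    apply hom₂_ext; intro x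
    exact ((Category.id_comp _).trans (Category.comp_id _)).symm
  whiskerRight_comp _ _ _ := by
    apply hom₂_ext; intro x
    exact ((Category.id_comp _).trans (Category.comp_id _)).symm
  whisker_assoc _ _ _ _ _ := by
    apply hom₂_ext; intro x
    exact ((Category.id_comp _).trans (Category.comp_id _)).symm
  whisker_exchange η θ := by
    apply hom₂_ext; intro x
    exact ((Hom₂.hat θ).naturality ((Hom₂.hat η).app _)).symm
  pentagon f g h i := by
    apply hom₂_ext; intro x
    change (Hom.hat i).map (𝟙 _) ≫ 𝟙 _ ≫ 𝟙 _ = 𝟙 _ ≫ 𝟙 _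
    simp
  triangle f g := by
    apply hom₂_ext; intro x
    change 𝟙 _ ≫ 𝟙 _ = (Hom.hat g).map (𝟙 _)
    simp

theorem whiskerLeft_hat {X Y Z : LaxSlice B} (f : X ⟶ Y) {g h : Y ⟶ Z} (η : g ⟶ h)
    (x : X.dom) : (Hom₂.hat (f ◁ η)).app x = (Hom₂.hat η).app ((Hom.hat f).obj x) := rfl

theorem whiskerRight_hat {X Y Z : LaxSlice B} {f g : X ⟶ Y} (η : f ⟶ g) (h : Y ⟶ Z)
    (x : X.dom) : (Hom₂.hat (η ▷ h)).app x = (Hom.hat h).map ((Hom₂.hat η).app x) := rfl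

/-- Equality of 1-cells of the lax slice, checked on objects, morphisms and components. -/
theorem hom_ext {X Y : LaxSlice B} {f g : X ⟶ Y} (h : Hom.hat f = Hom.hat g)
    (w : ∀ x, (Hom.cell f).app x ≫ eqToHom (by rw [h]) = (Hom.cell g).app x) : f = g := by
  obtain ⟨f, a⟩ := f
  obtain ⟨g, b⟩ := g
  dsimp at h
  subst h
  congr 1
  ext x
  simpa using w x

theorem eqToHom_hat {X Y : LaxSlice B} {f g : X ⟶ Y} (h : f = g) (x : X.dom) :
    (Hom₂.hat (eqToHom h)).app x = eqToHom (by rw [h]) := by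
  subst h
  rfl

theorem conj_hat {X Y : LaxSlice B} {f f' g g' : X ⟶ Y} (h : f = f') (θ : f' ⟶ g') (h' : g' = g)
    (x : X.dom) : (Hom₂.hat (eqToHom h ≫ θ ≫ eqToHom h')).app x =
      eqToHom (by rw [h]) ≫ (Hom₂.hat θ).app x ≫ eqToHom (by rw [h']) := by
  subst h h'
  simp

instance strict : Bicategory.Strict (LaxSlice B) where
  id_comp _ := hom_ext rfl fun _ => by simp
  comp_id _ := hom_ext rfl fun _ => by simp
  assoc _ _ _ := hom_ext rfl fun _ => by simp
  leftUnitor_eqToIso _ := by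
    ext x
    rw [eqToIso.hom, eqToHom_hat]; rfl
  rightUnitor_eqToIso _ := by
    ext x
    rw [eqToIso.hom, eqToHom_hat]; rfl
  associator_eqToIso _ _ _ := by
    ext x
    rw [eqToIso.hom, eqToHom_hat]; rfl

/-- A 1-cell is tight when its triangle commutes strictly, i.e. is filled with an identity. -/
def IsTight {X Y : LaxSlice B} (f : X ⟶ Y) : Prop :=
  ∃ h : X.proj = Hom.hat f ⋙ Y.proj, Hom.cell f = eqToHom h

theorem isTight_iff {X Y : LaxSlice B} (f : X ⟶ Y) :
    IsTight f ↔ ∀ x, ∃ h : X.proj.obj x = Y.proj.obj ((Hom.hat f).obj x),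
      (Hom.cell f).app x = eqToHom h := by
  constructor
  · rintro ⟨h, hf⟩ x
    exact ⟨congrArg (fun F => F.obj x) h, by rw [hf, eqToHom_app]⟩
  · intro h
    have h' : X.proj = Hom.hat f ⋙ Y.proj := by
      refine CategoryTheory.Functor.ext (fun x : X.dom => (h x).1) (fun x y φ => ?_)
      have := (Hom.cell f).naturality φ
      rw [(h x).2, (h y).2] at this
      rw [← Category.assoc, ← this]
      simp
    exact ⟨h', by ext x; rw [(h x).2, eqToHom_app]⟩

/-- The canonical `F`-category structure of the lax slice, with tight part the strict slice. -/
instance : FCategory (LaxSlice B) where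
  Tight f := IsTight f
  tight_id X := ⟨rfl, rfl⟩
  tight_comp {X Y Z f g} hf hg := by
    rw [isTight_iff] at hf hg ⊢
    intro x
    exact ⟨(hf x).1.trans (hg _).1, by rw [comp_cell_app, (hf x).2, (hg _).2, eqToHom_trans]⟩

end LaxSlice

/-! ### Split Grothendieck opfibrations and strict pullbacks -/

/-- A split (normal) cleavage exhibiting `τ : E ⥤ B` as a split Grothendieck opfibration:
chosen (strongly) opcartesian lifts, compatible with identities and composition. -/
structure SplitOpfibration {E B : Type u} [Category.{u} E] [Category.{u} B] (τ : E ⥤ B) where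
  /-- The codomain of the chosen lift of `f` at `e`. -/
  push : ∀ {X Y : B} (_ : X ⟶ Y) (e : E) (_ : τ.obj e = X), E
  /-- The chosen lift of `f` at `e`. -/
  lift : ∀ {X Y : B} (f : X ⟶ Y) (e : E) (he : τ.obj e = X), e ⟶ push f e he
  isStronglyCocartesian : ∀ {X Y : B} (f : X ⟶ Y) (e : E) (he : τ.obj e = X),
    τ.IsStronglyCocartesian f (lift f e he)
  push_id : ∀ {X : B} (e : E) (he : τ.obj e = X), push (𝟙 X) e he = e
  lift_id : ∀ {X : B} (e : E) (he : τ.obj e = X),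
    lift (𝟙 X) e he = eqToHom (push_id e he).symm
  push_comp : ∀ {X Y Z : B} (f : X ⟶ Y) (g : Y ⟶ Z) (e : E) (he : τ.obj e = X)
    (he' : τ.obj (push f e he) = Y), push (f ≫ g) e he = push g (push f e he) he'
  lift_comp : ∀ {X Y Z : B} (f : X ⟶ Y) (g : Y ⟶ Z) (e : E) (he : τ.obj e = X)
    (he' : τ.obj (push f e he) = Y),
    lift (f ≫ g) e he =
      lift f e he ≫ lift g (push f e he) he' ≫ eqToHom (push_comp f g e he he').symm

section

variable {E B : Type u} [Category.{u} E] [Category.{u} B]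

attribute [instance] SplitOpfibration.isStronglyCocartesian

namespace SplitOpfibration

variable {τ : E ⥤ B} (c : SplitOpfibration τ)

instance lift_isHomLift {X Y : B} (f : X ⟶ Y) (e : E) (he : τ.obj e = X) :
    τ.IsHomLift f (c.lift f e he) :=
  (c.isStronglyCocartesian f e he).toIsHomLift

theorem obj_push {X Y : B} (f : X ⟶ Y) (e : E) (he : τ.obj e = X) :
    τ.obj (c.push f e he) = Y :=
  IsHomLift.codomain_eq τ f (c.lift f e he)

/-- The unique morphism over `g` induced by a morphism `φ` over `f ≫ g`. -/
noncomputable def desc {X Y Z : B} (f : X ⟶ Y) (g : Y ⟶ Z) (e : E) (he : τ.obj e = X) {e' : E}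
    (φ : e ⟶ e') (hφ : τ.IsHomLift (f ≫ g) φ) : c.push f e he ⟶ e' :=
  Functor.IsStronglyCocartesian.map τ f (c.lift f e he) (g := g) (f' := f ≫ g) rfl φ

theorem desc_isHomLift {X Y Z : B} (f : X ⟶ Y) (g : Y ⟶ Z) (e : E) (he : τ.obj e = X) {e' : E}
    (φ : e ⟶ e') (hφ : τ.IsHomLift (f ≫ g) φ) : τ.IsHomLift g (c.desc f g e he φ hφ) :=
  Functor.IsStronglyCocartesian.map_isHomLift τ f (c.lift f e he) (g := g) (f' := f ≫ g) rfl φ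

@[simp]
theorem lift_desc {X Y Z : B} (f : X ⟶ Y) (g : Y ⟶ Z) (e : E) (he : τ.obj e = X) {e' : E}
    (φ : e ⟶ e') (hφ : τ.IsHomLift (f ≫ g) φ) :
    c.lift f e he ≫ c.desc f g e he φ hφ = φ :=
  Functor.IsStronglyCocartesian.fac τ f (c.lift f e he) (g := g) (f' := f ≫ g) rfl φ

@[simp]
theorem lift_desc_assoc {X Y Z : B} (f : X ⟶ Y) (g : Y ⟶ Z) (e : E) (he : τ.obj e = X) {e' : E}
    (φ : e ⟶ e') (hφ : τ.IsHomLift (f ≫ g) φ) {z : E} (ψ : e' ⟶ z) :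
    c.lift f e he ≫ c.desc f g e he φ hφ ≫ ψ = φ ≫ ψ := by
  rw [← Category.assoc, lift_desc]

theorem hom_ext {X Y Z : B} {f : X ⟶ Y} (g : Y ⟶ Z) {e : E} {he : τ.obj e = X} {e' : E}
    {ψ ψ' : c.push f e he ⟶ e'} (h : τ.IsHomLift g ψ) (h' : τ.IsHomLift g ψ')
    (w : c.lift f e he ≫ ψ = c.lift f e he ≫ ψ') : ψ = ψ' :=
  Functor.IsStronglyCocartesian.ext τ f (c.lift f e he) g w

end SplitOpfibration

/-- The strict pullback of `τ : E ⥤ B` along `F : D ⥤ B`. -/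
structure Pull {D : Type u} [Category.{u} D] (τ : E ⥤ B) (F : D ⥤ B) where
  base : D
  fib : E
  w : τ.obj fib = F.obj base

namespace Pull

variable {D : Type u} [Category.{u} D] {τ : E ⥤ B} {F : D ⥤ B}

/-- Morphisms of the pullback: pairs of morphisms with the same image in `B`. -/
@[ext]
structure Hom (p q : Pull τ F) where
  base : p.base ⟶ q.base
  fib : p.fib ⟶ q.fib
  w : τ.IsHomLift (F.map base) fib

instance : Category (Pull τ F) where
  Hom := Hom
  id p := ⟨𝟙 _, 𝟙 _, by rw [F.map_id]; exact IsHomLift.id p.w⟩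
  comp f g := ⟨f.base ≫ g.base, f.fib ≫ g.fib, by
    have := f.w
    have := g.w
    rw [F.map_comp]
    infer_instance⟩
  id_comp f := Hom.ext (Category.id_comp _) (Category.id_comp _)
  comp_id f := Hom.ext (Category.comp_id _) (Category.comp_id _)
  assoc f g h := Hom.ext (Category.assoc _ _ _) (Category.assoc _ _ _)

@[ext]
theorem hom_ext {p q : Pull τ F} {f g : p ⟶ q} (h : Hom.base f = Hom.base g)
    (h' : Hom.fib f = Hom.fib g) : f = g := Hom.ext h h'

@[simp] theorem id_base (p : Pull τ F) : Hom.base (𝟙 p) = 𝟙 p.base := rfl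
@[simp] theorem id_fib (p : Pull τ F) : Hom.fib (𝟙 p) = 𝟙 p.fib := rfl
@[simp] theorem comp_base {p q r : Pull τ F} (f : p ⟶ q) (g : q ⟶ r) :
    Hom.base (f ≫ g) = Hom.base f ≫ Hom.base g := rfl
@[simp] theorem comp_fib {p q r : Pull τ F} (f : p ⟶ q) (g : q ⟶ r) :
    Hom.fib (f ≫ g) = Hom.fib f ≫ Hom.fib g := rfl

theorem eqToHom_base {p q : Pull τ F} (h : p = q) :
    Hom.base (eqToHom h) = eqToHom (by rw [h]) := by
  subst h
  rfl

theorem eqToHom_fib {p q : Pull τ F} (h : p = q) :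
    Hom.fib (eqToHom h) = eqToHom (by rw [h]) := by
  subst h
  rfl

/-- Objects of the pullback with the same first component. -/
theorem obj_ext {p q : Pull τ F} (h : p.base = q.base) (h' : p.fib = q.fib) : p = q := by
  obtain ⟨_, _, _⟩ := p
  obtain ⟨_, _, _⟩ := q
  cases h
  cases h'
  rfl

variable (τ F) in
/-- The projection of the pullback of `τ` along `F` to `E`. -/
def toFib : Pull τ F ⥤ E where
  obj p := p.fib
  map f := f.fib

end Pull

namespace UpperStar

variable {τ : E ⥤ B} (c : SplitOpfibration τ)

/-- The pullback of an object of the lax slice. -/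
abbrev obj (τ : E ⥤ B) (F : LaxSlice B) : LaxSlice E where
  dom := Cat.of (Pull τ F.proj)
  proj := Pull.toFib τ F.proj

theorem homLift_comp {X Y Z : B} {f : X ⟶ Y} {g : Y ⟶ Z} {a b d : E} {φ : a ⟶ b} {ψ : b ⟶ d}
    (hφ : τ.IsHomLift f φ) (hψ : τ.IsHomLift g ψ) : τ.IsHomLift (f ≫ g) (φ ≫ ψ) :=
  IsHomLift.comp τ f g φ ψ

theorem hatMap_aux {F G : LaxSlice B} (α : F ⟶ G) {p q : Pull τ F.proj} (f : p ⟶ q) :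
    τ.IsHomLift (α.cell.app p.base ≫ G.proj.map (α.hat.map f.base))
      (f.fib ≫ c.lift (α.cell.app q.base) q.fib q.w) := by
  have n := α.cell.naturality f.base
  dsimp at n
  rw [← n]
  exact homLift_comp f.w (c.lift_isHomLift _ _ _)

/-- The functor between pullbacks induced by a 1-cell of the lax slice: `(x, e)` is sent to
`(α̂ x, e')` where `e ⟶ e'` is the chosen lift of `α_x`. -/
noncomputable def hat {F G : LaxSlice B} (α : F ⟶ G) : Pull τ F.proj ⥤ Pull τ G.proj where
  obj p := ⟨α.hat.obj p.base, c.push (α.cell.app p.base) p.fib p.w, c.obj_push _ _ _⟩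
  map {p q} f :=
    { base := α.hat.map f.base
      fib := c.desc (α.cell.app p.base) (G.proj.map (α.hat.map f.base)) p.fib p.w
        (f.fib ≫ c.lift (α.cell.app q.base) q.fib q.w) (hatMap_aux c α f)
      w := c.desc_isHomLift _ _ _ _ _ _ }
  map_id p := by
    ext
    · simp
    · refine c.hom_ext _ (c.desc_isHomLift _ _ _ _ _ (hatMap_aux c α (𝟙 p))) ?_ ?_
      · simp only [Pull.id_base, CategoryTheory.Functor.map_id]
        exact IsHomLift.id (c.obj_push _ _ _)
      · simp
  map_comp {p q r} f g := by
    ext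
    · simp
    · refine c.hom_ext _ (c.desc_isHomLift _ _ _ _ _ (hatMap_aux c α (f ≫ g))) ?_ ?_
      · simp only [Pull.comp_base, CategoryTheory.Functor.map_comp]
        exact homLift_comp (c.desc_isHomLift _ _ _ _ _ (hatMap_aux c α f))
          (c.desc_isHomLift _ _ _ _ _ (hatMap_aux c α g))
      · simp

/-- The chosen lift of `α_x` at `e`, as a morphism from `e` to the second component of the image
of `(x, e)`. -/
def hatLift {F G : LaxSlice B} (α : F ⟶ G) (p : Pull τ F.proj) :
    p.fib ⟶ ((hat c α).obj p).fib :=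
  c.lift (α.cell.app p.base) p.fib p.w

@[simp] theorem hat_map_base {F G : LaxSlice B} (α : F ⟶ G) {p q : Pull τ F.proj} (f : p ⟶ q) :
    Pull.Hom.base ((hat c α).map f) = α.hat.map f.base := rfl

@[simp]
theorem lift_hat_map {F G : LaxSlice B} (α : F ⟶ G) {p q : Pull τ F.proj} (f : p ⟶ q) :
    hatLift c α p ≫ Pull.Hom.fib ((hat c α).map f) =
      Pull.Hom.fib f ≫ hatLift c α q :=
  c.lift_desc _ _ _ _ _ (hatMap_aux c α f)

@[simp]
theorem lift_hat_map_assoc {F G : LaxSlice B} (α : F ⟶ G) {p q : Pull τ F.proj} (f : p ⟶ q)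
    {z : E} (k : ((hat c α).obj q).fib ⟶ z) :
    hatLift c α p ≫ Pull.Hom.fib ((hat c α).map f) ≫ k = Pull.Hom.fib f ≫ hatLift c α q ≫ k := by
  rw [← Category.assoc, lift_hat_map, Category.assoc]

/-- The action of `τ*` on 1-cells of the lax slice. -/
noncomputable def map {F G : LaxSlice B} (α : F ⟶ G) : obj τ F ⟶ obj τ G :=
  LaxSlice.Hom.mk (X := obj τ F) (Y := obj τ G) (hat c α)
    { app := fun p : Pull τ F.proj => hatLift c α p
      naturality := fun (_ _ : Pull τ F.proj) f => (lift_hat_map c α f).symm }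

theorem hat₂_aux {F G : LaxSlice B} {α β : F ⟶ G} (δ : α ⟶ β) (p : Pull τ F.proj) :
    τ.IsHomLift (α.cell.app p.base ≫ G.proj.map (δ.hat.app p.base))
      (c.lift (β.cell.app p.base) p.fib p.w) := by
  rw [δ.w]
  exact c.lift_isHomLift _ _ _

/-- The component at `p` of the action of `τ*` on a 2-cell of the lax slice. -/
noncomputable def hat₂App {F G : LaxSlice B} {α β : F ⟶ G} (δ : α ⟶ β) (p : Pull τ F.proj) :
    (hat c α).obj p ⟶ (hat c β).obj p where
  base := δ.hat.app p.base
  fib := c.desc (α.cell.app p.base) (G.proj.map (δ.hat.app p.base)) p.fib p.w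
    (c.lift (β.cell.app p.base) p.fib p.w) (hat₂_aux c δ p)
  w := c.desc_isHomLift _ _ _ _ _ (hat₂_aux c δ p)

@[simp] theorem hat₂App_base {F G : LaxSlice B} {α β : F ⟶ G} (δ : α ⟶ β) (p : Pull τ F.proj) :
    Pull.Hom.base (hat₂App c δ p) = δ.hat.app p.base := rfl

@[simp]
theorem lift_hat₂App {F G : LaxSlice B} {α β : F ⟶ G} (δ : α ⟶ β) (p : Pull τ F.proj) :
    hatLift c α p ≫ Pull.Hom.fib (hat₂App c δ p) = hatLift c β p :=
  c.lift_desc _ _ _ _ _ (hat₂_aux c δ p)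

@[simp]
theorem lift_hat₂App_assoc {F G : LaxSlice B} {α β : F ⟶ G} (δ : α ⟶ β) (p : Pull τ F.proj)
    {z : E} (k : ((hat c β).obj p).fib ⟶ z) :
    hatLift c α p ≫ Pull.Hom.fib (hat₂App c δ p) ≫ k = hatLift c β p ≫ k := by
  rw [← Category.assoc, lift_hat₂App]

/-- The second component of the action of `τ*` on a 2-cell `δ` is the chosen lift of `δ_x`. -/
theorem hat₂App_fib {F G : LaxSlice B} {α β : F ⟶ G} (δ : α ⟶ β) (p : Pull τ F.proj) :
    ∃ h : c.push (G.proj.map (δ.hat.app p.base)) ((hat c α).obj p).fib ((hat c α).obj p).w =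
        ((hat c β).obj p).fib,
      Pull.Hom.fib (hat₂App c δ p) =
        c.lift (G.proj.map (δ.hat.app p.base)) ((hat c α).obj p).fib ((hat c α).obj p).w ≫
          eqToHom h := by
  have key : ∀ {Z : B} (f g : F.proj.obj p.base ⟶ Z) (h : f = g),
      ∃ h' : c.push f p.fib p.w = c.push g p.fib p.w,
        c.lift g p.fib p.w = c.lift f p.fib p.w ≫ eqToHom h' := by
    rintro Z f _ rfl
    exact ⟨rfl, by simp⟩
  obtain ⟨h1, h2⟩ := key _ _ (δ.w p.base)
  have h3 := c.push_comp (α.cell.app p.base) (G.proj.map (δ.hat.app p.base)) p.fib p.w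
    ((hat c α).obj p).w
  have h4 := c.lift_comp (α.cell.app p.base) (G.proj.map (δ.hat.app p.base)) p.fib p.w
    ((hat c α).obj p).w
  refine ⟨h3.symm.trans h1, ?_⟩
  refine c.hom_ext (G.proj.map (δ.hat.app p.base)) (hat₂App c δ p).w ?_ ?_
  · have key₂ : ∀ {x y y' : E} {X Y : B} (f : X ⟶ Y) (k : x ⟶ y) (_ : τ.IsHomLift f k)
        (h : y = y'), τ.IsHomLift f (k ≫ eqToHom h) := by
      rintro x y _ X Y f k hk rfl
      simpa using hk
    exact key₂ _ _ (c.lift_isHomLift _ _ _) _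
  · refine (lift_hat₂App c δ p).trans (h2.trans ?_)
    rw [h4]
    simp only [Category.assoc, eqToHom_trans]
    rfl

/-- Morphisms out of an object in the image of `hat` are determined by their first component
and by their restriction along the chosen lift. -/
theorem hat_hom_ext {F G : LaxSlice B} {α : F ⟶ G} {p : Pull τ F.proj} {q : Pull τ G.proj}
    {f g : (hat c α).obj p ⟶ q} (h : Pull.Hom.base f = Pull.Hom.base g)
    (h' : hatLift c α p ≫ Pull.Hom.fib f =
      hatLift c α p ≫ Pull.Hom.fib g) : f = g :=
  Pull.hom_ext h (c.hom_ext _ f.w (h ▸ g.w) h')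

/-- The natural transformation between pullback functors induced by a 2-cell of the lax slice. -/
noncomputable def hat₂ {F G : LaxSlice B} {α β : F ⟶ G} (δ : α ⟶ β) : hat c α ⟶ hat c β where
  app p := hat₂App c δ p
  naturality p q f := hat_hom_ext c (δ.hat.naturality f.base) (by simp)

/-- The action of `τ*` on 2-cells of the lax slice: over `δ_x`, the unique morphism compatible
with the chosen lifts. It is the chosen lift of `δ_x`, see `hat₂App_fib`. -/
noncomputable def map₂ {F G : LaxSlice B} {α β : F ⟶ G} (δ : α ⟶ β) : map c α ⟶ map c β :=
  LaxSlice.Hom₂.mk (f := map c α) (g := map c β) (hat₂ c δ) (fun p => lift_hat₂App c δ p)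

theorem hatLift_id (F : LaxSlice B) (p : Pull τ F.proj) (h : p = (hat c (𝟙 F)).obj p) :
    hatLift c (𝟙 F) p = eqToHom (congrArg Pull.fib h) :=
  c.lift_id p.fib p.w

theorem hatLift_comp {F G H : LaxSlice B} (α : F ⟶ G) (β : G ⟶ H) (p : Pull τ F.proj)
    (h : (hat c β).obj ((hat c α).obj p) = (hat c (α ≫ β)).obj p) :
    hatLift c (α ≫ β) p =
      hatLift c α p ≫ hatLift c β ((hat c α).obj p) ≫ eqToHom (congrArg Pull.fib h) :=
  c.lift_comp _ _ _ _ _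

/-- Equality of functors out of a pullback, checked after restriction along the chosen lifts. -/
theorem hat_eq {F G : LaxSlice B} (α : F ⟶ G) (K : Pull τ F.proj ⥤ Pull τ G.proj)
    (h : ∀ p, (hat c α).obj p = K.obj p)
    (hb : ∀ {p q : Pull τ F.proj} (f : p ⟶ q), Pull.Hom.base ((hat c α).map f) =
      eqToHom (congrArg Pull.base (h p)) ≫ Pull.Hom.base (K.map f) ≫
        eqToHom (congrArg Pull.base (h q)).symm)
    (hl : ∀ {p q : Pull τ F.proj} (f : p ⟶ q),
      hatLift c α p ≫ eqToHom (congrArg Pull.fib (h p)) ≫ Pull.Hom.fib (K.map f) =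
        Pull.Hom.fib f ≫ hatLift c α q ≫ eqToHom (congrArg Pull.fib (h q))) :
    hat c α = K := by
  refine CategoryTheory.Functor.ext h (fun p q f => hat_hom_ext c ?_ ?_)
  · simp only [Pull.comp_base, Pull.eqToHom_base]
    exact hb f
  · simp only [Pull.comp_fib, Pull.eqToHom_fib, lift_hat_map]
    have := hl f
    rw [reassoc_of% this]
    simp

theorem hat_id_obj (F : LaxSlice B) (p : Pull τ F.proj) : (hat c (𝟙 F)).obj p = p :=
  Pull.obj_ext rfl (c.push_id p.fib p.w)

theorem hat_id (F : LaxSlice B) : hat c (𝟙 F) = 𝟭 (Pull τ F.proj) := by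
  refine hat_eq c _ _ (hat_id_obj c F) (fun f => ?_) (fun {p q} f => ?_)
  · exact ((Category.id_comp _).trans (Category.comp_id _)).symm
  · rw [hatLift_id c F p (hat_id_obj c F p).symm, hatLift_id c F q (hat_id_obj c F q).symm]
    simp

theorem hat_comp_obj {F G H : LaxSlice B} (α : F ⟶ G) (β : G ⟶ H) (p : Pull τ F.proj) :
    (hat c (α ≫ β)).obj p = (hat c β).obj ((hat c α).obj p) :=
  Pull.obj_ext rfl (c.push_comp _ _ p.fib p.w _)

theorem hat_comp {F G H : LaxSlice B} (α : F ⟶ G) (β : G ⟶ H) :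
    hat c (α ≫ β) = hat c α ⋙ hat c β := by
  refine hat_eq c _ _ (hat_comp_obj c α β) (fun f => ?_) (fun {p q} f => ?_)
  · exact ((Category.id_comp _).trans (Category.comp_id _)).symm
  · rw [hatLift_comp c α β p (hat_comp_obj c α β p).symm,
      hatLift_comp c α β q (hat_comp_obj c α β q).symm]
    simp

theorem map_id (F : LaxSlice B) : map c (𝟙 F) = 𝟙 (obj τ F) := by
  refine LaxSlice.hom_ext (hat_id c F) (fun (p : Pull τ F.proj) => ?_)
  change hatLift c (𝟙 F) p ≫ eqToHom _ = 𝟙 p.fib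
  rw [hatLift_id c F p (hat_id_obj c F p).symm]
  exact eqToHom_trans _ _

theorem map_comp {F G H : LaxSlice B} (α : F ⟶ G) (β : G ⟶ H) :
    map c (α ≫ β) = map c α ≫ map c β := by
  refine LaxSlice.hom_ext (hat_comp c α β) (fun (p : Pull τ F.proj) => ?_)
  change hatLift c (α ≫ β) p ≫ eqToHom _ = hatLift c α p ≫ hatLift c β ((hat c α).obj p)
  rw [hatLift_comp c α β p (hat_comp_obj c α β p).symm, Category.assoc, Category.assoc]
  congr 1
  erw [eqToHom_trans]
  exact Category.comp_id _

theorem map₂_id {F G : LaxSlice B} (α : F ⟶ G) : map₂ c (𝟙 α) = 𝟙 (map c α) :=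
  LaxSlice.hom₂_ext fun (p : Pull τ F.proj) =>
    show hat₂App c (𝟙 α) p = 𝟙 ((hat c α).obj p) from hat_hom_ext c rfl (by simp)

theorem map₂_comp {F G : LaxSlice B} {α β γ : F ⟶ G} (δ : α ⟶ β) (δ' : β ⟶ γ) :
    map₂ c (δ ≫ δ') = map₂ c δ ≫ map₂ c δ' :=
  LaxSlice.hom₂_ext fun (p : Pull τ F.proj) =>
    show hat₂App c (δ ≫ δ') p = hat₂App c δ p ≫ hat₂App c δ' p from hat_hom_ext c rfl (by simp)

theorem map₂_whiskerLeft {F G H : LaxSlice B} (α : F ⟶ G) {β γ : G ⟶ H} (δ : β ⟶ γ) :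
    map₂ c (α ◁ δ) =
      eqToHom (map_comp c α β) ≫ map c α ◁ map₂ c δ ≫ eqToHom (map_comp c α γ).symm := by
  refine LaxSlice.hom₂_ext fun (p : Pull τ F.proj) => ?_
  refine Eq.trans ?_ (LaxSlice.conj_hat _ _ _ _).symm
  change hat₂App c (α ◁ δ) p = eqToHom (hat_comp_obj c α β p) ≫
    hat₂App c δ ((hat c α).obj p) ≫ eqToHom (hat_comp_obj c α γ p).symm
  refine hat_hom_ext c ?_ ?_
  · simp only [Pull.comp_base, Pull.eqToHom_base]
    exact ((Category.id_comp _).trans (Category.comp_id _)).symm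
  · simp only [Pull.comp_fib, Pull.eqToHom_fib, lift_hat₂App]
    rw [hatLift_comp c α β p (hat_comp_obj c α β p).symm,
      hatLift_comp c α γ p (hat_comp_obj c α γ p).symm]
    simp

theorem map₂_whiskerRight {F G H : LaxSlice B} {α β : F ⟶ G} (δ : α ⟶ β) (γ : G ⟶ H) :
    map₂ c (δ ▷ γ) =
      eqToHom (map_comp c α γ) ≫ map₂ c δ ▷ map c γ ≫ eqToHom (map_comp c β γ).symm := by
  refine LaxSlice.hom₂_ext fun (p : Pull τ F.proj) => ?_
  refine Eq.trans ?_ (LaxSlice.conj_hat _ _ _ _).symm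
  change hat₂App c (δ ▷ γ) p = eqToHom (hat_comp_obj c α γ p) ≫
    (hat c γ).map (hat₂App c δ p) ≫ eqToHom (hat_comp_obj c β γ p).symm
  refine hat_hom_ext c ?_ ?_
  · simp only [Pull.comp_base, Pull.eqToHom_base]
    exact ((Category.id_comp _).trans (Category.comp_id _)).symm
  · simp only [Pull.comp_fib, Pull.eqToHom_fib, lift_hat₂App]
    rw [hatLift_comp c α γ p (hat_comp_obj c α γ p).symm,
      hatLift_comp c β γ p (hat_comp_obj c β γ p).symm]
    simp

/-- The underlying 2-functor of `τ*`. -/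
noncomputable def toStrictPseudofunctor : StrictPseudofunctor (LaxSlice B) (LaxSlice E) :=
  StrictPseudofunctor.mk''
    { obj := obj τ
      map := map c
      map₂ := map₂ c
      map₂_id := map₂_id c
      map₂_comp := map₂_comp c
      map_id := map_id c
      map_comp := map_comp c
      map₂_whisker_left := map₂_whiskerLeft c
      map₂_whisker_right := map₂_whiskerRight c }

theorem isTight_map {F G : LaxSlice B} (α : F ⟶ G) (hα : LaxSlice.IsTight α) :
    LaxSlice.IsTight (map c α) := by
  rw [LaxSlice.isTight_iff] at hα ⊢
  intro (p : Pull τ F.proj)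
  have key : ∀ {X Y : B} (f : X ⟶ Y) (h : X = Y) (_ : f = eqToHom h) (e : E) (he : τ.obj e = X),
      ∃ h' : e = c.push f e he, c.lift f e he = eqToHom h' := by
    rintro X _ _ rfl rfl e he
    exact ⟨(c.push_id e he).symm, c.lift_id e he⟩
  exact key _ (hα p.base).1 (hα p.base).2 p.fib p.w

end UpperStar

/-- Change of base `τ* : CAT // B ⥤ CAT // E` along a split Grothendieck opfibration, as an
`F`-functor between lax slices. -/
noncomputable def upperStar {τ : E ⥤ B} (c : SplitOpfibration τ) :
    FFunctor (LaxSlice B) (LaxSlice E) where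
  toStrictPseudofunctor := UpperStar.toStrictPseudofunctor c
  map_tight α hα := UpperStar.isTight_map c α hα

end

/-! ### The right adjoint `τ_*` -/

section

variable {E B : Type u} [Category.{u} E] [Category.{u} B] {τ : E ⥤ B}

namespace Fibre

/-- The object of `E` underlying an object of a fibre of `τ`. -/
abbrev obj {X : B} (e : τ.Fiber X) : E := Functor.Fiber.fiberInclusion.obj e

/-- The morphism of `E` underlying a (vertical) morphism of a fibre of `τ`. -/
abbrev map {X : B} {e e' : τ.Fiber X} (v : e ⟶ e') : obj e ⟶ obj e' :=
  Functor.Fiber.fiberInclusion.map v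

theorem obj_w {X : B} (e : τ.Fiber X) : τ.obj (obj e) = X := e.2

theorem map_w {X : B} {e e' : τ.Fiber X} (v : e ⟶ e') : τ.IsHomLift (𝟙 X) (map v) := v.2

/-- A morphism over an identity, as a morphism of the fibre. -/
def homMk {X : B} {e e' : τ.Fiber X} (g : obj e ⟶ obj e') (hg : τ.IsHomLift (𝟙 X) g) : e ⟶ e' :=
  ⟨g, hg⟩

@[simp] theorem map_homMk {X : B} {e e' : τ.Fiber X} (g : obj e ⟶ obj e')
    (hg : τ.IsHomLift (𝟙 X) g) : map (homMk g hg) = g := rfl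

theorem homLift_map_comp {X Y : B} {f : X ⟶ Y} {e₀ e : τ.Fiber X} (v : e₀ ⟶ e) {e' : E}
    {g : obj e ⟶ e'} (hg : τ.IsHomLift f g) : τ.IsHomLift f (map v ≫ g) :=
  have := map_w v
  IsHomLift.comp_lift_id_left τ f g (map v)

theorem homLift_comp_map {X Y : B} {f : X ⟶ Y} {e' e₁ : τ.Fiber Y} (v : e' ⟶ e₁) {e : E}
    {g : e ⟶ obj e'} (hg : τ.IsHomLift f g) : τ.IsHomLift f (g ≫ map v) :=
  have := map_w v
  IsHomLift.comp_lift_id_right τ f g (map v)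

variable (c : SplitOpfibration τ)

/-- The codomain of the chosen lift of `f` at `e`, as an object of the fibre. -/
def push {X Y : B} (f : X ⟶ Y) (e : τ.Fiber X) : τ.Fiber Y :=
  Functor.Fiber.mk (c.obj_push f (obj e) (obj_w e))

/-- The chosen lift of `f` at `e`. -/
def lift {X Y : B} (f : X ⟶ Y) (e : τ.Fiber X) : obj e ⟶ obj (push c f e) :=
  c.lift f (obj e) (obj_w e)

theorem lift_w {X Y : B} (f : X ⟶ Y) (e : τ.Fiber X) : τ.IsHomLift f (lift c f e) :=
  c.lift_isHomLift f (obj e) (obj_w e)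

/-- The factorization of a morphism over `f ≫ f'` through the chosen lift of `f`. -/
noncomputable def desc {X Y : B} (f : X ⟶ Y) {Z : B} (f' : Y ⟶ Z) (e : τ.Fiber X) {e' : E}
    (g : obj e ⟶ e') (hg : τ.IsHomLift (f ≫ f') g) : obj (push c f e) ⟶ e' :=
  c.desc f f' (obj e) (obj_w e) g hg

theorem desc_w {X Y : B} (f : X ⟶ Y) {Z : B} (f' : Y ⟶ Z) (e : τ.Fiber X) {e' : E}
    (g : obj e ⟶ e') (hg : τ.IsHomLift (f ≫ f') g) : τ.IsHomLift f' (desc c f f' e g hg) :=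
  c.desc_isHomLift f f' (obj e) (obj_w e) g hg

@[simp]
theorem lift_desc {X Y : B} (f : X ⟶ Y) {Z : B} (f' : Y ⟶ Z) (e : τ.Fiber X) {e' : E}
    (g : obj e ⟶ e') (hg : τ.IsHomLift (f ≫ f') g) : lift c f e ≫ desc c f f' e g hg = g :=
  c.lift_desc f f' (obj e) (obj_w e) g hg

@[simp]
theorem lift_desc_assoc {X Y : B} (f : X ⟶ Y) {Z : B} (f' : Y ⟶ Z) (e : τ.Fiber X) {e' : E}
    (g : obj e ⟶ e') (hg : τ.IsHomLift (f ≫ f') g) {z : E} (k : e' ⟶ z) :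
    lift c f e ≫ desc c f f' e g hg ≫ k = g ≫ k := by
  rw [← Category.assoc, lift_desc]

theorem hom_ext {X Y : B} {f : X ⟶ Y} {Z : B} (f' : Y ⟶ Z) {e : τ.Fiber X} {e' : E}
    {ψ ψ' : obj (push c f e) ⟶ e'} (h : τ.IsHomLift f' ψ) (h' : τ.IsHomLift f' ψ')
    (w : lift c f e ≫ ψ = lift c f e ≫ ψ') : ψ = ψ' :=
  c.hom_ext f' h h' w

end Fibre

/-- Objects of the domain of `τ_* H`, for `H : D ⥤ E`: an object `X` of `B` together with a lax
triangle from the inclusion of the fibre of `τ` over `X` to `H`. -/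
structure Sect (c : SplitOpfibration τ) {D : Type u} [Category.{u} D] (H : D ⥤ E) where
  base : B
  hat : τ.Fiber base ⥤ D
  cell : Functor.Fiber.fiberInclusion ⟶ hat ⋙ H

namespace Sect

variable {c : SplitOpfibration τ} {D : Type u} [Category.{u} D] {H : D ⥤ E}

/-- Morphisms in the domain of `τ_* H`, over `f : X ⟶ X'` in `B`: lax triangles from
`τ⁻¹(f)` to `H` extending the given ones on the fibres over `X` and `X'`. Here `τ⁻¹(f)` is the
pullback of `τ` along `f : 𝟚 ⥤ B`; a functor on it extending given functors on the two fibres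
amounts to an assignment on the morphisms `g` over `f` that is compatible with composition with
vertical morphisms on both sides. -/
structure Hom (p q : Sect c H) where
  base : p.base ⟶ q.base
  app : ∀ (e : τ.Fiber p.base) (e' : τ.Fiber q.base) (g : Fibre.obj e ⟶ Fibre.obj e'),
    τ.IsHomLift base g → (p.hat.obj e ⟶ q.hat.obj e')
  precomp : ∀ {e₀ e : τ.Fiber p.base} (v : e₀ ⟶ e) (e' : τ.Fiber q.base)
    (g : Fibre.obj e ⟶ Fibre.obj e') (hg : τ.IsHomLift base g),
    app e₀ e' (Fibre.map v ≫ g) (Fibre.homLift_map_comp v hg) = p.hat.map v ≫ app e e' g hg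
  postcomp : ∀ (e : τ.Fiber p.base) {e' e₁ : τ.Fiber q.base}
    (g : Fibre.obj e ⟶ Fibre.obj e') (v : e' ⟶ e₁) (hg : τ.IsHomLift base g),
    app e e₁ (g ≫ Fibre.map v) (Fibre.homLift_comp_map v hg) = app e e' g hg ≫ q.hat.map v
  w : ∀ (e : τ.Fiber p.base) (e' : τ.Fiber q.base) (g : Fibre.obj e ⟶ Fibre.obj e')
    (hg : τ.IsHomLift base g), p.cell.app e ≫ H.map (app e e' g hg) = g ≫ q.cell.app e'

theorem Hom.ext' {p q : Sect c H} {f g : Hom p q} (h : f.base = g.base)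
    (h' : ∀ e e' k (hk : τ.IsHomLift f.base k) (hk' : τ.IsHomLift g.base k),
      f.app e e' k hk = g.app e e' k hk') : f = g := by
  obtain ⟨f, φ, _, _, _⟩ := f
  obtain ⟨g, γ, _, _, _⟩ := g
  dsimp at h h'
  subst h
  have : φ = γ := by
    funext e e' k hk
    exact h' e e' k hk hk
  subst this
  rfl

theorem Hom.app_congr {p q : Sect c H} (φ : Hom p q) {e : τ.Fiber p.base} {e' : τ.Fiber q.base}
    {g g' : Fibre.obj e ⟶ Fibre.obj e'} (h : g = g') (hg : τ.IsHomLift φ.base g)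
    (hg' : τ.IsHomLift φ.base g') : φ.app e e' g hg = φ.app e e' g' hg' := by
  subst h
  rfl

/-- The identity: `g` over `𝟙 X` is sent to `hat g`. -/
def Hom.id (p : Sect c H) : Hom p p where
  base := 𝟙 p.base
  app _ _ g hg := p.hat.map (Fibre.homMk g hg)
  precomp v _ g hg := p.hat.map_comp v (Fibre.homMk g hg)
  postcomp _ _ _ g v hg := p.hat.map_comp (Fibre.homMk g hg) v
  w _ _ g hg := (p.cell.naturality (Fibre.homMk g hg)).symm

/-- Composition: a morphism `g` over `f ≫ f'` is factored as `g₁ ≫ g₂` with `g₁` over `f` and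
`g₂` over `f'` (using the chosen lift of `f` for `g₁`); the result does not depend on the
factorization, see `Sect.comp_app`. -/
noncomputable def compApp {p q r : Sect c H} (φ : Hom p q) (ψ : Hom q r) (e : τ.Fiber p.base)
    (e' : τ.Fiber r.base) (g : Fibre.obj e ⟶ Fibre.obj e')
    (hg : τ.IsHomLift (φ.base ≫ ψ.base) g) : p.hat.obj e ⟶ r.hat.obj e' :=
  φ.app e (Fibre.push c φ.base e) (Fibre.lift c φ.base e) (Fibre.lift_w c _ _) ≫
    ψ.app (Fibre.push c φ.base e) e' (Fibre.desc c φ.base ψ.base e g hg) (Fibre.desc_w c _ _ _ _ _)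

theorem compApp_eq {p q r : Sect c H} (φ : Hom p q) (ψ : Hom q r) (e : τ.Fiber p.base)
    (e' : τ.Fiber r.base) (g : Fibre.obj e ⟶ Fibre.obj e')
    (hg : τ.IsHomLift (φ.base ≫ ψ.base) g) (z : τ.Fiber q.base)
    (g₁ : Fibre.obj e ⟶ Fibre.obj z) (g₂ : Fibre.obj z ⟶ Fibre.obj e')
    (h₁ : τ.IsHomLift φ.base g₁) (h₂ : τ.IsHomLift ψ.base g₂) (h : g₁ ≫ g₂ = g) :
    compApp φ ψ e e' g hg = φ.app e z g₁ h₁ ≫ ψ.app z e' g₂ h₂ := by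
  have h₁' : τ.IsHomLift (φ.base ≫ 𝟙 q.base) g₁ := by rwa [Category.comp_id]
  obtain ⟨v, hv⟩ : ∃ v : Fibre.push c φ.base e ⟶ z, Fibre.lift c φ.base e ≫ Fibre.map v = g₁ :=
    ⟨Fibre.homMk _ (Fibre.desc_w c φ.base (𝟙 _) e g₁ h₁'), Fibre.lift_desc c _ _ _ _ h₁'⟩
  subst hv
  subst h
  rw [φ.postcomp e _ v (Fibre.lift_w c _ _)]
  refine Eq.trans ?_ (Category.assoc _ _ _).symm
  rw [← ψ.precomp v e' g₂ h₂]
  unfold compApp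
  congr 1
  refine ψ.app_congr ?_ _ _
  refine Fibre.hom_ext c ψ.base (Fibre.desc_w c _ _ _ _ hg) (Fibre.homLift_map_comp v h₂) ?_
  rw [Fibre.lift_desc, Category.assoc]

/-- Composition of morphisms in the domain of `τ_* H`. -/
noncomputable def Hom.comp {p q r : Sect c H} (φ : Hom p q) (ψ : Hom q r) : Hom p r where
  base := φ.base ≫ ψ.base
  app := compApp φ ψ
  precomp {e₀ e} v e' g hg := by
    rw [compApp_eq φ ψ e₀ e' (Fibre.map v ≫ g) _ (Fibre.push c φ.base e)
      (Fibre.map v ≫ Fibre.lift c φ.base e) (Fibre.desc c φ.base ψ.base e g hg)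
      (Fibre.homLift_map_comp v (Fibre.lift_w c _ _)) (Fibre.desc_w c _ _ _ _ _) (by simp),
      φ.precomp v _ _ (Fibre.lift_w c _ _), Category.assoc]
    rfl
  postcomp e {e' e₁} g v hg := by
    rw [compApp_eq φ ψ e e₁ (g ≫ Fibre.map v) _ (Fibre.push c φ.base e) (Fibre.lift c φ.base e)
      (Fibre.desc c φ.base ψ.base e g hg ≫ Fibre.map v) (Fibre.lift_w c _ _)
      (Fibre.homLift_comp_map v (Fibre.desc_w c _ _ _ _ _)) (by simp),
      ψ.postcomp _ _ v (Fibre.desc_w c _ _ _ _ _), ← Category.assoc]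
    rfl
  w e e' g hg := by
    unfold compApp
    rw [H.map_comp, reassoc_of% (φ.w e (Fibre.push c φ.base e) _ (Fibre.lift_w c _ _)), ψ.w]
    exact Fibre.lift_desc_assoc c _ _ _ _ hg _

noncomputable instance : Category (Sect c H) where
  Hom := Hom
  id := Hom.id
  comp := Hom.comp
  id_comp {p q} φ := Hom.ext' (Category.id_comp _) fun e e' k hk hk' => by
    refine (compApp_eq (Hom.id p) φ e e' k hk e (𝟙 _) k (IsHomLift.id e.2) hk'
      (Category.id_comp _)).trans ?_
    refine Eq.trans ?_ (Category.id_comp _)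
    congr 1
    exact p.hat.map_id e
  comp_id {p q} φ := Hom.ext' (Category.comp_id _) fun e e' k hk hk' => by
    refine (compApp_eq φ (Hom.id q) e e' k hk e' k (𝟙 _) hk' (IsHomLift.id e'.2)
      (Category.comp_id _)).trans ?_
    refine Eq.trans ?_ (Category.comp_id _)
    congr 1
    exact q.hat.map_id e'
  assoc {p q r s} φ ψ χ := Hom.ext' (Category.assoc _ _ _) fun e e' k hk hk' => by
    have h1 := Fibre.desc_w c φ.base (ψ.base ≫ χ.base) e k hk'
    have hl := Fibre.lift_w c φ.base e
    have hl' := Fibre.lift_w c ψ.base (Fibre.push c φ.base e)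
    have hm := IsHomLift.comp τ φ.base ψ.base (Fibre.lift c φ.base e)
      (Fibre.lift c ψ.base (Fibre.push c φ.base e))
    refine (compApp_eq (Hom.comp φ ψ) χ e e' k hk (Fibre.push c ψ.base (Fibre.push c φ.base e)) _
      (Fibre.desc c ψ.base χ.base (Fibre.push c φ.base e) _ h1) hm
      (Fibre.desc_w c _ _ _ _ _) ?_).trans ?_
    · rw [Category.assoc, Fibre.lift_desc]
      exact Fibre.lift_desc c _ _ _ _ hk'
    · refine (congrArg (fun t => t ≫ _) (compApp_eq φ ψ e _ _ hm (Fibre.push c φ.base e) _ _ hl hl'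
        rfl)).trans ?_
      exact Category.assoc _ _ _

theorem hom_ext {p q : Sect c H} {f g : p ⟶ q} (h : Hom.base f = Hom.base g)
    (h' : ∀ e e' k (hk : τ.IsHomLift (Hom.base f) k) (hk' : τ.IsHomLift (Hom.base g) k),
      Hom.app f e e' k hk = Hom.app g e e' k hk') : f = g := Hom.ext' h h'

@[simp] theorem id_base (p : Sect c H) : Hom.base (𝟙 p) = 𝟙 p.base := rfl
@[simp] theorem comp_base {p q r : Sect c H} (f : p ⟶ q) (g : q ⟶ r) :
    Hom.base (f ≫ g) = Hom.base f ≫ Hom.base g := rfl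

theorem id_app (p : Sect c H) (e e' : τ.Fiber p.base) (g : Fibre.obj e ⟶ Fibre.obj e')
    (hg : τ.IsHomLift (𝟙 p.base) g) : Hom.app (𝟙 p) e e' g hg = p.hat.map (Fibre.homMk g hg) := rfl

/-- The composition rule, for an arbitrary factorization. -/
theorem comp_app {p q r : Sect c H} (φ : p ⟶ q) (ψ : q ⟶ r) (e : τ.Fiber p.base)
    (z : τ.Fiber q.base) (e' : τ.Fiber r.base) (g₁ : Fibre.obj e ⟶ Fibre.obj z)
    (g₂ : Fibre.obj z ⟶ Fibre.obj e') (h₁ : τ.IsHomLift (Hom.base φ) g₁)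
    (h₂ : τ.IsHomLift (Hom.base ψ) g₂) (h : τ.IsHomLift (Hom.base (φ ≫ ψ)) (g₁ ≫ g₂)) :
    Hom.app (φ ≫ ψ) e e' (g₁ ≫ g₂) h = Hom.app φ e z g₁ h₁ ≫ Hom.app ψ z e' g₂ h₂ :=
  compApp_eq φ ψ e e' _ h z g₁ g₂ h₁ h₂ rfl

variable (c H) in
/-- The functor `τ_* H`: projection to the first component. -/
noncomputable def toBase : Sect c H ⥤ B where
  obj p := p.base
  map f := f.base

/-- The morphism obtained by changing the triangles of source and target along equalities. -/
def recell {X Y : B} {h : τ.Fiber X ⥤ D} {k : τ.Fiber Y ⥤ D}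
    {a a' : Functor.Fiber.fiberInclusion ⟶ h ⋙ H} {b b' : Functor.Fiber.fiberInclusion ⟶ k ⋙ H}
    (ha : a = a') (hb : b' = b) (θ : Hom (⟨X, h, a'⟩ : Sect c H) ⟨Y, k, b'⟩) :
    Hom (⟨X, h, a⟩ : Sect c H) ⟨Y, k, b⟩ :=
  Hom.mk (p := ⟨X, h, a⟩) (q := ⟨Y, k, b⟩) θ.base θ.app θ.precomp θ.postcomp (by
    subst ha hb
    exact θ.w)

theorem conj_eq_recell {X Y : B} {h : τ.Fiber X ⥤ D} {k : τ.Fiber Y ⥤ D}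
    {a a' : Functor.Fiber.fiberInclusion ⟶ h ⋙ H} {b b' : Functor.Fiber.fiberInclusion ⟶ k ⋙ H}
    (ha : a = a') (hb : b' = b) (θ : (⟨X, h, a'⟩ : Sect c H) ⟶ ⟨Y, k, b'⟩)
    (ha' : (⟨X, h, a⟩ : Sect c H) = ⟨X, h, a'⟩) (hb' : (⟨Y, k, b'⟩ : Sect c H) = ⟨Y, k, b⟩) :
    eqToHom ha' ≫ θ ≫ eqToHom hb' = recell ha hb θ := by
  subst ha hb
  rw [eqToHom_refl, eqToHom_refl, Category.id_comp, Category.comp_id]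
  exact hom_ext rfl fun _ _ _ _ _ => rfl

end Sect

namespace LowerStar

variable (c : SplitOpfibration τ)

/-- The action of `τ_*` on objects. -/
noncomputable abbrev obj (H : LaxSlice E) : LaxSlice B where
  dom := Cat.of (Sect c H.proj)
  proj := Sect.toBase c H.proj

/-- The action of `τ_*` on a 1-cell: postcomposition of triangles. -/
noncomputable def hat {G H : LaxSlice E} (ψ : G ⟶ H) : Sect c G.proj ⥤ Sect c H.proj where
  obj p :=
    { base := p.base
      hat := p.hat ⋙ ψ.hat
      cell := p.cell ≫ Functor.whiskerLeft p.hat ψ.cell }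
  map {p q} φ :=
    { base := φ.base
      app := fun e e' g hg => ψ.hat.map (φ.app e e' g hg)
      precomp := fun v e' g hg => by
        rw [φ.precomp v e' g hg, ψ.hat.map_comp]
        rfl
      postcomp := fun e _ _ g v hg => by
        rw [φ.postcomp e g v hg, ψ.hat.map_comp]
        rfl
      w := fun e e' g hg => by
        have h1 := φ.w e e' g hg
        have h2 := ψ.cell.naturality (φ.app e e' g hg)
        dsimp at h1 h2 ⊢
        rw [Category.assoc, ← h2, reassoc_of% h1] }
  map_id p := Sect.hom_ext rfl fun e e' g hg _ => rfl
  map_comp {p q r} φ χ := Sect.hom_ext rfl fun e e' g hg _ => ψ.hat.map_comp _ _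

/-- The action of `τ_*` on 1-cells; the resulting triangle commutes strictly. -/
noncomputable def map {G H : LaxSlice E} (ψ : G ⟶ H) : obj c G ⟶ obj c H :=
  LaxSlice.Hom.mk (X := obj c G) (Y := obj c H) (hat c ψ)
    { app := fun p : Sect c G.proj => 𝟙 p.base
      naturality := fun (_ _ : Sect c G.proj) φ =>
        (Category.comp_id (Sect.Hom.base φ)).trans (Category.id_comp (Sect.Hom.base φ)).symm }

section

variable {G H : LaxSlice E} {ψ χ : G ⟶ H} (δ : ψ ⟶ χ) (p : Sect c G.proj)

/-- The functor part of the component at `p` of the action of `τ_*` on a 2-cell `δ`. -/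
def hat₂Map {e e' : τ.Fiber p.base} (v : e ⟶ e') :
    ψ.hat.obj (p.hat.obj e) ⟶ χ.hat.obj (p.hat.obj e') :=
  ψ.hat.map (p.hat.map v) ≫ δ.hat.app (p.hat.obj e')

theorem hat₂Map_comp {e e' e'' : τ.Fiber p.base} (v : e ⟶ e') (v' : e' ⟶ e'') :
    hat₂Map c δ p (v ≫ v') = ψ.hat.map (p.hat.map v) ≫ hat₂Map c δ p v' := by
  simp [hat₂Map]

theorem hat₂Map_comp' {e e' e'' : τ.Fiber p.base} (v : e ⟶ e') (v' : e' ⟶ e'') :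
    hat₂Map c δ p (v ≫ v') = hat₂Map c δ p v ≫ χ.hat.map (p.hat.map v') := by
  simp [hat₂Map]

theorem hat₂Map_id (e : τ.Fiber p.base) : hat₂Map c δ p (𝟙 e) = δ.hat.app (p.hat.obj e) := by
  simp [hat₂Map]

theorem hat₂Map_w {e e' : τ.Fiber p.base} (v : e ⟶ e') :
    (p.cell.app e ≫ ψ.cell.app (p.hat.obj e)) ≫ H.proj.map (hat₂Map c δ p v) =
      Fibre.map v ≫ p.cell.app e' ≫ χ.cell.app (p.hat.obj e') := by
  have h1 := p.cell.naturality v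
  have h2 := ψ.cell.naturality (p.hat.map v)
  have h3 := δ.w (p.hat.obj e')
  dsimp at h1 h2 h3
  rw [hat₂Map, H.proj.map_comp, Category.assoc, ← reassoc_of% h2, ← h3, reassoc_of% h1]

/-- The component at `p` of the action of `τ_*` on a 2-cell. -/
noncomputable def hat₂App : (hat c ψ).obj p ⟶ (hat c χ).obj p :=
  Sect.Hom.mk (p := (hat c ψ).obj p) (q := (hat c χ).obj p) (𝟙 p.base)
    (fun _ _ g hg => hat₂Map c δ p (Fibre.homMk g hg))
    (fun v _ g hg => hat₂Map_comp c δ p v (Fibre.homMk g hg))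
    (fun _ _ _ g v hg => hat₂Map_comp' c δ p (Fibre.homMk g hg) v)
    (fun _ _ g hg => hat₂Map_w c δ p (Fibre.homMk g hg))

end

/-- The natural transformation underlying the action of `τ_*` on a 2-cell. -/
noncomputable def hat₂ {G H : LaxSlice E} {ψ χ : G ⟶ H} (δ : ψ ⟶ χ) : hat c ψ ⟶ hat c χ where
  app p := hat₂App c δ p
  naturality p q φ := by
    have hb : Sect.Hom.base ((hat c ψ).map φ ≫ hat₂App c δ q) =
        Sect.Hom.base (hat₂App c δ p ≫ (hat c χ).map φ) :=
      (Category.comp_id (Sect.Hom.base φ)).trans (Category.id_comp (Sect.Hom.base φ)).symm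
    refine Sect.hom_ext hb fun e e' g hg hg' => ?_
    have hg₀ : τ.IsHomLift (Sect.Hom.base φ) g := by
      have := hg
      rwa [show Sect.Hom.base ((hat c ψ).map φ ≫ hat₂App c δ q) = Sect.Hom.base φ from
        Category.comp_id (Sect.Hom.base φ)] at this
    refine (Sect.compApp_eq ((hat c ψ).map φ) (hat₂App c δ q) e e' g hg e' g (𝟙 _) hg₀
      (IsHomLift.id e'.2) (Category.comp_id _)).trans ?_
    refine Eq.trans ?_ (Sect.compApp_eq (hat₂App c δ p) ((hat c χ).map φ) e e' g hg' e (𝟙 _) g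
      (IsHomLift.id e.2) hg₀ (Category.id_comp _)).symm
    exact (congrArg (fun t => ψ.hat.map (Sect.Hom.app φ e e' g hg₀) ≫ t)
      (hat₂Map_id c δ q e')).trans ((δ.hat.naturality (Sect.Hom.app φ e e' g hg₀)).trans
        (congrArg (fun t => t ≫ χ.hat.map (Sect.Hom.app φ e e' g hg₀)) (hat₂Map_id c δ p e)).symm)

/-- The action of `τ_*` on 2-cells. -/
noncomputable def map₂ {G H : LaxSlice E} {ψ χ : G ⟶ H} (δ : ψ ⟶ χ) : map c ψ ⟶ map c χ :=
  LaxSlice.Hom₂.mk (f := map c ψ) (g := map c χ) (hat₂ c δ)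
    (fun (p : Sect c G.proj) => Category.id_comp (𝟙 p.base))

theorem hat_id_obj (G : LaxSlice E) (p : Sect c G.proj) : (hat c (𝟙 G)).obj p = p :=
  congrArg (Sect.mk p.base p.hat) (by ext x; exact Category.comp_id _)

theorem hat_comp_obj {F G H : LaxSlice E} (ψ : F ⟶ G) (χ : G ⟶ H) (p : Sect c F.proj) :
    (hat c (ψ ≫ χ)).obj p = (hat c χ).obj ((hat c ψ).obj p) :=
  congrArg (Sect.mk p.base (p.hat ⋙ ψ.hat ⋙ χ.hat))
    (by ext x; exact (Category.assoc _ _ _).symm)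

theorem hat_id (G : LaxSlice E) : hat c (𝟙 G) = 𝟭 (Sect c G.proj) := by
  refine CategoryTheory.Functor.ext (hat_id_obj c G) fun p q φ => ?_
  refine Eq.trans ?_ (Sect.conj_eq_recell (by ext x; exact Category.comp_id _)
    (by ext x; exact (Category.comp_id _).symm) φ (hat_id_obj c G p) (hat_id_obj c G q).symm).symm
  exact Sect.hom_ext rfl fun _ _ _ _ _ => rfl

theorem hat_comp {F G H : LaxSlice E} (ψ : F ⟶ G) (χ : G ⟶ H) :
    hat c (ψ ≫ χ) = hat c ψ ⋙ hat c χ := by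
  refine CategoryTheory.Functor.ext (hat_comp_obj c ψ χ) fun p q φ => ?_
  refine Eq.trans ?_ (Sect.conj_eq_recell (by ext x; exact (Category.assoc _ _ _).symm)
    (by ext x; exact Category.assoc _ _ _) ((hat c χ).map ((hat c ψ).map φ))
    (hat_comp_obj c ψ χ p) (hat_comp_obj c ψ χ q).symm).symm
  exact Sect.hom_ext rfl fun _ _ _ _ _ => rfl

theorem map_id (G : LaxSlice E) : map c (𝟙 G) = 𝟙 (obj c G) := by
  refine LaxSlice.hom_ext (hat_id c G) (fun (p : Sect c G.proj) => ?_)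
  exact Category.id_comp (𝟙 p.base)

theorem map_comp {F G H : LaxSlice E} (ψ : F ⟶ G) (χ : G ⟶ H) :
    map c (ψ ≫ χ) = map c ψ ≫ map c χ := by
  refine LaxSlice.hom_ext (hat_comp c ψ χ) (fun (p : Sect c F.proj) => ?_)
  rfl

theorem map₂_id {G H : LaxSlice E} (ψ : G ⟶ H) : map₂ c (𝟙 ψ) = 𝟙 (map c ψ) :=
  LaxSlice.hom₂_ext fun (p : Sect c G.proj) =>
    show hat₂App c (𝟙 ψ) p = 𝟙 ((hat c ψ).obj p) from
      Sect.hom_ext rfl fun _ _ _ _ _ => Category.comp_id _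

theorem hat₂App_comp {G H : LaxSlice E} {ψ χ ω : G ⟶ H} (δ : ψ ⟶ χ) (δ' : χ ⟶ ω)
    (p : Sect c G.proj) : hat₂App c (δ ≫ δ') p = hat₂App c δ p ≫ hat₂App c δ' p := by
  refine Sect.hom_ext (Category.id_comp (𝟙 p.base)).symm fun e e' g hg hg' => ?_
  refine Eq.trans ?_ (Sect.compApp_eq (hat₂App c δ p) (hat₂App c δ' p) e e' g hg' e' g (𝟙 _) hg
      (IsHomLift.id e'.2) (Category.comp_id _)).symm
  refine Eq.trans ?_ (congrArg (fun t => hat₂Map c δ p (Fibre.homMk g hg) ≫ t)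
    (hat₂Map_id c δ' p e')).symm
  exact (Category.assoc _ _ _).symm

theorem map₂_comp {G H : LaxSlice E} {ψ χ ω : G ⟶ H} (δ : ψ ⟶ χ) (δ' : χ ⟶ ω) :
    map₂ c (δ ≫ δ') = map₂ c δ ≫ map₂ c δ' :=
  LaxSlice.hom₂_ext fun (p : Sect c G.proj) => hat₂App_comp c δ δ' p

theorem map₂_whiskerLeft {F G H : LaxSlice E} (ψ : F ⟶ G) {χ ω : G ⟶ H} (δ : χ ⟶ ω) :
    map₂ c (ψ ◁ δ) =
      eqToHom (map_comp c ψ χ) ≫ map c ψ ◁ map₂ c δ ≫ eqToHom (map_comp c ψ ω).symm := by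
  refine LaxSlice.hom₂_ext fun (p : Sect c F.proj) => ?_
  refine Eq.trans ?_ (LaxSlice.conj_hat _ _ _ _).symm
  refine Eq.trans ?_ (Sect.conj_eq_recell (by ext x; exact (Category.assoc _ _ _).symm)
    (by ext x; exact Category.assoc _ _ _) (hat₂App c δ ((hat c ψ).obj p))
    (hat_comp_obj c ψ χ p) (hat_comp_obj c ψ ω p).symm).symm
  exact Sect.hom_ext rfl fun _ _ _ _ _ => rfl

theorem map₂_whiskerRight {F G H : LaxSlice E} {ψ χ : F ⟶ G} (δ : ψ ⟶ χ) (ω : G ⟶ H) :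
    map₂ c (δ ▷ ω) =
      eqToHom (map_comp c ψ ω) ≫ map₂ c δ ▷ map c ω ≫ eqToHom (map_comp c χ ω).symm := by
  refine LaxSlice.hom₂_ext fun (p : Sect c F.proj) => ?_
  refine Eq.trans ?_ (LaxSlice.conj_hat _ _ _ _).symm
  refine Eq.trans ?_ (Sect.conj_eq_recell (by ext x; exact (Category.assoc _ _ _).symm)
    (by ext x; exact Category.assoc _ _ _) ((hat c ω).map (hat₂App c δ p))
    (hat_comp_obj c ψ ω p) (hat_comp_obj c χ ω p).symm).symm
  exact Sect.hom_ext rfl fun _ _ _ _ _ => (ω.hat.map_comp _ _).symm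

end LowerStar

/-- The 2-functor `τ_* : CAT // E ⥤ CAT // B`. It sends every 1-cell to a tight one. -/
noncomputable def lowerStar (c : SplitOpfibration τ) : FFunctor (LaxSlice E) (LaxSlice B) where
  toStrictPseudofunctor := StrictPseudofunctor.mk''
    { obj := LowerStar.obj c
      map := LowerStar.map c
      map₂ := LowerStar.map₂ c
      map₂_id := LowerStar.map₂_id c
      map₂_comp := LowerStar.map₂_comp c
      map_id := LowerStar.map_id c
      map_comp := LowerStar.map_comp c
      map₂_whisker_left := LowerStar.map₂_whiskerLeft c
      map₂_whisker_right := LowerStar.map₂_whiskerRight c }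
  map_tight _ _ := ⟨rfl, rfl⟩

/-- Evaluation `τ* τ_* H ⟶ H`: a pair of `(X, (α̂, α))` and `e` over `X` is sent to `α̂ e`, and
the component of the 2-cell is `α_e`. -/
noncomputable def evaluation (c : SplitOpfibration τ) (H : LaxSlice E) :
    (upperStar c).obj ((lowerStar c).obj H) ⟶ H :=
  LaxSlice.Hom.mk (X := UpperStar.obj τ (LowerStar.obj c H)) (Y := H)
    { obj := fun x : Pull τ (Sect.toBase c H.proj) => x.base.hat.obj (Functor.Fiber.mk x.w)
      map := fun {x y : Pull τ (Sect.toBase c H.proj)} f =>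
        Sect.Hom.app f.base (Functor.Fiber.mk x.w) (Functor.Fiber.mk y.w) f.fib f.w
      map_id := fun x : Pull τ (Sect.toBase c H.proj) => x.base.hat.map_id (Functor.Fiber.mk x.w)
      map_comp := fun {x y z : Pull τ (Sect.toBase c H.proj)} f g =>
        Sect.comp_app f.base g.base (Functor.Fiber.mk x.w) (Functor.Fiber.mk y.w)
          (Functor.Fiber.mk z.w) f.fib g.fib f.w g.w (Pull.Hom.w (f ≫ g)) }
    { app := fun x : Pull τ (Sect.toBase c H.proj) => x.base.cell.app (Functor.Fiber.mk x.w)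
      naturality := fun {x y : Pull τ (Sect.toBase c H.proj)} f =>
        (Sect.Hom.w f.base (Functor.Fiber.mk x.w) (Functor.Fiber.mk y.w) f.fib f.w).symm }

end

end LaxChangeOfBase

namespace LaxChangeOfBase

/-! ### Identity 2-cells -/

/-! Call a 2-cell an identity when it is an `eqToHom`. In strict bicategories all coherence cells
are identities. Identity cells are stable under composition, whiskering and 2-functors, satisfy two
out of three, and coincide when parallel (`IsIdCell.ext`). A pasting law whose factors are all
identities therefore needs no computation.

Existence of the adjunction. The unit sends `a` to the inclusion of the fibre over `F a` into the
pullback. Its structure cell at `α` sends a morphism `g` over `α_a` to the vertical factor of `g`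
through the chosen lift of `α_a`. A chosen lift of an identity is an identity, so this cell is an
identity when `α` is tight. For the same reason evaluation is strictly natural: `τ_*` makes every
1-cell tight. The triangle cells `s` and `t` are identities because `η` is tight. The only law in
which a structure cell at a loose 1-cell survives is naturality of `s`. There the cell occurs as
`τ*(η_α)` followed by evaluation, which takes the vertical factor of a chosen lift through itself,
an identity (`Triangle.isIdCell_map₂_cell`).

Preservation of cocylinders is formal (`LaxAdjunction.isUniversal_map`). Transposition sends `v : F
a ⟶ Q` to `η ≫ U v`. Right semi-laxity makes `v` equal to its double transpose, so transposition is
injective on 1-cells and on 2-cells. In the other direction, the comparison from the double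
transpose of `u` to `u` is built from `η_u` and `t`, and is an identity when `u` is tight.
Transposing `F x ≫ v` agrees with composing `x` with the transpose of `v` up to `η_x` (`slide`),
hence strictly for tight `x`. A cocylinder on `Q` under `F H` thus transposes to one on `U Q` under
`H`; the universal property of `μ` gives a 1-cell `C ⟶ U Q`, which is transposed back.

Two points need care. The structure cells of a transposed cocylinder involve `η` at possibly loose
1-cells `H f`; these are cancelled after untransposing, where they become identities
(`cancel_slide`). And the 1-cell `q` given by universality is not known to be tight, only its
composites with the components of `μ` are; `isIdCell_whiskerLeft_reflect` shows that this suffices.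
-/

namespace IsIdCell

section

variable {S : Type u} [Bicategory.{w, v} S] {a b c d : S}

theorem refl (f : a ⟶ b) : IsIdCell (𝟙 f) := ⟨rfl, rfl⟩

theorem comp {f g h : a ⟶ b} {θ : f ⟶ g} {φ : g ⟶ h} (hθ : IsIdCell θ) (hφ : IsIdCell φ) :
    IsIdCell (θ ≫ φ) := by
  obtain ⟨rfl, rfl⟩ := hθ
  obtain ⟨rfl, rfl⟩ := hφ
  exact ⟨rfl, by simp⟩

/-- By proof irrelevance: both cells are `eqToHom` of proofs of the same equation. This settles the
coherence laws below. -/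
theorem ext {f g : a ⟶ b} {θ θ' : f ⟶ g} (h : IsIdCell θ) (h' : IsIdCell θ') : θ = θ' := by
  obtain ⟨_, rfl⟩ := h
  obtain ⟨_, rfl⟩ := h'
  rfl

theorem eq_id {f : a ⟶ b} {θ : f ⟶ f} (h : IsIdCell θ) : θ = 𝟙 f := h.ext (refl f)

theorem isIso {f g : a ⟶ b} {θ : f ⟶ g} (h : IsIdCell θ) : IsIso θ := by
  obtain ⟨rfl, rfl⟩ := h
  infer_instance

/-- Two out of three. With `of_comp_right` it isolates one factor of a pasting composite known to be
an identity. -/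
theorem of_comp_left {f g h : a ⟶ b} {θ : f ⟶ g} {φ : g ⟶ h} (hθ : IsIdCell θ)
    (hφ : IsIdCell (θ ≫ φ)) : IsIdCell φ := by
  obtain ⟨rfl, rfl⟩ := hθ
  simpa using hφ

theorem of_comp_right {f g h : a ⟶ b} {θ : f ⟶ g} {φ : g ⟶ h} (hφ : IsIdCell φ)
    (hθ : IsIdCell (θ ≫ φ)) : IsIdCell θ := by
  obtain ⟨rfl, rfl⟩ := hφ
  simpa using hθ

theorem inv {f g : a ⟶ b} {e : f ≅ g} (h : IsIdCell e.hom) : IsIdCell e.inv :=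
  of_comp_left h (by rw [e.hom_inv_id]; exact refl f)

theorem whiskerLeft (f : a ⟶ b) {g h : b ⟶ c} {θ : g ⟶ h} (hθ : IsIdCell θ) :
    IsIdCell (f ◁ θ) := by
  obtain ⟨rfl, rfl⟩ := hθ
  exact ⟨rfl, by simp⟩

theorem whiskerRight {f g : a ⟶ b} {θ : f ⟶ g} (hθ : IsIdCell θ) (h : b ⟶ c) :
    IsIdCell (θ ▷ h) := by
  obtain ⟨rfl, rfl⟩ := hθ
  exact ⟨rfl, by simp⟩

theorem map₂ {T : Type u₂} [Bicategory.{w₂, v₂} T] (F : PrelaxFunctor S T) {f g : a ⟶ b}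
    {θ : f ⟶ g} (hθ : IsIdCell θ) : IsIdCell (F.map₂ θ) := by
  obtain ⟨rfl, rfl⟩ := hθ
  exact ⟨rfl, by simp⟩

variable [Bicategory.Strict S]

theorem associator_hom (f : a ⟶ b) (g : b ⟶ c) (h : c ⟶ d) : IsIdCell (α_ f g h).hom :=
  ⟨Bicategory.Strict.assoc f g h, by rw [Bicategory.Strict.associator_eqToIso]; rfl⟩

theorem associator_inv (f : a ⟶ b) (g : b ⟶ c) (h : c ⟶ d) : IsIdCell (α_ f g h).inv :=
  (associator_hom f g h).inv

theorem leftUnitor_hom (f : a ⟶ b) : IsIdCell (λ_ f).hom :=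
  ⟨Bicategory.Strict.id_comp f, by rw [Bicategory.Strict.leftUnitor_eqToIso]; rfl⟩

theorem leftUnitor_inv (f : a ⟶ b) : IsIdCell (λ_ f).inv := (leftUnitor_hom f).inv

theorem rightUnitor_hom (f : a ⟶ b) : IsIdCell (ρ_ f).hom :=
  ⟨Bicategory.Strict.comp_id f, by rw [Bicategory.Strict.rightUnitor_eqToIso]; rfl⟩

theorem rightUnitor_inv (f : a ⟶ b) : IsIdCell (ρ_ f).inv := (rightUnitor_hom f).inv

/-- The cell `θ` itself need not be an identity. The intended case is `θ = F(η_x)` with `η_x` a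
genuine 2-cell that becomes an identity only after whiskering with the counit. -/
theorem whiskerRight_comp {f g : a ⟶ b} {θ : f ⟶ g} {h : b ⟶ c} (hθ : IsIdCell (θ ▷ h))
    (k : c ⟶ d) : IsIdCell (θ ▷ (h ≫ k)) := by
  rw [Bicategory.whiskerRight_comp]
  exact (associator_inv _ _ _).comp ((hθ.whiskerRight k).comp (associator_hom _ _ _))

theorem comp_whiskerRight_iff {f g : a ⟶ b} {θ : f ⟶ g} {h : b ⟶ c}
    {k : c ⟶ d} : IsIdCell (θ ▷ h ▷ k) ↔ IsIdCell (θ ▷ (h ≫ k)) := by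
  rw [Bicategory.whiskerRight_comp]
  exact ⟨fun h => (associator_inv _ _ _).comp (h.comp (associator_hom _ _ _)),
    fun h => of_comp_right (associator_hom _ _ _) (of_comp_left (associator_inv _ _ _) h)⟩

end

section

variable {S : Type u₁} [Bicategory.{w₁, v₁} S] {T : Type u₂} [Bicategory.{w₂, v₂} T]
  (F : StrictPseudofunctor S T)

theorem mapComp_hom {a b c : S} (f : a ⟶ b) (g : b ⟶ c) : IsIdCell (F.mapComp f g).hom :=
  ⟨F.map_comp f g, by rw [F.mapComp_eq_eqToIso]; rfl⟩

theorem mapComp_inv {a b c : S} (f : a ⟶ b) (g : b ⟶ c) : IsIdCell (F.mapComp f g).inv :=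
  (mapComp_hom F f g).inv

theorem mapId_hom (a : S) : IsIdCell (F.mapId a).hom :=
  ⟨F.map_id a, by rw [F.mapId_eq_eqToIso]; rfl⟩

theorem mapId_inv (a : S) : IsIdCell (F.mapId a).inv := (mapId_hom F a).inv

end

/-- Identity 2-cells of `Cat` are detected componentwise. -/
theorem cat_iff {C D : Cat.{v, u}} {F G : C ⟶ D} {θ : F ⟶ G} : IsIdCell θ ↔
    ∀ X : C, ∃ h : F.toFunctor.obj X = G.toFunctor.obj X, θ.toNatTrans.app X = eqToHom h := by
  constructor
  · rintro ⟨rfl, rfl⟩ X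
    exact ⟨rfl, by simp⟩
  · intro h
    -- Naturality of a transformation with identity components forces the functors to agree on
    -- morphisms too.
    have h' : F = G := by
      ext1
      refine CategoryTheory.Functor.ext (fun X => (h X).1) fun X Y f => ?_
      have := θ.toNatTrans.naturality f
      rw [(h X).2, (h Y).2] at this
      rw [← Category.assoc, ← this]
      simp
    subst h'
    exact ⟨rfl, by ext X; simp [(h X).2]⟩

end IsIdCell

/-! ### Transposition along a lax unit -/

/-- The data of a lax natural transformation `1 ⟶ U F`, spelled out. -/
structure LaxUnit {S : Type u₁} [Bicategory.{w₁, v₁} S] {T : Type u₂} [Bicategory.{w₂, v₂} T]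
    (F : StrictPseudofunctor S T) (U : StrictPseudofunctor T S) where
  /-- The components. -/
  app (a : S) : a ⟶ U.obj (F.obj a)
  /-- The structure 2-cells. -/
  nat {a b : S} (x : a ⟶ b) : app a ≫ U.map (F.map x) ⟶ x ≫ app b
  nat_naturality {a b : S} {x x' : a ⟶ b} (θ : x ⟶ x') :
    nat x ≫ θ ▷ app b = app a ◁ U.map₂ (F.map₂ θ) ≫ nat x'
  nat_id (a : S) : nat (𝟙 a) =
    app a ◁ U.map₂ (F.mapId a).hom ≫ app a ◁ (U.mapId (F.obj a)).hom ≫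
      (ρ_ (app a)).hom ≫ (λ_ (app a)).inv
  nat_comp {a b c : S} (x : a ⟶ b) (y : b ⟶ c) : nat (x ≫ y) =
    app a ◁ U.map₂ (F.mapComp x y).hom ≫ app a ◁ (U.mapComp (F.map x) (F.map y)).hom ≫
      (α_ _ _ _).inv ≫ nat x ▷ U.map (F.map y) ≫ (α_ _ _ _).hom ≫ x ◁ nat y ≫ (α_ _ _ _).inv

namespace LaxUnit

variable {S : Type u₁} [Bicategory.{w₁, v₁} S] {T : Type u₂} [Bicategory.{w₂, v₂} T]
  {F : StrictPseudofunctor S T} {U : StrictPseudofunctor T S}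

/-- The comparison cells of `U F` are invertible, so the lax unit law can be solved for the
structure cell `n`. In this form, as for `of_naturality_comp`, the law serves as a rewriting rule.
-/
theorem of_naturality_id {a : S} {e : a ⟶ U.obj (F.obj a)}
    {n : e ≫ U.map (F.map (𝟙 a)) ⟶ 𝟙 a ≫ e}
    (h : e ◁ ((U.mapId (F.obj a)).inv ≫ U.map₂ (F.mapId a).inv) ≫ n =
      (ρ_ e).hom ≫ (λ_ e).inv ≫ 𝟙 (𝟙 a) ▷ e) :
    n = e ◁ U.map₂ (F.mapId a).hom ≫ e ◁ (U.mapId (F.obj a)).hom ≫ (ρ_ e).hom ≫ (λ_ e).inv := by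
  rw [id_whiskerRight, Category.comp_id] at h
  rw [← h]
  have k : e ◁ U.map₂ (F.mapId a).hom ≫ e ◁ U.map₂ (F.mapId a).inv = 𝟙 _ := by
    rw [← Bicategory.whiskerLeft_comp, ← PrelaxFunctor.map₂_comp, Iso.hom_inv_id]
    simp
  rw [Bicategory.whiskerLeft_comp, Category.assoc, whiskerLeft_hom_inv_assoc, reassoc_of% k]

theorem of_naturality_comp {a b c : S} {x : a ⟶ b} {y : b ⟶ c} {e : a ⟶ U.obj (F.obj a)}
    {e' : b ⟶ U.obj (F.obj b)} {e'' : c ⟶ U.obj (F.obj c)} {n : e ≫ U.map (F.map x) ⟶ x ≫ e'}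
    {n' : e' ≫ U.map (F.map y) ⟶ y ≫ e''} {m : e ≫ U.map (F.map (x ≫ y)) ⟶ (x ≫ y) ≫ e''}
    (h : e ◁ ((U.mapComp (F.map x) (F.map y)).inv ≫ U.map₂ (F.mapComp x y).inv) ≫ m =
      (α_ _ _ _).inv ≫ n ▷ U.map (F.map y) ≫ (α_ _ _ _).hom ≫ x ◁ n' ≫ (α_ _ _ _).inv ≫
        𝟙 (x ≫ y) ▷ e'') :
    m = e ◁ U.map₂ (F.mapComp x y).hom ≫ e ◁ (U.mapComp (F.map x) (F.map y)).hom ≫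
      (α_ _ _ _).inv ≫ n ▷ U.map (F.map y) ≫ (α_ _ _ _).hom ≫ x ◁ n' ≫ (α_ _ _ _).inv := by
  rw [id_whiskerRight, Category.comp_id] at h
  rw [← h]
  have k : e ◁ U.map₂ (F.mapComp x y).hom ≫ e ◁ U.map₂ (F.mapComp x y).inv = 𝟙 _ := by
    rw [← Bicategory.whiskerLeft_comp, ← PrelaxFunctor.map₂_comp, Iso.hom_inv_id]
    simp
  rw [Bicategory.whiskerLeft_comp, Category.assoc, whiskerLeft_hom_inv_assoc, reassoc_of% k]

/-- The data of a lax natural transformation `1 ⟶ U F`. -/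
def ofLaxTrans (η : Lax.LaxTrans (StrictPseudofunctor.id S).toLax (F.comp U).toLax) :
    LaxUnit F U where
  app a := η.app a
  nat x := η.naturality x
  nat_naturality θ := η.naturality_naturality θ
  nat_id a := of_naturality_id (η.naturality_id a)
  nat_comp x y := of_naturality_comp (η.naturality_comp x y)

variable (η : LaxUnit F U)

/-- The transpose `η ≫ U v` of a 1-cell `v : F a ⟶ Q`. -/
abbrev transpose {a : S} {Q : T} (v : F.obj a ⟶ Q) : a ⟶ U.obj Q :=
  η.app a ≫ U.map v

/-- The action of `transpose` on 2-cells. -/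
def transpose₂ {a : S} {Q : T} {v v' : F.obj a ⟶ Q} (δ : v ⟶ v') :
    η.transpose v ⟶ η.transpose v' :=
  η.app a ◁ U.map₂ δ

@[simp]
theorem transpose₂_id {a : S} {Q : T} (v : F.obj a ⟶ Q) :
    η.transpose₂ (𝟙 v) = 𝟙 (η.transpose v) := by
  simp [transpose₂, transpose]

theorem transpose₂_comp {a : S} {Q : T} {v v' v'' : F.obj a ⟶ Q} (δ : v ⟶ v') (δ' : v' ⟶ v'') :
    η.transpose₂ (δ ≫ δ') = η.transpose₂ δ ≫ η.transpose₂ δ' := by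
  simp [transpose₂]

/-- The comparison between the transpose of `F x ≫ v` and the composite of `x` with the transpose
of `v`. -/
def slide {a b : S} (x : a ⟶ b) {Q : T} (v : F.obj b ⟶ Q) :
    η.transpose (F.map x ≫ v) ⟶ x ≫ η.transpose v :=
  η.app a ◁ (U.mapComp (F.map x) v).hom ≫ (α_ _ _ _).inv ≫ η.nat x ▷ U.map v ≫
    (α_ _ _ _).hom

/-- Interchange of `η_x` with `U δ`. -/
theorem slide_naturality_right {a b : S} (x : a ⟶ b) {Q : T} {v v' : F.obj b ⟶ Q} (δ : v ⟶ v') :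
    η.transpose₂ (F.map x ◁ δ) ≫ η.slide x v' = η.slide x v ≫ x ◁ η.transpose₂ δ := by
  have h := whisker_exchange (η.nat x) (U.map₂ δ)
  dsimp only [transpose₂, slide]
  simp only [Category.assoc, Pseudofunctor.map₂_whisker_left, Bicategory.whiskerLeft_comp,
    Bicategory.whiskerLeft_inv_hom_assoc]
  rw [← associator_naturality_right, ← reassoc_of% h]
  simp

/-- Naturality of `η` in the 2-cell `θ`, whiskered with `U v`. -/
theorem slide_naturality_left {a b : S} {x x' : a ⟶ b} (θ : x ⟶ x') {Q : T} (v : F.obj b ⟶ Q) :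
    η.transpose₂ (F.map₂ θ ▷ v) ≫ η.slide x' v = η.slide x v ≫ θ ▷ η.transpose v := by
  have h := congrArg (fun t => t ▷ U.map v) (η.nat_naturality θ)
  simp only [comp_whiskerRight] at h
  dsimp only [transpose₂, slide, transpose]
  simp only [Category.assoc, Pseudofunctor.map₂_whisker_right, Bicategory.whiskerLeft_comp,
    Bicategory.whiskerLeft_inv_hom_assoc]
  rw [← associator_naturality_left, reassoc_of% h]
  simp

theorem slide_id (a : S) {Q : T} (v : F.obj a ⟶ Q) :
    η.slide (𝟙 a) v ≫ (λ_ (η.transpose v)).hom =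
      η.transpose₂ ((F.mapId a).hom ▷ v ≫ (λ_ v).hom) := by
  dsimp only [transpose₂, slide, transpose]
  rw [η.nat_id]
  simp

/-- The composition law of `η`, whiskered with `U v`; moving the comparison cell of `U` past `η_x`
uses interchange. -/
theorem slide_comp {a b c : S} (x : a ⟶ b) (y : b ⟶ c) {Q : T} (v : F.obj c ⟶ Q) :
    η.slide (x ≫ y) v ≫ (α_ x y (η.transpose v)).hom =
      η.transpose₂ ((F.mapComp x y).hom ▷ v ≫ (α_ _ _ _).hom) ≫ η.slide x (F.map y ≫ v) ≫
        x ◁ η.slide y v := by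
  dsimp only [transpose₂, slide, transpose]
  rw [η.nat_comp]
  have h := whisker_exchange (η.nat x) (U.mapComp (F.map y) v).hom
  simp only [Pseudofunctor.map₂_whisker_right, PrelaxFunctor.map₂_comp,
    Pseudofunctor.map₂_associator, Bicategory.whiskerLeft_comp, comp_whiskerRight, whisker_assoc,
    Category.assoc, Bicategory.whiskerLeft_inv_hom_assoc]
  rw [← associator_naturality_right_assoc, ← reassoc_of% h]
  simp

/-- With `θ` a structure cell of a cocylinder, this is the modification axiom for
`slideModification`. -/
theorem slide_comp_of_cell {a b c : S} {x : a ⟶ b} {y : b ⟶ c} {z : a ⟶ c} (θ : z ⟶ x ≫ y)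
    {Q : T} (v : F.obj c ⟶ Q) :
    η.slide z v ≫ θ ▷ η.transpose v ≫ (α_ x y (η.transpose v)).hom =
      (η.transpose₂ ((F.map₂ θ ≫ (F.mapComp x y).hom) ▷ v ≫ (α_ _ _ _).hom) ≫
        η.slide x (F.map y ≫ v)) ≫ x ◁ η.slide y v := by
  have h := η.slide_comp x y v
  simp only [comp_whiskerRight, transpose₂_comp, Category.assoc] at h ⊢
  rw [← h, ← reassoc_of% (η.slide_naturality_left θ v)]

end LaxUnit

/-! ### Oplax transformations of `Cat`-valued functors -/

section

variable {A : Type u₁} [Bicategory.{w₁, v₁} A] {P P' P'' : OplaxFunctor A Cat.{v, u}}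

theorem vcomp_naturality_app (σ : Oplax.OplaxTrans P P') (θ : Oplax.OplaxTrans P' P'') {a b : A}
    (f : a ⟶ b) (X : P.obj a) :
    ((σ.vcomp θ).naturality f).toNatTrans.app X =
      (θ.app b).toFunctor.map ((σ.naturality f).toNatTrans.app X) ≫
        (θ.naturality f).toNatTrans.app ((σ.app a).toFunctor.obj X) := by
  -- The identities are components of associators of `Cat`.
  change 𝟙 _ ≫ (θ.app b).toFunctor.map ((σ.naturality f).toNatTrans.app X) ≫ 𝟙 _ ≫
    (θ.naturality f).toNatTrans.app ((σ.app a).toFunctor.obj X) ≫ 𝟙 _ = _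
  simp

theorem isIdCell_vcomp_naturality {σ : Oplax.OplaxTrans P P'} {θ : Oplax.OplaxTrans P' P''}
    {a b : A} {f : a ⟶ b} (hσ : IsIdCell (σ.naturality f)) (hθ : IsIdCell (θ.naturality f)) :
    IsIdCell ((σ.vcomp θ).naturality f) :=
  (IsIdCell.associator_inv _ _ _).comp ((hσ.whiskerRight _).comp
    ((IsIdCell.associator_hom _ _ _).comp ((hθ.whiskerLeft _).comp
      (IsIdCell.associator_inv _ _ _))))

/-- Oplax transformations are equal when they are related by a modification whose components are
identities. -/
theorem oplaxTrans_eq_of_modification {σ θ : Oplax.OplaxTrans P P'}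
    (Γ : Oplax.OplaxTrans.Modification σ θ) (h : ∀ a, IsIdCell (Γ.app a)) : σ = θ := by
  obtain ⟨x, n, _, _, _⟩ := σ
  obtain ⟨y, m, _, _, _⟩ := θ
  -- Once the component functors are identified, the modification has identity components and its
  -- axiom equates the structure cells.
  obtain rfl : x = y := funext fun a => (h a).1
  congr 1
  funext a b f
  have := Γ.naturality f
  have h1 := fun a => (h a).eq_id
  dsimp at this h1
  rw [h1, h1] at this
  simpa using this.symm

/-- `N` and `N'` force their sources and targets to be equal, so `Γ` can be transported along them;
the equation records the result componentwise. -/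
theorem exists_modification_conj {σ σ' θ θ' : Oplax.OplaxTrans P P'}
    (N : Oplax.OplaxTrans.Modification σ θ) (N' : Oplax.OplaxTrans.Modification σ' θ')
    (hN : ∀ a, IsIdCell (N.app a)) (hN' : ∀ a, IsIdCell (N'.app a))
    (Γ : Oplax.OplaxTrans.Modification σ σ') :
    ∃ Γ' : Oplax.OplaxTrans.Modification θ θ', ∀ a, Γ.app a ≫ N'.app a = N.app a ≫ Γ'.app a := by
  obtain rfl := oplaxTrans_eq_of_modification N hN
  obtain rfl := oplaxTrans_eq_of_modification N' hN'
  exact ⟨Γ, fun a => by rw [(hN a).eq_id, (hN' a).eq_id, Category.comp_id, Category.id_comp]⟩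

end

/-! ### Transposition of cocylinders -/

namespace LaxUnit

variable {S : Type u} [Bicategory.{w, v} S] {T : Type u₂} [Bicategory.{w, v} T]
  {A : Type u₁} [Bicategory.{w₁, v₁} A]
  {F : StrictPseudofunctor S T} {U : StrictPseudofunctor T S} (η : LaxUnit F U)

/-- Transposition, as a functor between categories of 1-cells. -/
def transposeFunctor (a : S) (Q : T) : (F.obj a ⟶ Q) ⥤ (a ⟶ U.obj Q) where
  obj v := η.transpose v
  map δ := η.transpose₂ δ
  map_id v := η.transpose₂_id v
  map_comp δ δ' := η.transpose₂_comp δ δ'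

/-- Transposition, as an oplax transformation `T(F(H(-)), Q) ⟶ S(H(-), U(Q))`. -/
def transposeTrans (H : StrictPseudofunctor A S) (Q : T) :
    Oplax.OplaxTrans (homPresheaf (H.comp F) Q).toOplax (homPresheaf H (U.obj Q)).toOplax where
  app a := (η.transposeFunctor (H.obj (unop a)) Q).toCatHom
  naturality {a b} f := NatTrans.toCatHom₂
    { app := fun (x : F.obj (H.obj (unop a)) ⟶ Q) => η.slide (H.map f.unop) x
      naturality := fun (x y : F.obj (H.obj (unop a)) ⟶ Q) δ =>
        η.slide_naturality_right (H.map f.unop) δ }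
  naturality_naturality {a b f g} θ := by
    ext (x : F.obj (H.obj (unop a)) ⟶ Q)
    exact η.slide_naturality_left (H.map₂ θ.unop2) x
  naturality_id a := by
    ext (x : F.obj (H.obj (unop a)) ⟶ Q)
    change η.slide (H.map (𝟙 (unop a))) x ≫ (H.mapId (unop a)).hom ▷ η.transpose x ≫
        (λ_ (η.transpose x)).hom =
      η.transpose₂ ((F.map₂ (H.mapId (unop a)).hom ≫ (F.mapId _).hom) ▷ x ≫ (λ_ x).hom) ≫ 𝟙 _ ≫ 𝟙 _
    -- The comparison cell of `H` is first moved inside the transpose, leaving `slide` at an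
    -- identity 1-cell.
    rw [← reassoc_of% (η.slide_naturality_left (H.mapId (unop a)).hom x), slide_id]
    simp [transpose₂_comp]
  naturality_comp {a b c} f g := by
    ext (x : F.obj (H.obj (unop a)) ⟶ Q)
    change η.slide (H.map (g.unop ≫ f.unop)) x ≫
        (H.mapComp g.unop f.unop).hom ▷ η.transpose x ≫ (α_ _ _ _).hom =
      η.transpose₂ ((F.map₂ (H.mapComp g.unop f.unop).hom ≫ (F.mapComp _ _).hom) ▷ x ≫
        (α_ _ _ _).hom) ≫ 𝟙 _ ≫
        η.slide (H.map g.unop) (F.map (H.map f.unop) ≫ x) ≫ 𝟙 _ ≫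
        H.map g.unop ◁ η.slide (H.map f.unop) x ≫ 𝟙 _
    rw [← reassoc_of% (η.slide_naturality_left (H.mapComp g.unop f.unop).hom x), slide_comp]
    simp [transpose₂_comp]

variable {W : StrictPseudofunctor Aᵒᵖ Cat.{w, v}} {H : StrictPseudofunctor A S} {C : S}

/-- The comparison between the transpose of the cocylinder induced by `v` and the cocylinder
induced by the transpose of `v`. -/
def slideModification (μ : OplaxCocylinder W H C) {Q : T} (v : F.obj C ⟶ Q) :
    Oplax.OplaxTrans.Modification (((μ.map F).postcomp v).vcomp (η.transposeTrans H Q))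
      (μ.postcomp (η.transpose v)) where
  app a := Cat.Hom₂.ofNatTrans
    { app := fun X => η.slide (μ.component (unop a) X) v
      naturality := fun X Y φ =>
        η.slide_naturality_left ((μ.app a).toFunctor.map φ) v }
  naturality {a b} f := by
    ext X
    have e1 : ((μ.postcomp (η.transpose v)).naturality f).toNatTrans.app X =
        (μ.naturality f).toNatTrans.app X ▷ η.transpose v ≫
          (α_ (H.map f.unop) (μ.component (unop a) X) (η.transpose v)).hom :=
      vcomp_naturality_app μ (postcompTrans H (η.transpose v)) f X
    have e2 :
        ((((μ.map F).postcomp v).vcomp (η.transposeTrans H Q)).naturality f).toNatTrans.app X =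
        η.transpose₂ ((F.map₂ ((μ.naturality f).toNatTrans.app X) ≫
          (F.mapComp (H.map f.unop) (μ.component (unop a) X)).hom) ▷ v ≫
          (α_ (F.map (H.map f.unop)) (F.map (μ.component (unop a) X)) v).hom) ≫
        η.slide (H.map f.unop) (F.map (μ.component (unop a) X) ≫ v) :=
      (vcomp_naturality_app ((μ.map F).postcomp v) (η.transposeTrans H Q) f X).trans
        (congrArg (fun t => η.transpose₂ t ≫
          η.slide (H.map f.unop) (F.map (μ.component (unop a) X) ≫ v))
          ((vcomp_naturality_app (μ.map F) (postcompTrans (H.comp F) v) f X).trans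
            (congrArg (fun t => t ▷ v ≫
              (α_ (F.map (H.map f.unop)) (F.map (μ.component (unop a) X)) v).hom)
              (vcomp_naturality_app μ (mapTrans H F C) f X))))
    change η.slide (μ.component (unop b) ((W.map f).toFunctor.obj X)) v ≫ _ =
      _ ≫ H.map f.unop ◁ η.slide (μ.component (unop a) X) v
    rw [e1, e2]
    exact η.slide_comp_of_cell ((μ.naturality f).toNatTrans.app X) v

end LaxUnit

/-- Applied to transposition, to recover the component functors of a cocylinder from those of its
transpose. -/
theorem functor_eq_of_comp_eq {C : Type u} {D : Type u₁} {E : Type u₂} [Category.{v} C]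
    [Category.{v₁} D] [Category.{v₂} E] {K K' : C ⥤ D} {R : D ⥤ E}
    (hobj : Function.Injective R.obj) (hmap : R.Faithful) (h : K ⋙ R = K' ⋙ R) : K = K' :=
  CategoryTheory.Functor.ext (fun X => hobj (CategoryTheory.Functor.congr_obj h X))
    fun X Y f => R.map_injective (by
      have := CategoryTheory.Functor.congr_hom h f
      simpa [eqToHom_map] using this)

/-! ### Double transposition along a lax adjunction -/

namespace LaxAdjunction

section

variable {S : Type u₁} [Bicategory.{w₁, v₁} S] {T : Type u₂} [Bicategory.{w₂, v₂} T]
  {F : StrictPseudofunctor S T} {U : StrictPseudofunctor T S} (adj : LaxAdjunction F U)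

/-- The unit, with its data spelled out. -/
def laxUnit : LaxUnit F U := LaxUnit.ofLaxTrans adj.unit

/-- The components of the counit. -/
def counitApp (Q : T) : F.obj (U.obj Q) ⟶ Q := adj.counit.app Q

/-- The structure 2-cells of the counit. -/
def counitCell {P Q : T} (g : P ⟶ Q) :
    adj.counitApp P ≫ g ⟶ F.map (U.map g) ≫ adj.counitApp Q :=
  adj.counit.naturality g

theorem counitCell_naturality {P Q : T} {g g' : P ⟶ Q} (δ : g ⟶ g') :
    adj.counitCell g ≫ F.map₂ (U.map₂ δ) ▷ adj.counitApp Q =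
      adj.counitApp P ◁ δ ≫ adj.counitCell g' :=
  adj.counit.naturality_naturality δ

/-- The components of the modification `s`. -/
def unitTriangle (a : S) : 𝟙 (F.obj a) ⟶ F.map (adj.laxUnit.app a) ≫ adj.counitApp (F.obj a) :=
  adj.s a

/-- The components of the modification `t`. -/
def counitTriangle (Q : T) : adj.laxUnit.app (U.obj Q) ≫ U.map (adj.counitApp Q) ⟶ 𝟙 (U.obj Q) :=
  adj.t Q

theorem unitTriangle_naturality {a b : S} (x : a ⟶ b) :
    adj.unitTriangle a ▷ F.map x ≫ (α_ _ _ _).hom ≫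
        F.map (adj.laxUnit.app a) ◁ adj.counitCell (F.map x) ≫ (α_ _ _ _).inv ≫
        ((F.mapComp (adj.laxUnit.app a) (U.map (F.map x))).inv ≫ F.map₂ (adj.laxUnit.nat x) ≫
          (F.mapComp x (adj.laxUnit.app b)).hom) ▷ adj.counitApp (F.obj b) ≫ (α_ _ _ _).hom =
      (λ_ (F.map x)).hom ≫ (ρ_ (F.map x)).inv ≫ F.map x ◁ adj.unitTriangle b :=
  adj.s_naturality x

/-- The transpose `F u ≫ ε` of a 1-cell `u : a ⟶ U Q`. -/
abbrev untranspose {a : S} {Q : T} (u : a ⟶ U.obj Q) : F.obj a ⟶ Q :=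
  F.map u ≫ adj.counitApp Q

/-- The action of `untranspose` on 2-cells. -/
def untranspose₂ {a : S} {Q : T} {u u' : a ⟶ U.obj Q} (δ : u ⟶ u') :
    adj.untranspose u ⟶ adj.untranspose u' :=
  F.map₂ δ ▷ adj.counitApp Q

theorem untranspose₂_comp {a : S} {Q : T} {u u' u'' : a ⟶ U.obj Q} (δ : u ⟶ u') (δ' : u' ⟶ u'') :
    adj.untranspose₂ (δ ≫ δ') = adj.untranspose₂ δ ≫ adj.untranspose₂ δ' := by
  simp [untranspose₂]

theorem isIdCell_untranspose₂ {a : S} {Q : T} {u u' : a ⟶ U.obj Q} {δ : u ⟶ u'}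
    (h : IsIdCell δ) : IsIdCell (adj.untranspose₂ δ) :=
  (h.map₂ F.toPrelaxFunctor).whiskerRight _

/-- The comparison between `v` and the 1-cell obtained by transposing twice. -/
def coreflect {a : S} {Q : T} (v : F.obj a ⟶ Q) :
    v ⟶ adj.untranspose (adj.laxUnit.transpose v) :=
  (λ_ v).inv ≫ adj.unitTriangle a ▷ v ≫ (α_ (F.map (adj.laxUnit.app a)) _ v).hom ≫
    F.map (adj.laxUnit.app a) ◁ adj.counitCell v ≫ (α_ _ _ _).inv ≫
    (F.mapComp (adj.laxUnit.app a) (U.map v)).inv ▷ adj.counitApp Q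

/-- `coreflect` is `s` followed by `ε_v`: interchange handles the first, naturality of `ε` in
2-cells the second. -/
theorem coreflect_naturality {a : S} {Q : T} {v v' : F.obj a ⟶ Q} (δ : v ⟶ v') :
    δ ≫ adj.coreflect v' =
      adj.coreflect v ≫ adj.untranspose₂ (adj.laxUnit.transpose₂ δ) := by
  have h1 := whisker_exchange (adj.unitTriangle a) δ
  have h2 := congrArg (fun t => F.map (adj.laxUnit.app a) ◁ t) (adj.counitCell_naturality δ)
  dsimp only [coreflect, untranspose₂, LaxUnit.transpose₂]
  simp only [Bicategory.whiskerLeft_comp] at h2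
  simp only [Category.assoc, Pseudofunctor.map₂_whisker_left, comp_whiskerRight,
    inv_hom_whiskerRight_assoc, whisker_assoc, Iso.inv_hom_id_assoc]
  rw [reassoc_of% h2, leftUnitor_inv_naturality_assoc, reassoc_of% h1]
  simp

/-- The comparison between `u` and the 1-cell obtained by transposing twice. -/
def reflect {a : S} {Q : T} (u : a ⟶ U.obj Q) :
    adj.laxUnit.transpose (adj.untranspose u) ⟶ u :=
  adj.laxUnit.slide u (adj.counitApp Q) ≫ u ◁ adj.counitTriangle Q ≫ (ρ_ u).hom

theorem reflect_naturality {a : S} {Q : T} {u u' : a ⟶ U.obj Q} (δ : u ⟶ u') :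
    adj.laxUnit.transpose₂ (adj.untranspose₂ δ) ≫ adj.reflect u' = adj.reflect u ≫ δ := by
  have h1 := adj.laxUnit.slide_naturality_left δ (adj.counitApp Q)
  have h2 := whisker_exchange δ (adj.counitTriangle Q)
  dsimp only [reflect, untranspose₂]
  rw [reassoc_of% h1]
  simp only [Category.assoc]
  rw [← reassoc_of% h2, rightUnitor_naturality]

variable {adj} [Bicategory.Strict T]

/-- Besides coherence cells only `s` and `ε_v` occur, and both are identities by right semi-laxity.
No tightness of `v` is needed. -/
theorem isIdCell_coreflect (h : adj.IsRightSemiLax) {a : S} {Q : T} (v : F.obj a ⟶ Q) :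
    IsIdCell (adj.coreflect v) :=
  (IsIdCell.leftUnitor_inv _).comp (((h.2 a).whiskerRight _).comp
    ((IsIdCell.associator_hom _ _ _).comp (((h.1 v).whiskerLeft _).comp
      ((IsIdCell.associator_inv _ _ _).comp ((IsIdCell.mapComp_inv F _ _).whiskerRight _)))))

/-- Naturality of the invertible cell `coreflect` recovers `δ` from the untranspose of its
transpose. -/
theorem transpose₂_injective (h : adj.IsRightSemiLax) {a : S} {Q : T} {v v' : F.obj a ⟶ Q}
    {δ δ' : v ⟶ v'} (hδ : adj.laxUnit.transpose₂ δ = adj.laxUnit.transpose₂ δ') : δ = δ' := by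
  have := (isIdCell_coreflect h v').isIso
  rw [← cancel_mono (adj.coreflect v'), coreflect_naturality, coreflect_naturality, hδ]

theorem transpose_injective (h : adj.IsRightSemiLax) {a : S} {Q : T} {v v' : F.obj a ⟶ Q}
    (hv : adj.laxUnit.transpose v = adj.laxUnit.transpose v') : v = v' :=
  (isIdCell_coreflect h v).1.trans
    ((congrArg adj.untranspose hv).trans (isIdCell_coreflect h v').1.symm)

variable [Bicategory.Strict S]

/-- In the naturality law of `s` at `x` every other factor is an identity, hence so is this one. The
cell `η_x` itself may be a genuine 2-cell when `x` is loose. -/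
theorem isIdCell_map_unit_whiskerRight (h : adj.IsRightSemiLax) {a b : S} (x : a ⟶ b) :
    IsIdCell (F.map₂ (adj.laxUnit.nat x) ▷ adj.counitApp (F.obj b)) := by
  have h1 := adj.unitTriangle_naturality x
  have h2 : IsIdCell ((λ_ (F.map x)).hom ≫ (ρ_ (F.map x)).inv ≫ F.map x ◁ adj.unitTriangle b) :=
    (IsIdCell.leftUnitor_hom _).comp ((IsIdCell.rightUnitor_inv _).comp ((h.2 b).whiskerLeft _))
  rw [← h1] at h2
  have h3 := IsIdCell.of_comp_left ((h.2 a).whiskerRight _) h2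
  have h4 := IsIdCell.of_comp_left (IsIdCell.associator_hom _ _ _) h3
  have h5 := IsIdCell.of_comp_left ((h.1 _).whiskerLeft _) h4
  have h6 := IsIdCell.of_comp_left (IsIdCell.associator_inv _ _ _) h5
  have h7 := IsIdCell.of_comp_right (IsIdCell.associator_hom _ _ _) h6
  rw [comp_whiskerRight, comp_whiskerRight] at h7
  exact IsIdCell.of_comp_right ((IsIdCell.mapComp_hom F _ _).whiskerRight _)
    (IsIdCell.of_comp_left ((IsIdCell.mapComp_inv F _ _).whiskerRight _) h7)

/-- Untransposing turns `slide` into `F(η_x)` whiskered with `F U v ≫ ε`. Strict naturality of the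
counit rewrites this 1-cell as `ε ≫ v`, and `F(η_x) ▷ ε` is an identity. -/
theorem isIdCell_untranspose₂_slide (h : adj.IsRightSemiLax) {a b : S} (x : a ⟶ b) {Q : T}
    (v : F.obj b ⟶ Q) : IsIdCell (adj.untranspose₂ (adj.laxUnit.slide x v)) := by
  have h1 : IsIdCell (F.map₂ (adj.laxUnit.nat x) ▷ (F.map (U.map v) ≫ adj.counitApp Q)) := by
    have e : adj.counitApp (F.obj b) ≫ v = F.map (U.map v) ≫ adj.counitApp Q := (h.1 v).1
    rw [← e]
    exact (isIdCell_map_unit_whiskerRight h x).whiskerRight_comp v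
  have h2 : IsIdCell (F.map₂ (adj.laxUnit.nat x ▷ U.map v) ▷ adj.counitApp Q) := by
    rw [F.map₂_whisker_right, comp_whiskerRight, comp_whiskerRight]
    exact ((IsIdCell.mapComp_hom F _ _).whiskerRight _).comp
      ((IsIdCell.comp_whiskerRight_iff.2 h1).comp ((IsIdCell.mapComp_inv F _ _).whiskerRight _))
  rw [LaxUnit.slide, untranspose₂_comp, untranspose₂_comp, untranspose₂_comp]
  exact (isIdCell_untranspose₂ adj ((IsIdCell.mapComp_hom U _ _).whiskerLeft _)).comp
    ((isIdCell_untranspose₂ adj (IsIdCell.associator_inv _ _ _)).comp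
      (h2.comp (isIdCell_untranspose₂ adj (IsIdCell.associator_hom _ _ _))))

/-- For loose `x` the cell `η_x` need not be invertible, so it cannot be cancelled directly. After
untransposing it is an identity and can be dropped; naturality of `coreflect` then recovers `δ` and
`δ'`. -/
theorem cancel_slide (h : adj.IsRightSemiLax) {a b : S} {x : a ⟶ b} {Q : T} {v : F.obj b ⟶ Q}
    {z : F.obj a ⟶ Q} {δ δ' : z ⟶ F.map x ≫ v}
    (hδ : adj.laxUnit.transpose₂ δ ≫ adj.laxUnit.slide x v =
      adj.laxUnit.transpose₂ δ' ≫ adj.laxUnit.slide x v) : δ = δ' := by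
  have h1 := congrArg adj.untranspose₂ hδ
  have := (isIdCell_untranspose₂_slide h x v).isIso
  have := (isIdCell_coreflect h (F.map x ≫ v)).isIso
  rw [untranspose₂_comp, untranspose₂_comp, cancel_mono] at h1
  rw [← cancel_mono (adj.coreflect _), coreflect_naturality, coreflect_naturality, h1]

end

section

variable {S : Type u} [Bicategory.{w, v} S] [Bicategory.Strict S] {T : Type u₂}
  [Bicategory.{w, v} T] [Bicategory.Strict T] {A : Type u₁} [Bicategory.{w₁, v₁} A]
  {F : StrictPseudofunctor S T} {U : StrictPseudofunctor T S} {adj : LaxAdjunction F U}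
  {W : StrictPseudofunctor Aᵒᵖ Cat.{w, v}} {H : StrictPseudofunctor A S}

/-- Transposition of cocylinders is injective. -/
theorem vcomp_transposeTrans_injective (h : adj.IsRightSemiLax) {Q : T}
    {σ σ' : OplaxCocylinder W (H.comp F) Q}
    (hσ : σ.vcomp (adj.laxUnit.transposeTrans H Q) = σ'.vcomp (adj.laxUnit.transposeTrans H Q)) :
    σ = σ' := by
  have happ : ∀ a, σ.app a = σ'.app a := fun a => by
    ext1
    refine functor_eq_of_comp_eq (R := adj.laxUnit.transposeFunctor (H.obj (unop a)) Q)
      (fun v v' hv => transpose_injective h hv)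
      ⟨fun {v v'} δ δ' hδ => transpose₂_injective h hδ⟩ ?_
    exact congrArg (fun t : OplaxCocylinder W H (U.obj Q) => (t.app a).toFunctor) hσ
  obtain ⟨x, n, n1, n2, n3⟩ := σ
  obtain ⟨y, m, m1, m2, m3⟩ := σ'
  obtain rfl : x = y := funext happ
  congr 1
  funext a b f
  ext X
  -- Heterogeneous equality is needed because the type of a structure cell depends on the
  -- cocylinder; here the two types agree definitionally, as the components are already identified.
  have key : ∀ θ θ' : OplaxCocylinder W H (U.obj Q), θ = θ' →
      HEq ((θ.naturality f).toNatTrans.app X) ((θ'.naturality f).toNatTrans.app X) := by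
    rintro _ _ rfl
    rfl
  have hk := key _ _ hσ
  have := eq_of_heq hk
  rw [vcomp_naturality_app, vcomp_naturality_app] at this
  -- The transposed structure cell at `f` is the transpose of the original one followed by `slide`
  -- at `H f`, which may be loose.
  exact cancel_slide h this

variable [FCategory S] [FCategory T]

theorem isIdCell_slide (hL : adj.IsLooseFAdjunction) {a b : S} {x : a ⟶ b}
    (hx : FCategory.Tight x) {Q : T} (v : F.obj b ⟶ Q) : IsIdCell (adj.laxUnit.slide x v) :=
  ((IsIdCell.mapComp_hom U _ _).whiskerLeft _).comp ((IsIdCell.associator_inv _ _ _).comp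
    (((hL.1 x hx).whiskerRight _).comp (IsIdCell.associator_hom _ _ _)))

/-- The factor `η_u` is an identity because `u` is tight, the factor `t` because the adjunction is
strict. -/
theorem isIdCell_reflect (hL : adj.IsLooseFAdjunction) (hS : adj.IsStrict) {a : S} {Q : T}
    {u : a ⟶ U.obj Q} (hu : FCategory.Tight u) : IsIdCell (adj.reflect u) :=
  (isIdCell_slide hL hu _).comp (((hS.2 Q).whiskerLeft _).comp (IsIdCell.rightUnitor_hom _))

/-- Whiskering `reflect u` with a tight 1-cell whose composite with `u` is tight. -/
theorem isIdCell_whiskerLeft_reflect (hL : adj.IsLooseFAdjunction) (hS : adj.IsStrict) {a b : S}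
    {Q : T} {x : a ⟶ b} {u : b ⟶ U.obj Q} (hx : FCategory.Tight x)
    (hu : FCategory.Tight (x ≫ u)) : IsIdCell (x ◁ adj.reflect u) := by
  have h1 := isIdCell_reflect hL hS hu
  -- The cell `η` at `x ≫ u` decomposes into `η_x` and `x ◁ η_u`. The first two are identities since
  -- `x ≫ u` and `x` are tight, hence so is the third, with no tightness of `u`.
  have h2 := adj.laxUnit.slide_comp x u (adj.counitApp Q)
  have h3 : IsIdCell (adj.laxUnit.slide (x ≫ u) (adj.counitApp Q)) :=
    IsIdCell.of_comp_right (((hS.2 Q).whiskerLeft _).comp (IsIdCell.rightUnitor_hom _)) h1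
  have h4 := h3.comp (IsIdCell.associator_hom _ _ _)
  rw [h2] at h4
  have h5 : IsIdCell (adj.laxUnit.transpose₂ ((F.mapComp x u).hom ▷ adj.counitApp Q ≫
      (α_ _ _ _).hom)) :=
    ((((IsIdCell.mapComp_hom F _ _).whiskerRight _).comp
      (IsIdCell.associator_hom _ _ _)).map₂ U.toPrelaxFunctor).whiskerLeft _
  have h6 := IsIdCell.of_comp_left (isIdCell_slide hL hx _) (IsIdCell.of_comp_left h5 h4)
  rw [reflect, Bicategory.whiskerLeft_comp, Bicategory.whiskerLeft_comp]
  exact h6.comp ((((hS.2 Q).whiskerLeft _).whiskerLeft _).comp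
    ((IsIdCell.rightUnitor_hom _).whiskerLeft _))

/-- Fullness of transposition: a preimage of `δ` is its untranspose conjugated by `coreflect`. On
tight 1-cells `reflect` is an identity, and its naturality returns `δ`. -/
theorem exists_transpose₂_eq (hL : adj.IsLooseFAdjunction) (h : adj.IsRightSemiLax)
    (hS : adj.IsStrict) {a : S} {Q : T}
    {v v' : F.obj a ⟶ Q} (hv : FCategory.Tight (adj.laxUnit.transpose v))
    (hv' : FCategory.Tight (adj.laxUnit.transpose v'))
    (δ : adj.laxUnit.transpose v ⟶ adj.laxUnit.transpose v') :
    ∃ δ' : v ⟶ v', adj.laxUnit.transpose₂ δ' = δ := by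
  have := (isIdCell_coreflect h v').isIso
  refine ⟨adj.coreflect v ≫ adj.untranspose₂ δ ≫ inv (adj.coreflect v'), ?_⟩
  have h1 := adj.reflect_naturality δ
  have i1 : IsIdCell (adj.laxUnit.transpose₂ (adj.coreflect v)) :=
    ((isIdCell_coreflect h v).map₂ U.toPrelaxFunctor).whiskerLeft _
  have i2 : IsIdCell (adj.laxUnit.transpose₂ (adj.coreflect v')) :=
    ((isIdCell_coreflect h v').map₂ U.toPrelaxFunctor).whiskerLeft _
  -- An identity cell from a 1-cell to itself is `𝟙`, so this triangle equation does not require a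
  -- swallowtail law.
  have e1 := (i1.comp (isIdCell_reflect hL hS hv)).eq_id
  have e2 := (i2.comp (isIdCell_reflect hL hS hv')).eq_id
  have e3 : adj.laxUnit.transpose₂ (inv (adj.coreflect v')) = adj.reflect _ := by
    have := i2.isIso
    rw [← cancel_epi (adj.laxUnit.transpose₂ (adj.coreflect v')), ← LaxUnit.transpose₂_comp, e2]
    simp
  rw [LaxUnit.transpose₂_comp, LaxUnit.transpose₂_comp, e3, h1, reassoc_of% e1]

theorem isIdCell_slideModification (hL : adj.IsLooseFAdjunction) {C : S}
    {μ : OplaxCocylinder W H C} (hμ : ∀ a X, FCategory.Tight (μ.component a X)) {Q : T}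
    (v : F.obj C ⟶ Q) (a : Aᵒᵖ) : IsIdCell ((adj.laxUnit.slideModification μ v).app a) :=
  IsIdCell.cat_iff.2 fun X => isIdCell_slide hL (hμ (unop a) X) v

end

end LaxAdjunction

theorem OplaxCocylinder.isNormal_map {S : Type u} [Bicategory.{w, v} S] {T : Type u₂}
    [Bicategory.{w, v} T] {A : Type u₁} [Bicategory.{w₁, v₁} A] [FCategory A]
    {F : StrictPseudofunctor S T} {W : StrictPseudofunctor Aᵒᵖ Cat.{w, v}}
    {H : StrictPseudofunctor A S} {C : S} {μ : OplaxCocylinder W H C} (hμ : μ.IsNormal) :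
    (μ.map F).IsNormal := fun f hf =>
  isIdCell_vcomp_naturality (hμ f hf) (IsIdCell.cat_iff.2 fun _ => IsIdCell.mapComp_hom F _ _)

/-! ### Preservation of universal cocylinders -/

namespace LaxAdjunction

section

variable {S : Type u} [Bicategory.{w, v} S] [Bicategory.Strict S] {T : Type u₂}
  [Bicategory.{w, v} T] [Bicategory.Strict T] {A : Type u₁} [Bicategory.{w₁, v₁} A]
  [FCategory S] [FCategory T] [FCategory A]

/-- For tight `f` the 1-cell `H f` is tight, so the cell `η` at `H f` added by transposition is an
identity. -/
theorem isNormal_vcomp_transposeTrans {F : StrictPseudofunctor S T} {U : StrictPseudofunctor T S}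
    {adj : LaxAdjunction F U} (hL : adj.IsLooseFAdjunction)
    {W : StrictPseudofunctor Aᵒᵖ Cat.{w, v}} {H : FFunctor A S} {Q : T}
    {σ : OplaxCocylinder W (H.toStrictPseudofunctor.comp F) Q} (hσ : σ.IsNormal) :
    OplaxCocylinder.IsNormal (σ.vcomp (adj.laxUnit.transposeTrans H.toStrictPseudofunctor Q)) :=
  fun f hf => isIdCell_vcomp_naturality (hσ f hf)
    (IsIdCell.cat_iff.2 fun X => isIdCell_slide hL (H.map_tight f hf) X)

open scoped Oplax.OplaxTrans in
/-- Let `F` be left adjoint to `U` by a lax adjunction that is a loose `F`-adjunction, right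
semi-lax and strict, such that the unit is tight and `U` sends all 1-cells to tight ones. Then `F`
preserves universal oplax normal cocylinders with tight components. -/
theorem isUniversal_map {F : StrictPseudofunctor S T} {U : StrictPseudofunctor T S}
    {adj : LaxAdjunction F U} (hL : adj.IsLooseFAdjunction) (hR : adj.IsRightSemiLax)
    (hS : adj.IsStrict) (hη : ∀ a, FCategory.Tight (adj.laxUnit.app a))
    (hU : ∀ {P Q : T} (g : P ⟶ Q), FCategory.Tight (U.map g))
    {W : StrictPseudofunctor Aᵒᵖ Cat.{w, v}} {H : FFunctor A S} {C : S}
    {μ : OplaxCocylinder W H.toStrictPseudofunctor C} (hμ : μ.IsUniversal)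
    (ht : ∀ a X, FCategory.Tight (μ.component a X)) : (μ.map F).IsUniversal := by
  have htr : ∀ {a : S} {Q : T} (v : F.obj a ⟶ Q), FCategory.Tight (adj.laxUnit.transpose v) :=
    fun {a Q} v => FCategory.tight_comp (hη a) (hU v)
  -- Tight components of `μ` make `slide` an identity, so transposing an induced cocylinder gives
  -- the one induced by the transpose.
  have hslide : ∀ {Q : T} (v : F.obj C ⟶ Q),
      ((μ.map F).postcomp v).vcomp (adj.laxUnit.transposeTrans H.toStrictPseudofunctor Q) =
        μ.postcomp (adj.laxUnit.transpose v) := fun v =>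
    oplaxTrans_eq_of_modification (adj.laxUnit.slideModification μ v)
      (isIdCell_slideModification hL ht v)
  constructor
  · intro Q σ hσ
    obtain ⟨q, hq, hq'⟩ := hμ.existsUnique_desc _ (isNormal_vcomp_transposeTrans hL hσ)
    -- Tightness is available only for the composites of `q` with the components of `μ`, which are
    -- transposes.
    have hcomp : ∀ a X, FCategory.Tight (μ.component a X ≫ q) := fun a X => by
      have : μ.component a X ≫ q = adj.laxUnit.transpose (σ.component a X) :=
        congrArg (fun t : OplaxCocylinder W H.toStrictPseudofunctor (U.obj Q) => t.component a X) hq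
      rw [this]
      exact htr _
    have h1 : μ.postcomp (adj.laxUnit.transpose (adj.untranspose q)) = μ.postcomp q :=
      oplaxTrans_eq_of_modification (μ.postcomp₂ (adj.reflect q)) fun a =>
        IsIdCell.cat_iff.2 fun X => isIdCell_whiskerLeft_reflect hL hS (ht (unop a) X) (hcomp _ X)
    refine ⟨adj.untranspose q, ?_, ?_⟩
    -- Both cocylinders have the same transpose, namely the one induced by `q`.
    · exact vcomp_transposeTrans_injective hR ((hslide _).trans (h1.trans hq))
    · intro v hv
      have h2 : adj.laxUnit.transpose v = q := by
        refine hq' _ ((hslide v).symm.trans ?_)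
        rw [hv]
      -- Uniqueness of `q` makes it the transpose both of `v` and of the 1-cell already constructed.
      refine transpose_injective hR (h2.trans ?_)
      exact (hq' _ (h1.trans hq)).symm
  · intro Q q q' Γ
    have hpost : ∀ δ : q ⟶ q', ∀ a : A, ∀ X : W.obj (op a),
        adj.laxUnit.transpose₂ (F.map (μ.component a X) ◁ δ) ≫
            adj.laxUnit.slide (μ.component a X) q' =
          adj.laxUnit.slide (μ.component a X) q ≫
            μ.component a X ◁ adj.laxUnit.transpose₂ δ :=
      fun δ a X => adj.laxUnit.slide_naturality_right _ δ
    -- `Γ` is transposed and then conjugated by the slide modifications, giving a modification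
    -- between cocylinders induced from `μ`.
    obtain ⟨Γ', h'⟩ := exists_modification_conj (adj.laxUnit.slideModification μ q)
      (adj.laxUnit.slideModification μ q') (isIdCell_slideModification hL ht q)
      (isIdCell_slideModification hL ht q') (Oplax.OplaxTrans.whiskerRight
        (Oplax.OplaxTrans.Hom.of Γ) (adj.laxUnit.transposeTrans H.toStrictPseudofunctor Q)).as
    have hΓ' : ∀ a : A, ∀ X : W.obj (op a),
        adj.laxUnit.transpose₂ ((Γ.app (op a)).toNatTrans.app X) ≫
            adj.laxUnit.slide (μ.component a X) q' =
          adj.laxUnit.slide (μ.component a X) q ≫ (Γ'.app (op a)).toNatTrans.app X :=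
      fun a X => congrArg (fun t => t.toNatTrans.app X) (h' (op a))
    -- Inducing `Γ` and inducing its transpose `Γ'` are equivalent conditions, as `slide` is
    -- invertible here and transposition is faithful.
    have key : ∀ δ : q ⟶ q', (μ.map F).postcomp₂ δ = Γ ↔
        μ.postcomp₂ (adj.laxUnit.transpose₂ δ) = Γ' := by
      intro δ
      constructor
      · rintro hδ
        ext a X
        have := (isIdCell_slide hL (ht (unop a) X) q).isIso
        refine (cancel_epi (adj.laxUnit.slide (μ.component (unop a) X) q)).1 ?_
        refine ((hpost δ (unop a) X).symm.trans ?_).trans (hΓ' (unop a) X)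
        rw [← hδ]
        rfl
      · intro hδ
        ext a X
        have := (isIdCell_slide hL (ht (unop a) X) q').isIso
        refine transpose₂_injective hR ?_
        refine (cancel_mono (adj.laxUnit.slide (μ.component (unop a) X) q')).1 ?_
        refine ((hpost δ (unop a) X).trans ?_).trans (hΓ' (unop a) X).symm
        rw [← hδ]
        rfl
    obtain ⟨δ, hδ, hδ'⟩ := hμ.existsUnique_desc₂ Γ'
    -- All transposes are tight, so the 2-cell supplied by universality is itself a transpose.
    obtain ⟨δ₀, rfl⟩ := exists_transpose₂_eq hL hR hS (htr q) (htr q') δ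
    exact ⟨δ₀, (key δ₀).2 hδ, fun δ₁ h₁ => transpose₂_injective hR (hδ' _ ((key δ₁).1 h₁))⟩

end

end LaxAdjunction

/-! ### Morphisms that are identities -/

/-- A morphism of a category is an identity, up to transport. -/
def IsEqToHom {C : Type u} [Category.{v} C] {X Y : C} (f : X ⟶ Y) : Prop :=
  ∃ h : X = Y, f = eqToHom h

namespace IsEqToHom

variable {C : Type u} [Category.{v} C]

theorem id (X : C) : IsEqToHom (𝟙 X) := ⟨rfl, rfl⟩

theorem comp {X Y Z : C} {f : X ⟶ Y} {g : Y ⟶ Z} (hf : IsEqToHom f) (hg : IsEqToHom g) :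
    IsEqToHom (f ≫ g) := by
  obtain ⟨rfl, rfl⟩ := hf
  obtain ⟨rfl, rfl⟩ := hg
  exact ⟨rfl, by simp⟩

theorem of_comp_left {X Y Z : C} {f : X ⟶ Y} {g : Y ⟶ Z} (hf : IsEqToHom f)
    (h : IsEqToHom (f ≫ g)) : IsEqToHom g := by
  obtain ⟨rfl, rfl⟩ := hf
  simpa using h

theorem map {D : Type u₁} [Category.{v₁} D] (K : C ⥤ D) {X Y : C} {f : X ⟶ Y}
    (hf : IsEqToHom f) : IsEqToHom (K.map f) := by
  obtain ⟨rfl, rfl⟩ := hf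
  exact ⟨rfl, by simp⟩

theorem natTrans {D : Type u₁} [Category.{v₁} D] {K L : C ⥤ D} (θ : K ⟶ L)
    (h : ∀ X, IsEqToHom (θ.app X)) : K = L :=
  CategoryTheory.Functor.ext (fun X => (h X).1) fun X Y f => by
    have := θ.naturality f
    rw [(h X).2, (h Y).2] at this
    rw [← Category.assoc, ← this]
    simp

end IsEqToHom

/-! ### Recognizing identities in lax slices, pullbacks and categories of sections -/

/-- Equality of the triangle cells comes for free from `θ.w`. Questions about 2-cells thus reduce to
single morphisms of `Pull` or `Sect`. -/
theorem LaxSlice.isIdCell_iff {B : Type u} [Category.{u} B] {X Y : LaxSlice B} {f g : X ⟶ Y}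
    {θ : f ⟶ g} : IsIdCell θ ↔ ∀ x, IsEqToHom ((Hom₂.hat θ).app x) := by
  constructor
  · rintro ⟨rfl, rfl⟩ x
    exact IsEqToHom.id _
  · intro h
    have h' : f = g := by
      refine LaxSlice.hom_ext (IsEqToHom.natTrans (Hom₂.hat θ) h) fun x => ?_
      rw [← θ.w x, (h x).2, eqToHom_map]
    subst h'
    refine ⟨rfl, hom₂_ext fun x => ?_⟩
    rw [(h x).2]
    rfl

section

variable {E B : Type u} [Category.{u} E] [Category.{u} B] {τ : E ⥤ B}

theorem Pull.isEqToHom {D : Type u} [Category.{u} D] {F : D ⥤ B} {p q : Pull τ F} {f : p ⟶ q}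
    (h : IsEqToHom (Pull.Hom.base f)) (h' : IsEqToHom (Pull.Hom.fib f)) : IsEqToHom f := by
  obtain rfl := Pull.obj_ext h.1 h'.1
  exact ⟨rfl, Pull.hom_ext h.2 h'.2⟩

theorem Fibre.isEqToHom {X : B} {e e' : τ.Fiber X} {v : e ⟶ e'} (h : IsEqToHom (Fibre.map v)) :
    IsEqToHom v := by
  obtain ⟨h, h'⟩ := h
  obtain rfl : e = e' := Subtype.ext h
  exact ⟨rfl, Subtype.ext h'⟩

/-- A morphism of sections over an identity whose values on identities are identities. -/
theorem Sect.isEqToHom {c : SplitOpfibration τ} {D : Type u} [Category.{u} D] {H : D ⥤ E}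
    {p q : Sect c H} {φ : p ⟶ q} (hb : IsEqToHom (Sect.Hom.base φ))
    (h : ∀ (e : τ.Fiber p.base) (e' : τ.Fiber q.base) (g : Fibre.obj e ⟶ Fibre.obj e') (hg),
      IsEqToHom g → IsEqToHom (Sect.Hom.app φ e e' g hg)) : IsEqToHom φ := by
  obtain ⟨X, k, a⟩ := p
  obtain ⟨Y, l, b⟩ := q
  obtain rfl : X = Y := hb.1
  have hb' : Sect.Hom.base φ = 𝟙 X := hb.2
  have hl : ∀ {e e' : τ.Fiber X} (v : e ⟶ e'), τ.IsHomLift (Sect.Hom.base φ) (Fibre.map v) := by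
    intro e e' v
    rw [hb']
    exact Fibre.map_w v
  have hid : ∀ e : τ.Fiber X, IsEqToHom (Sect.Hom.app φ e e (Fibre.map (𝟙 e)) (hl (𝟙 e))) :=
    fun e => h e e _ _ ((IsEqToHom.id e).map Functor.Fiber.fiberInclusion)
  -- Compatibility with vertical morphisms on either side makes the values at identities a natural
  -- transformation `k ⟶ l` and determines all other values. Its components being identities, `k =
  -- l`.
  have h1 : ∀ {e e' : τ.Fiber X} (v : e ⟶ e'), Sect.Hom.app φ e e' (Fibre.map v) (hl v) =
      k.map v ≫ Sect.Hom.app φ e' e' (Fibre.map (𝟙 e')) (hl (𝟙 e')) := by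
    intro e e' v
    have := Sect.Hom.precomp φ v e' (Fibre.map (𝟙 e')) (hl (𝟙 e'))
    rw [← this]
    exact Sect.Hom.app_congr φ (by simp) _ _
  have h2 : ∀ {e e' : τ.Fiber X} (v : e ⟶ e'), Sect.Hom.app φ e e' (Fibre.map v) (hl v) =
      Sect.Hom.app φ e e (Fibre.map (𝟙 e)) (hl (𝟙 e)) ≫ l.map v := by
    intro e e' v
    have := Sect.Hom.postcomp φ e (Fibre.map (𝟙 e)) v (hl (𝟙 e))
    rw [← this]
    exact Sect.Hom.app_congr φ (by simp) _ _
  obtain rfl : k = l := IsEqToHom.natTrans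
    { app := fun e => Sect.Hom.app φ e e (Fibre.map (𝟙 e)) (hl (𝟙 e))
      naturality := fun e e' v => (h1 v).symm.trans (h2 v) } hid
  have h3 : ∀ e, Sect.Hom.app φ e e (Fibre.map (𝟙 e)) (hl (𝟙 e)) = 𝟙 (k.obj e) := fun e => (hid e).2
  -- The triangle condition at an identity equates the two cells.
  obtain rfl : a = b := by
    ext e
    have := Sect.Hom.w φ e e (Fibre.map (𝟙 e)) (hl (𝟙 e))
    dsimp only at this
    rw [h3] at this
    simpa using this
  refine ⟨rfl, Sect.hom_ext hb' fun e e' g hg hg' => ?_⟩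
  refine (h1 (Fibre.homMk g hg')).trans ?_
  rw [h3]
  exact Category.comp_id _

/-- Chosen lifts along equal morphisms. -/
theorem SplitOpfibration.isEqToHom_of_lift_comp (c : SplitOpfibration τ) {X Y : B} {f f' : X ⟶ Y}
    (hf : f = f') {e : E} {he he' : τ.obj e = X} {k : c.push f e he ⟶ c.push f' e he'} {g : Y ⟶ Y}
    (hg : g = 𝟙 Y) (hk : τ.IsHomLift g k) (h : c.lift f e he ≫ k = c.lift f' e he') :
    IsEqToHom k := by
  subst hf hg
  exact ⟨rfl, c.hom_ext (𝟙 Y) hk (IsHomLift.id (c.obj_push f e he)) (by simpa using h)⟩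

/-- Normality of the cleavage. All the strictness on tight 1-cells rests on this. -/
theorem SplitOpfibration.isEqToHom_lift (c : SplitOpfibration τ) {X Y : B} {f : X ⟶ Y}
    (hf : IsEqToHom f) {e : E} {he : τ.obj e = X} : IsEqToHom (c.lift f e he) := by
  obtain ⟨rfl, rfl⟩ := hf
  exact ⟨(c.push_id e he).symm, c.lift_id e he⟩

end

section

variable {E B : Type u} [Category.{u} E] [Category.{u} B] {τ : E ⥤ B}

theorem IsEqToHom.eq_id {C : Type u₁} [Category.{v₁} C] {X : C} {f : X ⟶ X} (h : IsEqToHom f) :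
    f = 𝟙 X := h.2

theorem Pull.isEqToHom_base {D : Type u} [Category.{u} D] {F : D ⥤ B} {p q : Pull τ F} {f : p ⟶ q}
    (h : IsEqToHom f) : IsEqToHom (Pull.Hom.base f) := by
  obtain ⟨rfl, rfl⟩ := h
  exact IsEqToHom.id _

theorem Sect.isEqToHom_base {c : SplitOpfibration τ} {D : Type u} [Category.{u} D] {H : D ⥤ E}
    {p q : Sect c H} {φ : p ⟶ q} (hφ : IsEqToHom φ) : IsEqToHom (Sect.Hom.base φ) := by
  obtain ⟨rfl, rfl⟩ := hφ
  exact IsEqToHom.id _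

theorem Sect.isEqToHom_app {c : SplitOpfibration τ} {D : Type u} [Category.{u} D] {H : D ⥤ E}
    {p q : Sect c H} {φ : p ⟶ q} (hφ : IsEqToHom φ) {e : τ.Fiber p.base} {e' : τ.Fiber q.base}
    {g : Fibre.obj e ⟶ Fibre.obj e'} (hg : τ.IsHomLift (Sect.Hom.base φ) g) (h : IsEqToHom g) :
    IsEqToHom (Sect.Hom.app φ e e' g hg) := by
  obtain ⟨rfl, rfl⟩ := hφ
  exact (Fibre.isEqToHom (v := Fibre.homMk g hg) h).map p.hat

/-! ### The unit -/

namespace UpperStar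

variable (c : SplitOpfibration τ)

/-- The morphism out of an object in the image of `hat` determined by its first component and its
restriction along the chosen lift. -/
noncomputable def hatDesc {F G : LaxSlice B} (α : F ⟶ G) (p : Pull τ F.proj) (q : Pull τ G.proj)
    (f : α.hat.obj p.base ⟶ q.base) (g : p.fib ⟶ q.fib)
    (hg : τ.IsHomLift (α.cell.app p.base ≫ G.proj.map f) g) : (hat c α).obj p ⟶ q :=
  Pull.Hom.mk (p := (hat c α).obj p) (q := q) f
    (c.desc (α.cell.app p.base) (G.proj.map f) p.fib p.w g hg)
    (c.desc_isHomLift _ _ _ _ _ hg)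

variable {F G : LaxSlice B} (α : F ⟶ G) (p : Pull τ F.proj) (q : Pull τ G.proj)
    (f : α.hat.obj p.base ⟶ q.base) (g : p.fib ⟶ q.fib)
    (hg : τ.IsHomLift (α.cell.app p.base ≫ G.proj.map f) g)

@[simp] theorem lift_hatDesc : hatLift c α p ≫ Pull.Hom.fib (hatDesc c α p q f g hg) = g :=
  c.lift_desc _ _ _ _ _ hg

@[simp] theorem lift_hatDesc_assoc {z : E} (k : q.fib ⟶ z) :
    hatLift c α p ≫ Pull.Hom.fib (hatDesc c α p q f g hg) ≫ k = g ≫ k := by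
  rw [← Category.assoc, lift_hatDesc]

/-- Splitness: the chosen lift along a composite is the composite of chosen lifts up to the identity
`j`. A morphism out of the iterated pushforward can therefore be compared after restriction along
both lifts. -/
theorem comp_hom_ext {F G H : LaxSlice B} {α : F ⟶ G} {β : G ⟶ H} {p : Pull τ F.proj}
    {q : Pull τ H.proj} {j : (hat c β).obj ((hat c α).obj p) ⟶ (hat c (α ≫ β)).obj p}
    (hj : IsEqToHom j) {k : (hat c (α ≫ β)).obj p ⟶ q}
    {r : (hat c β).obj ((hat c α).obj p) ⟶ q}
    (hb : Pull.Hom.base k = Pull.Hom.base r)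
    (hl : hatLift c (α ≫ β) p ≫ Pull.Hom.fib k =
      hatLift c α p ≫ hatLift c β ((hat c α).obj p) ≫ Pull.Hom.fib r) : j ≫ k = r := by
  have hjb : Pull.Hom.base j = 𝟙 (β.hat.obj (α.hat.obj p.base)) := (Pull.isEqToHom_base hj).eq_id
  obtain ⟨h, rfl⟩ := hj
  have : k = eqToHom h.symm ≫ r := by
    refine hat_hom_ext c ?_ ?_
    · rw [hb, Pull.comp_base, Pull.eqToHom_base]
      exact (Category.id_comp _).symm
    · rw [hl, hatLift_comp c α β p h, Pull.comp_fib, Pull.eqToHom_fib]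
      simp
  rw [this]
  simp

end UpperStar

namespace Unit

variable (c : SplitOpfibration τ)

/-- The inclusion of the fibre of `τ` over `F a` into the pullback of `τ` along `F`. -/
def fibreFunctor {D : Type u} [Category.{u} D] (F : D ⥤ B) (a : D) :
    τ.Fiber (F.obj a) ⥤ Pull τ F where
  obj e := Pull.mk a (Fibre.obj e) (Fibre.obj_w e)
  map v := Pull.Hom.mk (𝟙 a) (Fibre.map v) (by rw [F.map_id]; exact Fibre.map_w v)
  map_id e := Pull.hom_ext rfl (CategoryTheory.Functor.map_id Functor.Fiber.fiberInclusion e)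
  map_comp v v' := Pull.hom_ext (Category.id_comp (𝟙 a)).symm
    (CategoryTheory.Functor.map_comp Functor.Fiber.fiberInclusion v v')

/-- The section of the pullback of `τ` along `F` given by an object `a`. -/
def sect {D : Type u} [Category.{u} D] (F : D ⥤ B) (a : D) : Sect c (Pull.toFib τ F) where
  base := F.obj a
  hat := fibreFunctor F a
  cell := { app := fun e => 𝟙 (Fibre.obj e)
            naturality := fun _ _ v => (Category.comp_id (Fibre.map v)).trans
              (Category.id_comp (Fibre.map v)).symm }

/-- The functor part of the unit. -/
noncomputable def hat {D : Type u} [Category.{u} D] (F : D ⥤ B) : D ⥤ Sect c (Pull.toFib τ F) where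
  obj a := sect c F a
  map {a a'} f := Sect.Hom.mk (p := sect c F a) (q := sect c F a') (F.map f)
    (fun e e' g hg => Pull.Hom.mk (p := (fibreFunctor F a).obj e) (q := (fibreFunctor F a').obj e')
      f g hg)
    (fun _ _ _ _ => Pull.hom_ext (Category.id_comp f).symm rfl)
    (fun _ _ _ _ _ _ => Pull.hom_ext (Category.comp_id f).symm rfl)
    (fun _ _ g _ => (Category.id_comp g).trans (Category.comp_id g).symm)
  map_id a := Sect.hom_ext (F.map_id a) fun _ _ _ _ _ => Pull.hom_ext rfl rfl
  -- Composition of sections splits `g` through the chosen lift of `F f`; the two factors recompose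
  -- to `g`.
  map_comp f f' := Sect.hom_ext (F.map_comp f f') fun e _ g _ hg' =>
    Pull.hom_ext rfl (Fibre.lift_desc c (F.map f) (F.map f') e g hg').symm

/-- The unit `F ⟶ τ_* τ* F`. -/
noncomputable def app (F : LaxSlice B) : F ⟶ LowerStar.obj c (UpperStar.obj τ F) :=
  LaxSlice.Hom.mk (X := F) (Y := LowerStar.obj c (UpperStar.obj τ F)) (hat c F.proj)
    { app := fun a => 𝟙 (F.proj.obj a)
      naturality := fun _ _ f => (Category.comp_id (F.proj.map f)).trans
        (Category.id_comp (F.proj.map f)).symm }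

theorem isTight_app (F : LaxSlice B) : LaxSlice.IsTight (app c F) := ⟨rfl, rfl⟩

section

variable {F G : LaxSlice B} (α : F ⟶ G)

/-- Puts `α_a` in the form required by `hatDesc`, for a factor lying over the identity of `α̂ a`. -/
theorem cellValue_w (a : F.dom) {e : τ.Fiber (F.proj.obj a)}
    {e' : τ.Fiber (G.proj.obj (α.hat.obj a))} {g : Fibre.obj e ⟶ Fibre.obj e'}
    (hg : τ.IsHomLift (α.cell.app a) g) :
    τ.IsHomLift (α.cell.app a ≫ G.proj.map (𝟙 (α.hat.obj a))) g := by
  rw [G.proj.map_id]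
  simpa using hg

/-- The values of the structure 2-cell of the unit. -/
noncomputable def cellValue (a : F.dom) (e : τ.Fiber (F.proj.obj a))
    (e' : τ.Fiber (G.proj.obj (α.hat.obj a))) (g : Fibre.obj e ⟶ Fibre.obj e')
    (hg : τ.IsHomLift (α.cell.app a) g) :
    (UpperStar.hat c α).obj ((fibreFunctor F.proj a).obj e) ⟶
      (fibreFunctor G.proj (α.hat.obj a)).obj e' :=
  UpperStar.hatDesc c α ((fibreFunctor F.proj a).obj e)
    ((fibreFunctor G.proj (α.hat.obj a)).obj e') (𝟙 _) g (cellValue_w α a hg)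

/-- The value at `g` is its vertical factor through the chosen lift of `α_a`. Laws for the structure
cell are checked by restricting along that lift, by opcartesianness. -/
theorem lift_cellValue (a : F.dom) (e : τ.Fiber (F.proj.obj a))
    (e' : τ.Fiber (G.proj.obj (α.hat.obj a))) (g : Fibre.obj e ⟶ Fibre.obj e')
    (hg : τ.IsHomLift (α.cell.app a) g) :
    UpperStar.hatLift c α ((fibreFunctor F.proj a).obj e) ≫
        Pull.Hom.fib (cellValue c α a e e' g hg) = g :=
  UpperStar.lift_hatDesc c _ _ _ _ _ _

theorem lift_cellValue_comp (a : F.dom) (e : τ.Fiber (F.proj.obj a))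
    (e' : τ.Fiber (G.proj.obj (α.hat.obj a))) (g : Fibre.obj e ⟶ Fibre.obj e')
    (hg : τ.IsHomLift (α.cell.app a) g) {q : Pull τ G.proj}
    (k : (fibreFunctor G.proj (α.hat.obj a)).obj e' ⟶ q) :
    UpperStar.hatLift c α ((fibreFunctor F.proj a).obj e) ≫
        Pull.Hom.fib (cellValue c α a e e' g hg ≫ k) = g ≫ Pull.Hom.fib k :=
  UpperStar.lift_hatDesc_assoc c _ _ _ _ _ _ _

theorem lift_hat_map_comp {p q : Pull τ F.proj} (f : p ⟶ q) {r : Pull τ G.proj}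
    (k : (UpperStar.hat c α).obj q ⟶ r) :
    UpperStar.hatLift c α p ≫ Pull.Hom.fib ((UpperStar.hat c α).map f ≫ k) =
      Pull.Hom.fib f ≫ UpperStar.hatLift c α q ≫ Pull.Hom.fib k :=
  UpperStar.lift_hat_map_assoc c α f _

/-- The components of the structure 2-cell of the unit at a 1-cell. -/
noncomputable def cellApp (a : F.dom) :
    (LowerStar.hat c (UpperStar.map c α)).obj (sect c F.proj a) ⟶
      sect c G.proj (α.hat.obj a) :=
  Sect.Hom.mk (p := (LowerStar.hat c (UpperStar.map c α)).obj (sect c F.proj a))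
    (q := sect c G.proj (α.hat.obj a)) (α.cell.app a) (cellValue c α a)
    (fun {e₀ e} v e' g hg => by
      refine UpperStar.hat_hom_ext c ?_ ?_
      · exact ((Category.comp_id _).trans (α.hat.map_id _)).symm
      · refine (lift_cellValue c α a _ _ _ _).trans ?_
        refine Eq.trans ?_ (lift_hat_map_comp c α ((fibreFunctor F.proj a).map v) _).symm
        exact congrArg (fun t => Fibre.map v ≫ t) (lift_cellValue c α a _ _ _ _).symm)
    (fun e {e' e₁} g v hg => by
      refine UpperStar.hat_hom_ext c (Category.comp_id _).symm ?_
      exact (lift_cellValue c α a e e₁ _ (Fibre.homLift_comp_map v hg)).trans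
        (lift_cellValue_comp c α a e e' g hg ((fibreFunctor G.proj (α.hat.obj a)).map v)).symm)
    (fun e e' g hg => by
      refine Eq.trans (congrArg (fun t => t ≫ (UpperStar.obj τ G).proj.map _)
        (Category.id_comp (UpperStar.hatLift c α ((fibreFunctor F.proj a).obj e)))) ?_
      exact (lift_cellValue c α a e e' g hg).trans (Category.comp_id g).symm)

/-- The structure 2-cell of the unit at a 1-cell, as a natural transformation. -/
noncomputable def cellHat : hat c F.proj ⋙ LowerStar.hat c (UpperStar.map c α) ⟶
    α.hat ⋙ hat c G.proj where
  app a := cellApp c α a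
  naturality a a' f := by
    refine Sect.hom_ext (α.cell.naturality f) fun e e' k hk hk' => ?_
    refine UpperStar.hat_hom_ext c ?_ ?_
    · exact (Category.comp_id _).trans (Category.id_comp _).symm
    -- After restriction along the lift of `α_a` both sides are `k`, factored once through the lift
    -- of `F f` and once through that of `α_a`.
    · refine (lift_hat_map_comp c α _ _).trans ?_
      refine Eq.trans (congrArg (fun t => _ ≫ t) (lift_cellValue c α a' _ _ _
        (Fibre.desc_w c (F.proj.map f) (α.cell.app a') e k hk))) ?_
      refine Eq.trans ?_ (lift_cellValue_comp c α a e _ _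
        (Fibre.lift_w c (α.cell.app a) e) _).symm
      exact (Fibre.lift_desc c (F.proj.map f) (α.cell.app a') e k hk).trans
        (Fibre.lift_desc c (α.cell.app a) (G.proj.map (α.hat.map f)) e k hk').symm

/-- The structure 2-cell of the unit at a 1-cell. -/
noncomputable def cell : app c F ≫ LowerStar.map c (UpperStar.map c α) ⟶ α ≫ app c G :=
  LaxSlice.Hom₂.mk (f := app c F ≫ LowerStar.map c (UpperStar.map c α)) (g := α ≫ app c G)
    (cellHat c α) (fun a => by
      refine Eq.trans (congrArg (fun t => t ≫ _) (Category.id_comp (𝟙 (F.proj.obj a)))) ?_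
      exact (Category.id_comp (α.cell.app a)).trans (Category.comp_id (α.cell.app a)).symm)

theorem isIdCell_cell (hα : LaxSlice.IsTight α) : IsIdCell (cell c α) := by
  rw [LaxSlice.isTight_iff] at hα
  refine LaxSlice.isIdCell_iff.2 fun a => ?_
  change IsEqToHom (cellApp c α a)
  refine Sect.isEqToHom (hα a) fun e e' g hg h => ?_
  refine Pull.isEqToHom (f := cellValue c α a e e' g hg) (IsEqToHom.id (α.hat.obj a)) ?_
  -- The chosen lift is an identity as `α` is tight, so its vertical complement in the identity `g`
  -- is one too.
  refine IsEqToHom.of_comp_left (f := c.lift (α.cell.app a) (Fibre.obj e) (Fibre.obj_w e))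
    (c.isEqToHom_lift (hα a)) ?_
  rw [show c.lift (α.cell.app a) (Fibre.obj e) (Fibre.obj_w e) ≫
    Pull.Hom.fib (cellValue c α a e e' g hg) = g from lift_cellValue c α a _ _ _ _]
  exact h

/-- Evaluated at `k` and restricted along the lift of `α_a`, both sides equal `k`. -/
theorem cell_naturality {β : F ⟶ G} (θ : α ⟶ β) :
    cell c α ≫ θ ▷ app c G =
      app c F ◁ LowerStar.map₂ c (UpperStar.map₂ c θ) ≫ cell c β := by
  refine LaxSlice.hom₂_ext fun (a : F.dom) => ?_
  change cellApp c α a ≫ (hat c G.proj).map (θ.hat.app a) =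
    LowerStar.hat₂App c (UpperStar.map₂ c θ) (sect c F.proj a) ≫ cellApp c β a
  refine Sect.hom_ext ((θ.w a).trans (Category.id_comp _).symm) fun e e' k hk hk' => ?_
  have hk₁ : τ.IsHomLift (β.cell.app a) k := by
    have := hk'
    rwa [show Sect.Hom.base (LowerStar.hat₂App c (UpperStar.map₂ c θ) (sect c F.proj a) ≫
      cellApp c β a) = β.cell.app a from Category.id_comp _] at this
  -- The first factor lies over an identity, so the composite may be computed with the factorization
  -- `𝟙 ≫ k`.
  refine Eq.trans ?_ (Sect.compApp_eq (LowerStar.hat₂App c (UpperStar.map₂ c θ) (sect c F.proj a))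
    (cellApp c β a) e e' k hk' e (𝟙 _) k (IsHomLift.id e.2) hk₁ (Category.id_comp _)).symm
  refine Eq.trans ?_ (congrArg (fun t => t ≫ cellValue c β a e e' k hk₁)
    (LowerStar.hat₂Map_id c (UpperStar.map₂ c θ) (sect c F.proj a) e)).symm
  refine UpperStar.hat_hom_ext c ((Category.id_comp _).trans (Category.comp_id _).symm) ?_
  refine (lift_cellValue_comp c α a e _ _ (Fibre.lift_w c (α.cell.app a) e) _).trans ?_
  refine (Fibre.lift_desc c (α.cell.app a) (G.proj.map (θ.hat.app a)) e k hk).trans ?_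
  refine Eq.trans ?_ (UpperStar.lift_hat₂App_assoc c θ
    ((fibreFunctor F.proj a).obj e) (Pull.Hom.fib (cellValue c β a e e' k hk₁))).symm
  exact (lift_cellValue c β a e e' k hk₁).symm

/-- Vertical factors through the lifts of `α` and then `β` give the vertical factor through the lift
of the composite, by splitness. The comparison `j` may be any identity cell, which avoids unfolding
that of the 2-functor `τ_* τ*`. -/
theorem cell_comp {H : LaxSlice B} (β : G ⟶ H)
    {j : LowerStar.map c (UpperStar.map c α) ≫ LowerStar.map c (UpperStar.map c β) ⟶
      LowerStar.map c (UpperStar.map c (α ≫ β))} (hj : IsIdCell j) :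
    app c F ◁ j ≫ cell c (α ≫ β) =
      (α_ _ _ _).inv ≫ cell c α ▷ LowerStar.map c (UpperStar.map c β) ≫ (α_ _ _ _).hom ≫
        α ◁ cell c β ≫ (α_ _ _ _).inv := by
  refine LaxSlice.hom₂_ext fun (a : F.dom) => ?_
  have hja := LaxSlice.isIdCell_iff.1 hj (sect c F.proj a)
  -- The middle term is the right-hand pasting with its associators, whose components are
  -- identities, removed.
  refine Eq.trans (b := (LowerStar.hat c (UpperStar.map c β)).map (cellApp c α a) ≫
    cellApp c β (α.hat.obj a)) ?_ ?_
  · refine Sect.hom_ext ?_ fun e e' k hk hk' => ?_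
    · refine (congrArg (fun t => t ≫ _) (Sect.isEqToHom_base hja).eq_id).trans ?_
      exact Category.id_comp _
    · have hk₁ : τ.IsHomLift ((α ≫ β).cell.app a) k := hk'
      have hJ : τ.IsHomLift (Sect.Hom.base ((LaxSlice.Hom₂.hat j).app (sect c F.proj a)))
          (𝟙 (Fibre.obj e)) := by
        rw [(Sect.isEqToHom_base hja).eq_id]
        exact IsHomLift.id e.2
      refine (Sect.compApp_eq ((LaxSlice.Hom₂.hat j).app (sect c F.proj a)) (cellApp c (α ≫ β) a)
        e e' k hk e (𝟙 _) k hJ hk₁ (Category.id_comp _)).trans ?_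
      refine UpperStar.comp_hom_ext c (p := (fibreFunctor F.proj a).obj e)
        (Sect.isEqToHom_app hja hJ (IsEqToHom.id _)) ?_ ?_
      · exact ((Category.comp_id _).trans (β.hat.map_id _)).symm
      · refine (lift_cellValue c (α ≫ β) a e e' k hk₁).trans ?_
        refine Eq.trans ?_ (congrArg (fun t => UpperStar.hatLift c α _ ≫ t)
          (lift_hat_map_comp c β _ _)).symm
        refine Eq.trans ?_ (Category.assoc _ _ _)
        refine Eq.trans ?_ (congrArg₂ (fun s t => s ≫ t)
          (lift_cellValue c α a _ _ _ (Fibre.lift_w c (α.cell.app a) e))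
          (lift_cellValue c β (α.hat.obj a) _ _ _
            (Fibre.desc_w c (α.cell.app a) (β.cell.app (α.hat.obj a)) e k hk'))).symm
        exact (Fibre.lift_desc c (α.cell.app a) (β.cell.app (α.hat.obj a)) e k hk').symm
  · refine Eq.symm ((Category.id_comp _).trans ?_)
    refine congrArg (fun t => _ ≫ t) ((Category.id_comp _).trans (Category.comp_id _))

end

end Unit

end

/-! ### Assembling the lax natural unit -/

/-- Lax naturality with respect to identities, when the structure 2-cell is an identity. -/
theorem laxTrans_naturality_id_of_isIdCell {S : Type u₁} [Bicategory.{w₁, v₁} S] {T : Type u₂}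
    [Bicategory.{w₂, v₂} T] [Bicategory.Strict T] {F G : StrictPseudofunctor S T} {a : S}
    {e : F.obj a ⟶ G.obj a} {n : e ≫ G.map (𝟙 a) ⟶ F.map (𝟙 a) ≫ e} (hn : IsIdCell n) :
    e ◁ (G.mapId a).inv ≫ n = (ρ_ e).hom ≫ (λ_ e).inv ≫ (F.mapId a).inv ▷ e :=
  IsIdCell.ext (((IsIdCell.mapId_inv G a).whiskerLeft e).comp hn)
    ((IsIdCell.rightUnitor_hom _).comp ((IsIdCell.leftUnitor_inv _).comp
      ((IsIdCell.mapId_inv F a).whiskerRight e)))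

/-- Lax naturality with respect to composition, when the structure 2-cells are identities. -/
theorem laxTrans_naturality_comp_of_isIdCell {S : Type u₁} [Bicategory.{w₁, v₁} S] {T : Type u₂}
    [Bicategory.{w₂, v₂} T] [Bicategory.Strict T] {F G : StrictPseudofunctor S T} {a b c : S}
    {f : a ⟶ b} {g : b ⟶ c} {x : F.obj a ⟶ G.obj a} {y : F.obj b ⟶ G.obj b}
    {z : F.obj c ⟶ G.obj c} {m : x ≫ G.map f ⟶ F.map f ≫ y} {n : y ≫ G.map g ⟶ F.map g ≫ z}
    {k : x ≫ G.map (f ≫ g) ⟶ F.map (f ≫ g) ≫ z} (hm : IsIdCell m) (hn : IsIdCell n)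
    (hk : IsIdCell k) :
    x ◁ (G.mapComp f g).inv ≫ k =
      (α_ _ _ _).inv ≫ m ▷ G.map g ≫ (α_ _ _ _).hom ≫ F.map f ◁ n ≫ (α_ _ _ _).inv ≫
        (F.mapComp f g).inv ▷ z :=
  IsIdCell.ext (((IsIdCell.mapComp_inv G f g).whiskerLeft x).comp hk)
    ((IsIdCell.associator_inv _ _ _).comp ((hm.whiskerRight _).comp
      ((IsIdCell.associator_hom _ _ _).comp ((hn.whiskerLeft _).comp
        ((IsIdCell.associator_inv _ _ _).comp ((IsIdCell.mapComp_inv F f g).whiskerRight z))))))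

/-- Absorbs the comparison cell of the identity 2-functor, which ends the composition law of the
unit. -/
theorem comp_id_whiskerRight {S : Type u₁} [Bicategory.{w₁, v₁} S] {a b c : S} {f : a ⟶ b}
    {g : b ⟶ c} {h : a ⟶ c} {t : h ⟶ f ≫ g} : t = t ≫ 𝟙 f ▷ g := by
  rw [id_whiskerRight, Category.comp_id]

section

variable {E B : Type u} [Category.{u} E] [Category.{u} B] {τ : E ⥤ B}

/-- The unit of change of base along `τ`. -/
noncomputable def unit (c : SplitOpfibration τ) :
    Lax.LaxTrans (StrictPseudofunctor.id (LaxSlice B)).toLax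
      ((upperStar c).toStrictPseudofunctor.comp (lowerStar c).toStrictPseudofunctor).toLax where
  app F := Unit.app c F
  naturality α := Unit.cell c α
  naturality_naturality θ := Unit.cell_naturality c _ θ
  naturality_id F := laxTrans_naturality_id_of_isIdCell (F := StrictPseudofunctor.id (LaxSlice B))
    (G := (upperStar c).toStrictPseudofunctor.comp (lowerStar c).toStrictPseudofunctor)
    (Unit.isIdCell_cell c (𝟙 F) (FCategory.tight_id F))
  naturality_comp α β :=
    (Unit.cell_comp c α β (IsIdCell.mapComp_inv
      ((upperStar c).toStrictPseudofunctor.comp (lowerStar c).toStrictPseudofunctor) α β)).trans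
      (by
        refine congrArg (fun t => _ ≫ t) (congrArg (fun t => _ ≫ t) (congrArg (fun t => _ ≫ t)
          (congrArg (fun t => _ ≫ t) ?_)))
        exact comp_id_whiskerRight)

/-! ### The counit -/

namespace Counit

variable (c : SplitOpfibration τ)

section

variable {G H : LaxSlice E} (ψ : G ⟶ H)

/-- The chosen lift of an identity, as a morphism of the fibre. -/
noncomputable def vertical (x : Pull τ (Sect.toBase c G.proj)) :
    (Functor.Fiber.mk x.w : τ.Fiber x.base.base) ⟶
      Functor.Fiber.mk ((UpperStar.hat c (LowerStar.map c ψ)).obj x).w :=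
  Fibre.homMk (UpperStar.hatLift c (LowerStar.map c ψ) x) (c.lift_isHomLift _ _ _)

/-- The triangle cell of `τ_* ψ` consists of identities, and the cleavage is normal. -/
theorem isEqToHom_vertical (x : Pull τ (Sect.toBase c G.proj)) :
    IsEqToHom (vertical c ψ x) :=
  Fibre.isEqToHom (c.isEqToHom_lift (IsEqToHom.id x.base.base))

/-- The structure 2-cell of the counit, which is an identity. -/
noncomputable def cell : evaluation c G ≫ ψ ⟶
    UpperStar.map c (LowerStar.map c ψ) ≫ evaluation c H :=
  LaxSlice.Hom₂.mk (f := evaluation c G ≫ ψ)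
    (g := UpperStar.map c (LowerStar.map c ψ) ≫ evaluation c H)
    { app := fun x : Pull τ (Sect.toBase c G.proj) => ψ.hat.map (x.base.hat.map (vertical c ψ x))
      naturality := fun (x y : Pull τ (Sect.toBase c G.proj)) f => by
        refine (ψ.hat.map_comp _ _).symm.trans (Eq.trans ?_ (ψ.hat.map_comp _ _))
        refine congrArg ψ.hat.map ?_
        have h1 := Sect.Hom.postcomp f.base (Functor.Fiber.mk x.w) (e' := Functor.Fiber.mk y.w)
          f.fib (vertical c ψ y) f.w
        have h2 := Sect.Hom.precomp f.base (vertical c ψ x)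
          (Functor.Fiber.mk ((UpperStar.hat c (LowerStar.map c ψ)).obj y).w)
          (Pull.Hom.fib ((UpperStar.hat c (LowerStar.map c ψ)).map f))
          (Pull.Hom.w ((UpperStar.hat c (LowerStar.map c ψ)).map f))
        refine h1.symm.trans (Eq.trans ?_ h2)
        exact Sect.Hom.app_congr f.base
          (UpperStar.lift_hat_map c (LowerStar.map c ψ) f).symm _ _ }
    (fun (x : Pull τ (Sect.toBase c G.proj)) =>
      (((LowerStar.hat c ψ).obj x.base).cell.naturality (vertical c ψ x)).symm)

theorem isIdCell_cell : IsIdCell (cell c ψ) :=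
  LaxSlice.isIdCell_iff.2 fun x =>
    ((isEqToHom_vertical c ψ x).map x.base.hat).map ψ.hat

theorem cell_naturality {χ : G ⟶ H} (δ : ψ ⟶ χ) :
    cell c ψ ≫ UpperStar.map₂ c (LowerStar.map₂ c δ) ▷ evaluation c H =
      evaluation c G ◁ δ ≫ cell c χ := by
  refine LaxSlice.hom₂_ext fun (x : Pull τ (Sect.toBase c G.proj)) => ?_
  -- Both sides are the value of `hat₂Map` at the vertical morphism for `χ`: on the left the
  -- vertical morphism for `ψ` is absorbed into it, on the right it is split off from an identity.
  refine (LowerStar.hat₂Map_comp c δ x.base (vertical c ψ x) (Fibre.homMk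
    (e' := Functor.Fiber.mk ((UpperStar.hat c (LowerStar.map c χ)).obj x).w)
    (Pull.Hom.fib (UpperStar.hat₂App c (LowerStar.map₂ c δ) x))
    (Pull.Hom.w (UpperStar.hat₂App c (LowerStar.map₂ c δ) x)))).symm.trans ?_
  refine (congrArg (LowerStar.hat₂Map c δ x.base) (Subtype.ext
    (UpperStar.lift_hat₂App c (LowerStar.map₂ c δ) x))).trans
      (a := LowerStar.hat₂Map c δ x.base _) (b := LowerStar.hat₂Map c δ x.base (vertical c χ x)) ?_
  refine (congrArg (LowerStar.hat₂Map c δ x.base) (Category.id_comp (vertical c χ x))).symm.trans ?_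
  refine (LowerStar.hat₂Map_comp' c δ x.base (𝟙 _) (vertical c χ x)).trans ?_
  exact congrArg (fun t => t ≫ χ.hat.map (x.base.hat.map (vertical c χ x)))
    (LowerStar.hat₂Map_id c δ x.base _)

end

end Counit

/-- The counit of change of base along `τ`. -/
noncomputable def counit (c : SplitOpfibration τ) :
    Lax.LaxTrans
      ((lowerStar c).toStrictPseudofunctor.comp (upperStar c).toStrictPseudofunctor).toLax
      (StrictPseudofunctor.id (LaxSlice E)).toLax where
  app H := evaluation c H
  naturality ψ := Counit.cell c ψ
  naturality_naturality δ := Counit.cell_naturality c _ δ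
  naturality_id H := laxTrans_naturality_id_of_isIdCell (G := StrictPseudofunctor.id (LaxSlice E))
    (F := (lowerStar c).toStrictPseudofunctor.comp (upperStar c).toStrictPseudofunctor)
    (Counit.isIdCell_cell c (𝟙 H))
  naturality_comp ψ χ := laxTrans_naturality_comp_of_isIdCell
    (G := StrictPseudofunctor.id (LaxSlice E))
    (F := (lowerStar c).toStrictPseudofunctor.comp (upperStar c).toStrictPseudofunctor)
    (Counit.isIdCell_cell c ψ) (Counit.isIdCell_cell c χ) (Counit.isIdCell_cell c (ψ ≫ χ))

end

/-! ### Lax adjunctions with identity modifications -/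

/-- Treats the factor of the naturality law of `s` that contains `F(η_f)`, conjugated by comparison
cells; only its whiskering with the counit is an identity. -/
theorem IsIdCell.conj_whiskerRight {S : Type u₁} [Bicategory.{w₁, v₁} S] {a b d : S}
    {f' f g g' : a ⟶ b} {i : f' ⟶ f} {θ : f ⟶ g} {j : g ⟶ g'} {h : b ⟶ d} (hi : IsIdCell i)
    (hj : IsIdCell j) (hθ : IsIdCell (θ ▷ h)) : IsIdCell ((i ≫ θ ≫ j) ▷ h) := by
  rw [comp_whiskerRight, comp_whiskerRight]
  exact (hi.whiskerRight h).comp (hθ.comp (hj.whiskerRight h))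

/-- A lax adjunction whose modifications are identities: the laws hold as soon as the structure
2-cells involved are identities. -/
def LaxAdjunction.ofIsIdCell {S : Type u₁} [Bicategory.{w₁, v₁} S] [Bicategory.Strict S]
    {T : Type u₂} [Bicategory.{w₂, v₂} T] [Bicategory.Strict T]
    {F : StrictPseudofunctor S T} {U : StrictPseudofunctor T S}
    (unit : Lax.LaxTrans (StrictPseudofunctor.id S).toLax (F.comp U).toLax)
    (counit : Lax.LaxTrans (U.comp F).toLax (StrictPseudofunctor.id T).toLax)
    (s : ∀ a : S, 𝟙 (F.obj a) ⟶ F.map (unit.app a) ≫ counit.app (F.obj a))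
    (t : ∀ b : T, unit.app (U.obj b) ≫ U.map (counit.app b) ⟶ 𝟙 (U.obj b))
    (hs : ∀ a, IsIdCell (s a)) (ht : ∀ b, IsIdCell (t b))
    (hcounit : ∀ {b b' : T} (g : b ⟶ b'), IsIdCell (counit.naturality g))
    (hunit_app : ∀ a, IsIdCell (unit.naturality (unit.app a)))
    (hunit_map : ∀ {b b' : T} (g : b ⟶ b'), IsIdCell (unit.naturality (U.map g)))
    (hunit : ∀ {a a' : S} (f : a ⟶ a'),
      IsIdCell (F.map₂ (unit.naturality f) ▷ counit.app (F.obj a'))) :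
    LaxAdjunction F U where
  unit := unit
  counit := counit
  s := s
  t := t
  s_naturality {a a'} f := by
    refine IsIdCell.ext ?_ ?_
    · exact ((hs a).whiskerRight _).comp ((IsIdCell.associator_hom _ _ _).comp
        (((hcounit _).whiskerLeft _).comp ((IsIdCell.associator_inv _ _ _).comp
          ((IsIdCell.conj_whiskerRight (IsIdCell.mapComp_inv F _ _)
            (IsIdCell.mapComp_hom F _ _) (hunit f)).comp (IsIdCell.associator_hom _ _ _)))))
    · exact (IsIdCell.leftUnitor_hom _).comp ((IsIdCell.rightUnitor_inv _).comp
        ((hs a').whiskerLeft _))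
  t_naturality {b b'} g := by
    refine IsIdCell.ext ?_ ?_
    · exact ((ht b).whiskerRight _).comp ((IsIdCell.leftUnitor_hom _).comp
        (IsIdCell.rightUnitor_inv _))
    · exact (IsIdCell.associator_hom _ _ _).comp ((((IsIdCell.mapComp_inv U _ _).comp
        (((hcounit g).map₂ U.toPrelaxFunctor).comp (IsIdCell.mapComp_hom U _ _))).whiskerLeft
          _).comp ((IsIdCell.associator_inv _ _ _).comp (((hunit_map g).whiskerRight _).comp
            ((IsIdCell.associator_hom _ _ _).comp ((ht b').whiskerLeft _)))))
  swallowtail_unit a := by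
    refine IsIdCell.ext ?_ (IsIdCell.refl _)
    exact (((IsIdCell.mapId_inv U _).comp (((hs a).map₂ U.toPrelaxFunctor).comp
      (IsIdCell.mapComp_hom U _ _))).whiskerLeft _).comp ((IsIdCell.associator_inv _ _ _).comp
        (((hunit_app a).whiskerRight _).comp ((IsIdCell.associator_hom _ _ _).comp
          ((ht _).whiskerLeft _))))
  swallowtail_counit b := by
    refine IsIdCell.ext ?_ (IsIdCell.refl _)
    exact ((hs _).whiskerRight _).comp ((IsIdCell.associator_hom _ _ _).comp
      (((hcounit _).whiskerLeft _).comp ((IsIdCell.associator_inv _ _ _).comp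
        (((IsIdCell.mapComp_inv F _ _).comp (((ht b).map₂ F.toPrelaxFunctor).comp
          (IsIdCell.mapId_hom F _))).whiskerRight _))))

/-! ### The triangle 2-cells and the adjunction -/

section

variable {E B : Type u} [Category.{u} E] [Category.{u} B] {τ : E ⥤ B} (c : SplitOpfibration τ)

/-- Allows for an extra chosen lift of an identity in front: the unit contributes one before the
lift of `α_x`. -/
theorem SplitOpfibration.isEqToHom_of_comp_lift_comp {X Y : B} {f f' : X ⟶ Y} (hf : f = f')
    {e e₁ : E} {he : τ.obj e = X} {he₁ : τ.obj e₁ = X} {l : e ⟶ e₁} (hl : IsEqToHom l)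
    {k : c.push f e₁ he₁ ⟶ c.push f' e he} {g : Y ⟶ Y} (hg : g = 𝟙 Y) (hk : τ.IsHomLift g k)
    (h : l ≫ c.lift f e₁ he₁ ≫ k = c.lift f' e he) : IsEqToHom k := by
  obtain ⟨rfl, rfl⟩ := hl
  exact c.isEqToHom_of_lift_comp hf hg hk ((Category.id_comp _).symm.trans h)

namespace Triangle

/-- The morphism to the image under `τ* η` given by the chosen lift of an identity. -/
noncomputable def unitApp (F : LaxSlice B) (x : Pull τ F.proj) :
    x ⟶ Pull.mk x.base (Pull.fib ((UpperStar.hat c (Unit.app c F)).obj x))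
      (Pull.w ((UpperStar.hat c (Unit.app c F)).obj x)) :=
  Pull.Hom.mk (𝟙 x.base) (UpperStar.hatLift c (Unit.app c F) x) (by
    rw [F.proj.map_id]
    exact c.lift_isHomLift _ _ _)

/-- The first triangle 2-cell, which is an identity. -/
noncomputable def unitCell (F : LaxSlice B) : 𝟙 (UpperStar.obj τ F) ⟶
    UpperStar.map c (Unit.app c F) ≫ evaluation c (UpperStar.obj τ F) :=
  LaxSlice.Hom₂.mk (f := 𝟙 (UpperStar.obj τ F))
    (g := UpperStar.map c (Unit.app c F) ≫ evaluation c (UpperStar.obj τ F))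
    { app := fun x : Pull τ F.proj => unitApp c F x
      naturality := fun (_ _ : Pull τ F.proj) f => Pull.hom_ext
        ((Category.comp_id (Pull.Hom.base f)).trans (Category.id_comp (Pull.Hom.base f)).symm)
        (UpperStar.lift_hat_map c (Unit.app c F) f).symm }
    (fun (x : Pull τ F.proj) => (Category.id_comp (UpperStar.hatLift c (Unit.app c F) x)).trans
      (Category.comp_id (UpperStar.hatLift c (Unit.app c F) x)).symm)

theorem isIdCell_unitCell (F : LaxSlice B) : IsIdCell (unitCell c F) :=
  LaxSlice.isIdCell_iff.2 fun (x : Pull τ F.proj) =>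
    Pull.isEqToHom (f := unitApp c F x) (IsEqToHom.id _) (c.isEqToHom_lift (IsEqToHom.id _))

/-- The components of the second triangle 2-cell. -/
noncomputable def counitApp (H : LaxSlice E) (p : Sect c H.proj) :
    (LowerStar.hat c (evaluation c H)).obj (Unit.sect c (Sect.toBase c H.proj) p) ⟶ p :=
  Sect.Hom.mk (p := (LowerStar.hat c (evaluation c H)).obj (Unit.sect c (Sect.toBase c H.proj) p))
    (q := p) (𝟙 p.base) (fun _ _ g hg => p.hat.map (Fibre.homMk g hg))
    (fun {e₀ e} v e' g hg => p.hat.map_comp v (Fibre.homMk g hg))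
    (fun e {e' e₁} g v hg => p.hat.map_comp (Fibre.homMk g hg) v)
    (fun e e' g hg => by
      refine (congrArg (fun t => t ≫ H.proj.map _) (Category.id_comp (p.cell.app e))).trans ?_
      exact (p.cell.naturality (Fibre.homMk g hg)).symm)

/-- The second triangle 2-cell, which is an identity. -/
noncomputable def counitCell (H : LaxSlice E) :
    Unit.app c (LowerStar.obj c H) ≫ LowerStar.map c (evaluation c H) ⟶ 𝟙 (LowerStar.obj c H) :=
  LaxSlice.Hom₂.mk (f := Unit.app c (LowerStar.obj c H) ≫ LowerStar.map c (evaluation c H))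
    (g := 𝟙 (LowerStar.obj c H))
    { app := fun p : Sect c H.proj => counitApp c H p
      naturality := fun (p q : Sect c H.proj) φ => by
        refine Sect.hom_ext (f := (LowerStar.hat c (evaluation c H)).map
          ((Unit.hat c (Sect.toBase c H.proj)).map φ) ≫ counitApp c H q)
          (g := counitApp c H p ≫ φ) ((Category.comp_id (Sect.Hom.base φ)).trans
            (Category.id_comp (Sect.Hom.base φ)).symm) fun (e : τ.Fiber p.base) e' g hg hg' => ?_
        have hg₀ : τ.IsHomLift (Sect.Hom.base φ) g :=
          (Category.id_comp (Sect.Hom.base φ)) ▸ (show τ.IsHomLift (𝟙 p.base ≫ Sect.Hom.base φ) g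
            from hg')
        refine (Sect.compApp_eq ((LowerStar.hat c (evaluation c H)).map
          ((Unit.hat c (Sect.toBase c H.proj)).map φ)) (counitApp c H q) e e' g hg e' g (𝟙 _) hg₀
          (IsHomLift.id e'.2) (Category.comp_id _)).trans ?_
        refine Eq.trans ?_ (Sect.compApp_eq (counitApp c H p) φ e e' g hg' e (𝟙 _) g
          (IsHomLift.id e.2) hg₀ (Category.id_comp _)).symm
        refine (congrArg (fun t => Sect.Hom.app φ e e' g hg₀ ≫ t) (q.hat.map_id e')).trans ?_
        refine (Category.comp_id _).trans (Eq.trans (Category.id_comp _).symm ?_)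
        exact congrArg (fun t => t ≫ Sect.Hom.app φ e e' g hg₀) (p.hat.map_id e).symm }
    (fun (p : Sect c H.proj) => by
      refine (congrArg (fun t => t ≫ 𝟙 p.base) (Category.id_comp (𝟙 p.base))).trans ?_
      exact Category.id_comp (𝟙 p.base))

theorem isIdCell_counitCell (H : LaxSlice E) : IsIdCell (counitCell c H) :=
  LaxSlice.isIdCell_iff.2 fun (p : Sect c H.proj) =>
    Sect.isEqToHom (φ := counitApp c H p) (IsEqToHom.id _) fun _ _ g hg h =>
      (Fibre.isEqToHom (v := Fibre.homMk g hg) h).map p.hat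

/-- Up to identities, the fibre part of `τ*(η_α)` is the chosen lift of `α_x`, and evaluation
returns its vertical factor through that same lift, an identity. This holds for loose `α`, where
`η_α` itself need not be an identity. -/
theorem isIdCell_map₂_cell {F G : LaxSlice B} (α : F ⟶ G) :
    IsIdCell (UpperStar.map₂ c (Unit.cell c α) ▷ evaluation c (UpperStar.obj τ G)) := by
  refine LaxSlice.isIdCell_iff.2 fun (x : Pull τ F.proj) => ?_
  let K := UpperStar.hat₂App c (Unit.cell c α) x
  let y := (UpperStar.hat c (Unit.app c F ≫ LowerStar.map c (UpperStar.map c α))).obj x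
  let z := (UpperStar.hat c (α ≫ Unit.app c G)).obj x
  change IsEqToHom (Unit.cellValue c α x.base (Functor.Fiber.mk y.w) (Functor.Fiber.mk z.w)
    (Pull.Hom.fib K) (Pull.Hom.w K))
  refine Pull.isEqToHom (IsEqToHom.id (α.hat.obj x.base)) ?_
  refine c.isEqToHom_of_comp_lift_comp (f := α.cell.app x.base)
    (f' := α.cell.app x.base ≫ 𝟙 (G.proj.obj (α.hat.obj x.base))) (Category.comp_id _).symm
    (l := UpperStar.hatLift c (Unit.app c F ≫ LowerStar.map c (UpperStar.map c α)) x)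
    (c.isEqToHom_lift ((IsEqToHom.id _).comp (IsEqToHom.id _))) (G.proj.map_id _)
    (Pull.Hom.w (Unit.cellValue c α x.base (Functor.Fiber.mk y.w) (Functor.Fiber.mk z.w)
      (Pull.Hom.fib K) (Pull.Hom.w K))) ?_
  -- Restricting the value along the lift of `α_x` gives the fibre part of `K`; restricting that
  -- along `l` gives the chosen lift of `α_x ≫ 𝟙`.
  refine (congrArg (fun t => _ ≫ t) (Unit.lift_cellValue c α x.base (Functor.Fiber.mk y.w)
    (Functor.Fiber.mk z.w) (Pull.Hom.fib K) (Pull.Hom.w K))).trans ?_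
  exact UpperStar.lift_hat₂App c (Unit.cell c α) x

end Triangle

/-- The lax adjunction between `τ*` and `τ_*`. -/
noncomputable def changeOfBase : LaxAdjunction (upperStar c).toStrictPseudofunctor
    (lowerStar c).toStrictPseudofunctor :=
  LaxAdjunction.ofIsIdCell (unit c) (counit c) (Triangle.unitCell c) (Triangle.counitCell c)
    (Triangle.isIdCell_unitCell c) (Triangle.isIdCell_counitCell c) (Counit.isIdCell_cell c)
    -- `η_η` is an identity because `η` is tight, and `η` at a 1-cell `τ_* g` because `τ_* g` is
    -- tight.
    (fun F => Unit.isIdCell_cell c _ (Unit.isTight_app c F))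
    (fun _ => Unit.isIdCell_cell c _ ⟨rfl, rfl⟩) (Triangle.isIdCell_map₂_cell c)

theorem isLooseFAdjunction_changeOfBase : (changeOfBase c).IsLooseFAdjunction :=
  ⟨fun f hf => Unit.isIdCell_cell c f hf, fun g _ => Counit.isIdCell_cell c g⟩

theorem isRightSemiLax_changeOfBase : (changeOfBase c).IsRightSemiLax :=
  ⟨Counit.isIdCell_cell c, Triangle.isIdCell_unitCell c⟩

theorem isStrict_changeOfBase : (changeOfBase c).IsStrict :=
  ⟨Triangle.isIdCell_unitCell c, Triangle.isIdCell_counitCell c⟩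

end

end LaxChangeOfBase

/-! ### The theorem -/

theorem mainTheorem5 {E B : Type u} [Category.{u} E] [Category.{u} B] (τ : E ⥤ B)
    (c : LaxChangeOfBase.SplitOpfibration τ) :
    (∃ adj : LaxChangeOfBase.LaxAdjunction
        (LaxChangeOfBase.upperStar c).toStrictPseudofunctor
        (LaxChangeOfBase.lowerStar c).toStrictPseudofunctor,
      adj.IsLooseFAdjunction ∧ adj.IsRightSemiLax ∧ adj.IsStrict ∧
        ∀ H : LaxChangeOfBase.LaxSlice E,
          adj.counit.app H = LaxChangeOfBase.evaluation c H) ∧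
    (∀ {A : Type u₁} [Bicategory.{w₁, v₁} A] [Bicategory.Strict A] [LaxChangeOfBase.FCategory A]
      (W : LaxChangeOfBase.FWeight.{u, u} A)
      (H : LaxChangeOfBase.FFunctor A (LaxChangeOfBase.LaxSlice B))
      (C : LaxChangeOfBase.LaxSlice B)
      (μ : LaxChangeOfBase.OplaxCocylinder W.loose H.toStrictPseudofunctor C),
      μ.IsNormal → μ.IsUniversal →
      (∀ (a : A) (X : W.loose.obj (op a)), LaxChangeOfBase.FCategory.Tight (μ.component a X)) →
      (μ.map (LaxChangeOfBase.upperStar c).toStrictPseudofunctor).IsNormal ∧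
      (μ.map (LaxChangeOfBase.upperStar c).toStrictPseudofunctor).IsUniversal ∧
      ∀ (a : A) (X : W.loose.obj (op a)), LaxChangeOfBase.FCategory.Tight
        ((μ.map (LaxChangeOfBase.upperStar c).toStrictPseudofunctor).component a X)) := by
  refine ⟨⟨LaxChangeOfBase.changeOfBase c, LaxChangeOfBase.isLooseFAdjunction_changeOfBase c,
    LaxChangeOfBase.isRightSemiLax_changeOfBase c, LaxChangeOfBase.isStrict_changeOfBase c,
    fun _ => rfl⟩, fun W H C μ hn hμ ht =>
      ⟨LaxChangeOfBase.OplaxCocylinder.isNormal_map hn, ?_,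
        fun a X => (LaxChangeOfBase.upperStar c).map_tight _ (ht a X)⟩⟩
  exact (LaxChangeOfBase.changeOfBase c).isUniversal_map
    (LaxChangeOfBase.isLooseFAdjunction_changeOfBase c)
    (LaxChangeOfBase.isRightSemiLax_changeOfBase c) (LaxChangeOfBase.isStrict_changeOfBase c)
    -- The two extra hypotheses: the unit is tight, and `τ_*` sends every 1-cell to a tight one.
    (LaxChangeOfBase.Unit.isTight_app c) (fun _ => ⟨rfl, rfl⟩) hμ ht
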